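/- Let $\mathcal A$ be a finite collection of nonzero, pairwise noncollinear vectors $\alpha\in\mathbb R^n$ with multiplicities $m_\alpha\in\mathbb N=\{0,1,2,\dots\}$, let $(\cdot,\cdot)$ be the standard inner product extended complex-bilinearly to $\mathbb C^n$, and put $x^2=(x,x)$, $\Pi_\alpha=\{x\in\mathbb R^n:(\alpha,x)=0\}$, $|m|=\sum_\alpha m_\alpha$, $\partial_\alpha=(\alpha,\partial/\partial x)$, $$A_m(x)=\prod_{\alpha\in\mathcal A}(\alpha,x)^{m_\alpha},\qquad L=\Delta-\sum_{\alpha\in\mathcal A}\frac{2m_\alpha}{(\alpha,x)}\,\partial_\alpha .$$ A function $f$ is called quasi-invariant if $\partial_\alpha f=\partial_\alpha^3f=\dots=\partial_\alpha^{2m_\alpha-1}f=0$ on $\Pi_\alpha$ for all $\alpha\in\mathcal A$; let $Q^{\mathcal A}$ be the ring of quasi-invariant polynomials with real coefficients. Let $\phi(x,\lambda)$, $x,\lambda\in\mathbb C^n$, be a Baker--Akhiezer function of $\mathcal A$: $\phi(x,\lambda)=P(x,\lambda)e^{(x,\lambda)}$, where $P$ is a polynomial in $x$ with highest degree term $A_m(x)A_m(\lambda)$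 (all other terms have degree less than $|m|$ in $x$) that depends continuously on $\lambda$, and $x\mapsto\phi(x,\lambda)$ is quasi-invariant for every $\lambda$. Assume that $\phi(0,0)\neq0$. Then for every $p\in Q^{\mathcal A}$ there is a differential operator $L_p$ in $x$ with rational coefficients such that $L_p\phi(x,\lambda)=p(\lambda)\phi(x,\lambda)$, and $L^kp=0$ for all large $k$, so that $e^{L/2}p=\sum_{k\ge0}\frac1{k!}(L/2)^kp$ is a finite sum. For all $p,q\in Q^{\mathcal A}$ and any such operator $L_p$, $L_pq$ is a polynomial with real coefficients, and the canonical bilinear form $(p,q)^{\mathcal A}=(L_pq)(0)$ satisfies $$(p,q)^{\mathcal A}=\phi(0,0)\int_{i\xi+\mathbb R^n}\frac{(e^{L/2}p)(-ix)\,(e^{L/2}q)(ix)}{A_m(x)^2}\,d\gamma(x),\qquad d\gamma(x)=(2\pi)^{-n/2}e^{-x^2/2}\,dx,$$ for every $\xi\in\mathbb R^n\setminus\bigcup_{\alpha\in\mathcal A}\Pi_\alpha$, the integral being absolutely convergent. If moreover $p$ and $q$ are harmonic, that is $Lp=Lq=0$, then $$(p,q)^{\mathcal A}=\phi(0,0)\int_{i\xi+\mathbb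 R^n}\frac{p(-ix)\,q(ix)}{A_m(x)^2}\,d\gamma(x),$$ again with an absolutely convergent integral. -/

import Mathlib

open MeasureTheory

noncomputable section

namespace BakerAkhiezer

/-- A finite collection of nonzero, pairwise noncollinear vectors in `ℝⁿ`, indexed by `ι`,
with multiplicities in `ℕ`. -/
structure Arrangement (n : ℕ) (ι : Type*) where
  vec : ι → Fin n → ℝ
  mult : ι → ℕ
  vec_ne_zero : ∀ i, vec i ≠ 0
  noncollinear : Pairwise fun i j => LinearIndependent ℝ ![vec i, vec j]

variable {n : ℕ} {ι : Type*}

/-- The inclusion `ℝⁿ ⊆ ℂⁿ`. -/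
def toComplex (x : Fin n → ℝ) : Fin n → ℂ := fun j => (x j : ℂ)

/-- The complex bilinear extension to `ℂⁿ` of the standard inner product. -/
def pairing (x y : Fin n → ℂ) : ℂ := ∑ j, x j * y j

namespace Arrangement

/-- The linear form `x ↦ (α, x)` on `ℂⁿ`, for the vector `α` with index `i`. -/
def form (A : Arrangement n ι) (i : ι) (x : Fin n → ℂ) : ℂ := pairing (toComplex (A.vec i)) x

/-- The complement in `ℂⁿ` of the (complexified) hyperplanes `(α, x) = 0`. -/
def regular (A : Arrangement n ι) : Set (Fin n → ℂ) := {x | ∀ i, A.form i x ≠ 0}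

/-- `∂_α^k f (x)`, where `∂_α = (α, ∂/∂x)`, for the vector `α` with index `i`. -/
def normalDeriv (A : Arrangement n ι) (i : ι) (k : ℕ) (f : (Fin n → ℂ) → ℂ)
    (x : Fin n → ℂ) : ℂ :=
  iteratedDeriv k (fun t : ℂ => f (x + t • toComplex (A.vec i))) 0

/-- For every `α`, the derivatives `∂_α f, ∂_α³ f, …, ∂_α^(2 m_α - 1) f` vanish at the points of
the hyperplane `Π_α ⊆ ℝⁿ`. -/
def QuasiInvariant (A : Arrangement n ι) (f : (Fin n → ℂ) → ℂ) : Prop :=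
  ∀ i, ∀ s < A.mult i, ∀ x : Fin n → ℝ, A.form i (toComplex x) = 0 →
    A.normalDeriv i (2 * s + 1) f (toComplex x) = 0

/-- The set of real polynomials that are quasi-invariant. -/
def quasiInvariants (A : Arrangement n ι) : Set (MvPolynomial (Fin n) ℝ) :=
  {p | A.QuasiInvariant fun x => MvPolynomial.aeval x p}

variable [Fintype ι]

/-- `|m| = ∑ m_α`. -/
def totalMult (A : Arrangement n ι) : ℕ := ∑ i, A.mult i

/-- `A_m(x) = ∏ (α, x)^(m_α)`. -/
def discr (A : Arrangement n ι) (x : Fin n → ℂ) : ℂ := ∏ i, A.form i x ^ A.mult i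

/-- `φ(x, λ)` is a Baker-Akhiezer function of the arrangement: `φ(x, λ) = P(x, λ) exp (x, λ)` with
`P` a polynomial in `x` with highest degree term `A_m(x) A_m(λ)` (that is, all other terms have
degree less than `|m|` in `x`), depending continuously on `λ`, and `φ(·, λ)` is quasi-invariant.
Without continuity, the values at the `λ` with `A_m(λ) = 0` would not be determined. -/
structure IsBakerAkhiezer (A : Arrangement n ι) (φ : (Fin n → ℂ) → (Fin n → ℂ) → ℂ) : Prop where
  form_eq : ∀ lam : Fin n → ℂ, ∃ R : MvPolynomial (Fin n) ℂ,
    (∀ d ∈ R.support, d.degree < A.totalMult) ∧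
    ∀ x, φ x lam = (A.discr x * A.discr lam + MvPolynomial.eval x R) * Complex.exp (pairing x lam)
  continuous_right : ∀ x, Continuous fun lam => φ x lam
  quasiInvariant : ∀ lam, A.QuasiInvariant fun x => φ x lam

end Arrangement

/-- The partial derivative `∂f/∂x_j`. -/
def partialDeriv (j : Fin n) (f : (Fin n → ℂ) → ℂ) : (Fin n → ℂ) → ℂ :=
  fun x => lineDeriv ℂ f x (Pi.single j 1)

/-- The iterated partial derivative `∂^a f` for a multi-index `a`. -/
def multiDeriv (a : Fin n →₀ ℕ) (f : (Fin n → ℂ) → ℂ) : (Fin n → ℂ) → ℂ :=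
  (List.finRange n).foldr (fun j g => (partialDeriv j)^[a j] g) f

/-- A differential operator `∑_a (num a / den) ∂^a` with rational coefficients, written with a
common denominator. -/
structure RatDiffOp (n : ℕ) where
  den : MvPolynomial (Fin n) ℂ
  den_ne_zero : den ≠ 0
  num : (Fin n →₀ ℕ) →₀ MvPolynomial (Fin n) ℂ

/-- The value of `D f` at `x`, meaningful where the denominator of `D` does not vanish. -/
def RatDiffOp.apply (D : RatDiffOp n) (f : (Fin n → ℂ) → ℂ) (x : Fin n → ℂ) : ℂ :=
  (D.num.sum fun a c => MvPolynomial.eval x c * multiDeriv a f x) / MvPolynomial.eval x D.den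

/-- `D` is an operator `L_p`: it satisfies `D φ(·, λ) = p(λ) φ(·, λ)` for all `λ`. -/
def RatDiffOp.IsAssociated (D : RatDiffOp n) (φ : (Fin n → ℂ) → (Fin n → ℂ) → ℂ)
    (p : MvPolynomial (Fin n) ℝ) : Prop :=
  ∀ lam x : Fin n → ℂ, MvPolynomial.eval x D.den ≠ 0 →
    D.apply (fun y => φ y lam) x = MvPolynomial.aeval lam p * φ x lam

namespace Arrangement

variable [Fintype ι]

/-- `L = Δ - ∑_α (2 m_α / (α, x)) ∂_α`, meaningful at regular points. -/
def L (A : Arrangement n ι) (f : (Fin n → ℂ) → ℂ) : (Fin n → ℂ) → ℂ := fun x =>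
  ∑ j, partialDeriv j (partialDeriv j f) x -
    ∑ i, 2 * (A.mult i : ℂ) / A.form i x * lineDeriv ℂ f x (toComplex (A.vec i))

/-- `exp (L/2) f = ∑_k (1/k!) (L/2)^k f`, meaningful at regular points. -/
def expHalfL (A : Arrangement n ι) (f : (Fin n → ℂ) → ℂ) : (Fin n → ℂ) → ℂ := fun x =>
  ∑' k : ℕ, A.L^[k] f x / (2 ^ k * (k.factorial : ℂ))

/-- `L p = 0`. -/
def IsHarmonic (A : Arrangement n ι) (p : MvPolynomial (Fin n) ℝ) : Prop :=
  ∀ x ∈ A.regular, A.L (fun y => MvPolynomial.aeval y p) x = 0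

/-- The density with respect to `dy` of `F(-ix) G(ix) / A_m(x)² dγ(x)` at the point `x = y + iξ`
of `iξ + ℝⁿ`, where `dγ(x) = (2π)^(-n/2) exp (-x²/2) dx`. -/
def contourDensity (A : Arrangement n ι) (F G : (Fin n → ℂ) → ℂ) (ξ y : Fin n → ℝ) : ℂ :=
  let x : Fin n → ℂ := toComplex y + Complex.I • toComplex ξ
  F (-(Complex.I • x)) * G (Complex.I • x) / A.discr x ^ 2 *
    (((2 * Real.pi) ^ (-(n : ℝ) / 2) : ℝ) * Complex.exp (-pairing x x / 2))

end Arrangement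

end BakerAkhiezer

end

open BakerAkhiezer

open MeasureTheory
open BakerAkhiezer

noncomputable section

namespace BakerAkhiezer

open MvPolynomial

variable {n : ℕ} {ι : Type*}

/-! ### Directional derivatives and linear forms -/

/-! Write φ(λ,u) = ∑_N φ_N(λ,u), where φ_N collects the terms of degree N in λ; this is `taylor`.
Both sides of the integral formula are bilinear in p and q, so it suffices to know that the φ_N(λ,·)
span the quasi-invariants and to compute both sides on them.

Algebra. If p(x)e^{(x,λ)} is quasi-invariant and λ lies off the hyperplanes, then the top degree
part of p is divisible by A_m (`discrPoly_dvd`). Hence a quasi-invariant quasi-polynomial of degree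
below |m| is zero. This rigidity has several consequences. The factor P is polynomial in λ
(`exists_biNum`). It is real, and φ(tx,λ) = φ(x,tλ). For quasi-invariant p, the product p(x)φ is a
combination of λ-derivatives of φ (`exists_operator`). Finally L_λφ = x²φ (`bispectral`), where
φ(0,0) ≠ 0 kills the one remaining constant. By scaling, φ_N(λ,·) is homogeneous of degree N, and
the bispectral equation reads Lφ_N = λ²φ_{N-2}. So e^{L/2}φ_N is the finite sum `taylorExp`.

Analysis. Put u = ix. The weight w(u) = e^{u²/2}/A_m(u)² makes L + E symmetric, E being the Euler
operator, because w(L + E)f = div(w∇f). The polynomial e^{L/2}φ_N(μ,·) is an eigenvector of L + E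
with eigenvalue N, so such polynomials with different N are orthogonal. Their integral against the
whole of φ(λ,·) is e^{-λ²/2} times the integral against φ_N(λ,·). Replacing λ by sλ and dilating the
contour along with it turns the integrand into a Gaussian concentrated near u = -sλ. The limit s → ∞
then gives the exact value (-1)^{N+|m|}(2π)^{n/2}φ_N(μ,λ) (`gaussInt_taylorExp_mul_taylor`). The
integral of a product is symmetric in the two factors, so φ_N(μ,λ) = φ_N(λ,μ), and φ itself is
symmetric (`eval_biNum_comm`). Operators in λ thereby become operators in x, which yields L_p.

Conclusion. Applying L_p componentwise gives L_pφ_N(λ,·) = ∑_i p_i(λ)φ_{N-i}(λ,·), where p_i is the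
degree i part of p. Its value at 0 is φ(0,0)p_N(λ). The orthogonality relations give the same number
for the integral once p is expanded in Taylor components. The expansion exists because a functional
that kills every φ_N(λ,·) also kills p_N (`dual_homogeneousComponent_eq_zero`). -/

/-- The derivation `(v, ∂/∂x)` on polynomials. -/
def dirDeriv (v : Fin n → ℂ) :
    Derivation ℂ (MvPolynomial (Fin n) ℂ) (MvPolynomial (Fin n) ℂ) :=
  mkDerivation ℂ fun j => C (v j)

@[simp]
lemma dirDeriv_X (v : Fin n → ℂ) (j : Fin n) : dirDeriv v (X j) = C (v j) :=
  mkDerivation_X _ _ _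

@[simp]
lemma dirDeriv_C (v : Fin n → ℂ) (c : ℂ) : dirDeriv v (C c) = 0 :=
  (dirDeriv v).map_algebraMap c

lemma dirDeriv_eq_sum (v : Fin n → ℂ) (p : MvPolynomial (Fin n) ℂ) :
    dirDeriv v p = ∑ j, C (v j) * pderiv j p := by
  classical
  induction p using MvPolynomial.induction_on with
  | C a => simp
  | add p q hp hq => simp [hp, hq, mul_add, Finset.sum_add_distrib]
  | mul_X p j hp =>
    simp only [Derivation.leibniz, dirDeriv_X, hp, pderiv_X, smul_eq_mul, mul_add,
      Finset.sum_add_distrib, Finset.mul_sum, Pi.single_apply]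
    congr 1
    · simp [mul_comm]
    · exact Finset.sum_congr rfl fun _ _ => by ring

/-- The linear form `x ↦ (v, x)` as a polynomial. -/
def linForm (v : Fin n → ℂ) : MvPolynomial (Fin n) ℂ := ∑ j, C (v j) * X j

@[simp]
lemma eval_linForm (v x : Fin n → ℂ) : eval x (linForm v) = pairing v x := by
  simp [linForm, pairing]

@[simp]
lemma dirDeriv_linForm (v w : Fin n → ℂ) : dirDeriv v (linForm w) = C (pairing v w) := by
  simp [linForm, pairing, Derivation.leibniz, mul_comm]

lemma linForm_isHomogeneous (v : Fin n → ℂ) : (linForm v).IsHomogeneous 1 :=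
  IsHomogeneous.sum _ _ _ fun _ _ => isHomogeneous_C_mul_X _ _

lemma pairing_comm (x y : Fin n → ℂ) : pairing x y = pairing y x := by
  simp [pairing, mul_comm]

lemma pairing_add_left (x y z : Fin n → ℂ) : pairing (x + y) z = pairing x z + pairing y z := by
  simp [pairing, add_mul, Finset.sum_add_distrib]

lemma pairing_add_right (x y z : Fin n → ℂ) : pairing x (y + z) = pairing x y + pairing x z := by
  simp [pairing, mul_add, Finset.sum_add_distrib]

lemma pairing_smul_left (c : ℂ) (x y : Fin n → ℂ) : pairing (c • x) y = c * pairing x y := by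
  simp [pairing, Finset.mul_sum, mul_assoc]

lemma pairing_smul_right (c : ℂ) (x y : Fin n → ℂ) : pairing x (c • y) = c * pairing x y := by
  rw [pairing_comm, pairing_smul_left, pairing_comm]

@[simp]
lemma pairing_zero_right (x : Fin n → ℂ) : pairing x 0 = 0 := by simp [pairing]

lemma pairing_neg_right (x y : Fin n → ℂ) : pairing x (-y) = -pairing x y := by
  simp [pairing]

lemma pairing_neg_left (x y : Fin n → ℂ) : pairing (-x) y = -pairing x y := by
  simp [pairing]

lemma pairing_single (v : Fin n → ℂ) (j : Fin n) : pairing v (Pi.single j 1) = v j := by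
  classical
  simp [pairing, Pi.single_apply]

lemma pairing_toComplex (x y : Fin n → ℝ) :
    pairing (toComplex x) (toComplex y) = ((∑ j, x j * y j : ℝ) : ℂ) := by
  simp [pairing, toComplex]

lemma continuous_pairing : Continuous fun q : (Fin n → ℂ) × (Fin n → ℂ) => pairing q.1 q.2 := by
  unfold pairing
  fun_prop

/-- `e^{-(x,λ)} ∘ (v, ∂/∂x) ∘ e^{(x,λ)}` on polynomials, with `c = (v, λ)`. -/
def twist (v : Fin n → ℂ) (c : ℂ) : Module.End ℂ (MvPolynomial (Fin n) ℂ) :=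
  (dirDeriv v).toLinearMap + c • LinearMap.id

lemma twist_apply (v : Fin n → ℂ) (c : ℂ) (p : MvPolynomial (Fin n) ℂ) :
    twist v c p = dirDeriv v p + c • p := rfl

lemma hasDerivAt_eval_line (p : MvPolynomial (Fin n) ℂ) (x v : Fin n → ℂ) (t : ℂ) :
    HasDerivAt (fun t : ℂ => eval (x + t • v) p) (eval (x + t • v) (dirDeriv v p)) t := by
  induction p using MvPolynomial.induction_on with
  | C a => simpa using hasDerivAt_const t a
  | add p q hp hq => simpa only [map_add] using hp.fun_add hq
  | mul_X p j hp =>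
    have hX : HasDerivAt (fun t : ℂ => x j + t * v j) (v j) t := by
      simpa using ((hasDerivAt_id t).mul_const (v j)).const_add (x j)
    have := hp.mul hX
    refine this.congr_deriv ?_ |>.congr_of_eventuallyEq ?_
    · simp [Derivation.leibniz]; ring
    · filter_upwards with s
      simp

lemma hasDerivAt_exp_pairing_line (x v lam : Fin n → ℂ) (t : ℂ) :
    HasDerivAt (fun t : ℂ => Complex.exp (pairing (x + t • v) lam))
      (pairing v lam * Complex.exp (pairing (x + t • v) lam)) t := by
  have h : HasDerivAt (fun t : ℂ => pairing (x + t • v) lam) (pairing v lam) t := by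
    simp only [pairing_add_left, pairing_smul_left]
    simpa using ((hasDerivAt_id t).mul_const (pairing v lam)).const_add (pairing x lam)
  simpa [mul_comm] using h.cexp

lemma hasDerivAt_polyExp_line (p : MvPolynomial (Fin n) ℂ) (x v lam : Fin n → ℂ) (t : ℂ) :
    HasDerivAt (fun t : ℂ => eval (x + t • v) p * Complex.exp (pairing (x + t • v) lam))
      (eval (x + t • v) (twist v (pairing v lam) p) *
        Complex.exp (pairing (x + t • v) lam)) t := by
  refine ((hasDerivAt_eval_line p x v t).mul (hasDerivAt_exp_pairing_line x v lam t)).congr_deriv ?_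
  simp [twist_apply, smul_eval]
  ring

lemma lineDeriv_polyExp (p : MvPolynomial (Fin n) ℂ) (x v lam : Fin n → ℂ) :
    lineDeriv ℂ (fun y => eval y p * Complex.exp (pairing y lam)) x v =
      eval x (twist v (pairing v lam) p) * Complex.exp (pairing x lam) := by
  simpa [lineDeriv] using (hasDerivAt_polyExp_line p x v lam 0).deriv

lemma lineDeriv_eval (p : MvPolynomial (Fin n) ℂ) (x v : Fin n → ℂ) :
    lineDeriv ℂ (fun y => eval y p) x v = eval x (dirDeriv v p) := by
  simpa [lineDeriv] using (hasDerivAt_eval_line p x v 0).deriv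

lemma iteratedDeriv_polyExp_line (p : MvPolynomial (Fin n) ℂ) (x v lam : Fin n → ℂ) (k : ℕ) :
    iteratedDeriv k (fun t : ℂ => eval (x + t • v) p * Complex.exp (pairing (x + t • v) lam)) =
      fun t => eval (x + t • v) ((twist v (pairing v lam) ^ k) p) *
        Complex.exp (pairing (x + t • v) lam) := by
  induction k with
  | zero => simp
  | succ k ih =>
    funext t
    rw [iteratedDeriv_succ, ih, (hasDerivAt_polyExp_line _ x v lam t).deriv, pow_succ',
      Module.End.mul_apply]

/-! ### Restriction to a hyperplane -/

/-- Composition with the orthogonal projection to the hyperplane `(v, x) = 0`. -/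
def restr (v : Fin n → ℂ) : MvPolynomial (Fin n) ℂ →ₐ[ℂ] MvPolynomial (Fin n) ℂ :=
  aeval fun j => X j - C (v j / pairing v v) * linForm v

lemma eval_restr (v x : Fin n → ℂ) (p : MvPolynomial (Fin n) ℂ) :
    eval x (restr v p) = eval (x - (pairing v x / pairing v v) • v) p := by
  induction p using MvPolynomial.induction_on with
  | C a => simp [restr]
  | add p q hp hq => simp [hp, hq]
  | mul_X p j hp =>
    rw [map_mul, map_mul, hp, map_mul]
    simp [restr]
    left
    ring

lemma eval_restr_of_pairing_eq_zero {v x : Fin n → ℂ} (h : pairing v x = 0)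
    (p : MvPolynomial (Fin n) ℂ) : eval x (restr v p) = eval x p := by
  rw [eval_restr, h]
  simp

lemma pairing_proj {v : Fin n → ℂ} (hv : pairing v v ≠ 0) (x : Fin n → ℂ) :
    pairing v (x - (pairing v x / pairing v v) • v) = 0 := by
  rw [sub_eq_add_neg, ← neg_smul, pairing_add_right, pairing_smul_right]
  field_simp
  ring

lemma restr_linForm {v : Fin n → ℂ} (hv : pairing v v ≠ 0) : restr v (linForm v) = 0 := by
  refine MvPolynomial.funext fun x => ?_
  rw [eval_restr, eval_linForm, pairing_proj hv, map_zero]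

lemma linForm_dvd_sub_restr (v : Fin n → ℂ) (p : MvPolynomial (Fin n) ℂ) :
    linForm v ∣ p - restr v p := by
  induction p using MvPolynomial.induction_on with
  | C a => simp [restr]
  | add p q hp hq =>
    rw [map_add, add_sub_add_comm]
    exact dvd_add hp hq
  | mul_X p j hp =>
    have : p * X j - restr v (p * X j) =
        (p - restr v p) * X j + restr v p * (C (v j / pairing v v)) * linForm v := by
      rw [map_mul]
      simp only [restr, aeval_X]
      ring
    rw [this]
    exact dvd_add (hp.mul_right _) (dvd_mul_left _ _)

lemma linForm_dvd_iff {v : Fin n → ℂ} (hv : pairing v v ≠ 0) (p : MvPolynomial (Fin n) ℂ) :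
    linForm v ∣ p ↔ restr v p = 0 := by
  constructor
  · rintro ⟨q, rfl⟩
    rw [map_mul, restr_linForm hv, zero_mul]
  · intro h
    simpa [h] using linForm_dvd_sub_restr v p

lemma linForm_ne_zero {v : Fin n → ℂ} (hv : pairing v v ≠ 0) : linForm v ≠ 0 := by
  intro h
  apply hv
  rw [← eval_linForm, h, map_zero]

lemma linForm_prime {v : Fin n → ℂ} (hv : pairing v v ≠ 0) : Prime (linForm v) := by
  refine ⟨linForm_ne_zero hv, fun hu => ?_, fun a b h => ?_⟩
  · have := hu.map (restr v)
    rw [restr_linForm hv] at this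
    exact not_isUnit_zero this
  · simp only [linForm_dvd_iff hv, map_mul, mul_eq_zero] at h ⊢
    exact h

lemma restr_isHomogeneous (v : Fin n → ℂ) {p : MvPolynomial (Fin n) ℂ} {d : ℕ}
    (hp : p.IsHomogeneous d) : (restr v p).IsHomogeneous d := by
  have := hp.aeval (fun j => X j - C (v j / pairing v v) * linForm v) (n := 1) fun j =>
    (isHomogeneous_X _ _).sub ((linForm_isHomogeneous v).C_mul _)
  rwa [one_mul] at this

/-- A polynomial vanishes on a real hyperplane only if it is divisible by its equation. -/
lemma restr_eq_zero_iff_real {v : Fin n → ℝ} (hv : pairing (toComplex v) (toComplex v) ≠ 0)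
    (p : MvPolynomial (Fin n) ℂ) :
    restr (toComplex v) p = 0 ↔
      ∀ x : Fin n → ℝ, pairing (toComplex v) (toComplex x) = 0 → eval (toComplex x) p = 0 := by
  constructor
  · intro h x hx
    rw [← eval_restr_of_pairing_eq_zero hx, h, map_zero]
  · intro h
    refine MvPolynomial.funext_set (fun _ => Set.range ((↑) : ℝ → ℂ))
      (fun _ => Set.infinite_range_of_injective Complex.ofReal_injective) fun x hx => ?_
    have hx' : ∀ j, ∃ r : ℝ, (r : ℂ) = x j := fun j => hx j (Set.mem_univ j)
    choose y hy using hx'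
    have hxy : x = toComplex y := funext fun j => (hy j).symm
    subst hxy
    rw [eval_restr, map_zero]
    -- Projection along a real vector sends real points to real points, so the hypothesis about real
    -- points of the hyperplane controls `restr` on the Zariski dense set ℝⁿ.
    have key : toComplex y - (pairing (toComplex v) (toComplex y) /
        pairing (toComplex v) (toComplex v)) • toComplex v =
        toComplex (y - ((∑ j, v j * y j) / ∑ j, v j * v j) • v) := by
      rw [pairing_toComplex, pairing_toComplex]
      funext j
      simp [toComplex]
    have h0 := pairing_proj hv (toComplex y)
    rw [key] at h0 ⊢
    exact h _ h0

/-! ### Homogeneous components and degrees -/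

lemma ext_homogeneousComponent {p : MvPolynomial (Fin n) ℂ}
    (h : ∀ r, homogeneousComponent r p = 0) : p = 0 := by
  rw [← sum_homogeneousComponent p]
  exact Finset.sum_eq_zero fun r _ => h r

lemma dirDeriv_isHomogeneous (v : Fin n → ℂ) {p : MvPolynomial (Fin n) ℂ} {d : ℕ}
    (hp : p.IsHomogeneous (d + 1)) : (dirDeriv v p).IsHomogeneous d := by
  rw [dirDeriv_eq_sum]
  exact IsHomogeneous.sum _ _ _ fun j _ => (hp.pderiv (i := j)).C_mul _

lemma homogeneousComponent_dirDeriv (v : Fin n → ℂ) (r : ℕ) (p : MvPolynomial (Fin n) ℂ) :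
    homogeneousComponent r (dirDeriv v p) = dirDeriv v (homogeneousComponent (r + 1) p) := by
  induction p using MvPolynomial.induction_on' with
  | add p q hp hq => simp [hp, hq]
  | monomial a c =>
    have hm : (monomial a c).IsHomogeneous a.degree := isHomogeneous_monomial c rfl
    rcases Nat.eq_zero_or_pos a.degree with h0 | h0
    · have ha : a = 0 := (Finsupp.degree_eq_zero_iff a).mp h0
      subst ha
      change homogeneousComponent r (dirDeriv v (C c)) =
        dirDeriv v (homogeneousComponent (r + 1) (C c))
      rw [dirDeriv_C, homogeneousComponent_of_mem (isHomogeneous_C (Fin n) c)]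
      simp
    · obtain ⟨d, hd⟩ := Nat.exists_eq_succ_of_ne_zero h0.ne'
      rw [hd] at hm
      rw [homogeneousComponent_of_mem hm,
        homogeneousComponent_of_mem (dirDeriv_isHomogeneous v hm)]
      by_cases h : r = d
      · simp [h]
      · simp [h]

lemma homogeneousComponent_dirDeriv_pow (v : Fin n → ℂ) (j r : ℕ) (p : MvPolynomial (Fin n) ℂ) :
    homogeneousComponent r (((dirDeriv v).toLinearMap ^ j) p) =
      ((dirDeriv v).toLinearMap ^ j) (homogeneousComponent (r + j) p) := by
  induction j generalizing r with
  | zero => simp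
  | succ j ih =>
    rw [pow_succ', Module.End.mul_apply, Module.End.mul_apply]
    change homogeneousComponent r (dirDeriv v _) = dirDeriv v _
    rw [homogeneousComponent_dirDeriv, ih, add_right_comm, add_assoc]

lemma homogeneousComponent_restr (v : Fin n → ℂ) (r : ℕ) (p : MvPolynomial (Fin n) ℂ) :
    homogeneousComponent r (restr v p) = restr v (homogeneousComponent r p) := by
  induction p using MvPolynomial.induction_on' with
  | add p q hp hq => simp only [map_add, hp, hq]
  | monomial a c =>
    have hm : (monomial a c).IsHomogeneous a.degree := isHomogeneous_monomial c rfl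
    rw [homogeneousComponent_of_mem hm, homogeneousComponent_of_mem (restr_isHomogeneous v hm)]
    split_ifs <;> simp

/-- Recovers the cofactor `q` on the hyperplane, up to a nonzero constant, from the `e`-th normal
derivative. This drives the induction on the order of vanishing. -/
lemma dirDeriv_pow_linForm_pow_mul (v : Fin n → ℂ) (e : ℕ) (q : MvPolynomial (Fin n) ℂ) :
    ∃ g, ((dirDeriv v).toLinearMap ^ e) (linForm v ^ e * q) =
      C ((e.factorial : ℂ) * pairing v v ^ e) * q + linForm v * g := by
  induction e generalizing q with
  | zero => exact ⟨0, by simp⟩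
  | succ e ih =>
    obtain ⟨g, hg⟩ := ih (C ((e + 1 : ℂ) * pairing v v) * q + linForm v * dirDeriv v q)
    refine ⟨C ((e.factorial : ℂ) * pairing v v ^ e) * dirDeriv v q + g, ?_⟩
    rw [pow_succ, Module.End.mul_apply]
    have : (dirDeriv v).toLinearMap (linForm v ^ (e + 1) * q) =
        linForm v ^ e * (C ((e + 1 : ℂ) * pairing v v) * q + linForm v * dirDeriv v q) := by
      change dirDeriv v _ = _
      rw [Derivation.leibniz, Derivation.leibniz_pow, dirDeriv_linForm]
      simp only [smul_eq_mul, Nat.add_sub_cancel, map_mul, map_add, map_one, nsmul_eq_mul,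
        Nat.cast_add, Nat.cast_one, map_natCast]
      ring
    rw [this, hg, Nat.factorial_succ]
    push_cast
    simp only [map_mul, map_add, map_one, map_natCast, map_pow]
    ring

lemma twist_pow (v : Fin n → ℂ) (c : ℂ) (K : ℕ) (p : MvPolynomial (Fin n) ℂ) :
    (twist v c ^ K) p = ∑ j ∈ Finset.range (K + 1),
      ((K.choose j : ℂ) * c ^ (K - j)) • ((dirDeriv v).toLinearMap ^ j) p := by
  have hc : Commute (dirDeriv v).toLinearMap
      (c • (LinearMap.id : Module.End ℂ (MvPolynomial (Fin n) ℂ))) :=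
    (Commute.one_right (dirDeriv v).toLinearMap).smul_right c
  have hid : (c • (LinearMap.id : Module.End ℂ (MvPolynomial (Fin n) ℂ))) =
      c • (1 : Module.End ℂ (MvPolynomial (Fin n) ℂ)) := rfl
  rw [twist, hc.add_pow, LinearMap.sum_apply]
  refine Finset.sum_congr rfl fun j _ => ?_
  rw [hid, smul_pow, one_pow, mul_smul_comm, mul_one, ← nsmul_eq_mul', LinearMap.smul_apply,
    LinearMap.smul_apply, ← Nat.cast_smul_eq_nsmul ℂ, smul_smul]

/-- After division by k^K, the sum for K = 2s+1 is the value at K of ∑ u_j/(k^j j!) ·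
K(K-1)⋯(K-j+1). This polynomial in K has degree at most e < m and the m zeros 1, 3, …, 2m-1. So it
vanishes identically, and its coefficient of K^e is u_e/(k^e e!). -/
lemma leading_eq_zero_of_descFactorial {e m : ℕ} (hem : e < m) {k : ℂ} (hk : k ≠ 0) (u : ℕ → ℂ)
    (hu : ∀ j, e < j → u j = 0)
    (h : ∀ s < m, ∑ j ∈ Finset.range (2 * s + 1 + 1),
      (((2 * s + 1).choose j : ℂ) * k ^ (2 * s + 1 - j)) * u j = 0) : u e = 0 := by
  set Q : Polynomial ℂ := ∑ j ∈ Finset.range (e + 1),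
    Polynomial.C (u j / (k ^ j * (j.factorial : ℂ))) * descPochhammer ℂ j with hQ
  have hQ0 : Q = 0 := by
    refine Polynomial.eq_zero_of_natDegree_lt_card_of_eval_eq_zero' Q
      ((Finset.range m).image fun s => ((2 * s + 1 : ℕ) : ℂ)) ?_ ?_
    · intro z hz
      obtain ⟨s, hs, rfl⟩ := Finset.mem_image.mp hz
      have h1 := h s (Finset.mem_range.mp hs)
      set K := 2 * s + 1
      have h2 : Q.eval (K : ℂ) * k ^ K = ∑ j ∈ Finset.range (K + 1),
          ((K.choose j : ℂ) * k ^ (K - j)) * u j := by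
        rw [hQ, Polynomial.eval_finsetSum, Finset.sum_mul]
        have hterm : ∀ j, j ≤ K → Polynomial.eval (K : ℂ)
            (Polynomial.C (u j / (k ^ j * (j.factorial : ℂ))) * descPochhammer ℂ j) * k ^ K =
            ((K.choose j : ℂ) * k ^ (K - j)) * u j := by
          intro j hj
          rw [Polynomial.eval_mul, Polynomial.eval_C, descPochhammer_eval_eq_descFactorial,
            Nat.descFactorial_eq_factorial_mul_choose]
          have hf : (j.factorial : ℂ) ≠ 0 := by exact_mod_cast j.factorial_ne_zero
          have hkK : k ^ K = k ^ (K - j) * k ^ j := by rw [← pow_add]; congr 1; omega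
          rw [hkK]
          push_cast
          field_simp
        have hzero1 : ∀ j, K < j → Polynomial.eval (K : ℂ)
            (Polynomial.C (u j / (k ^ j * (j.factorial : ℂ))) * descPochhammer ℂ j) * k ^ K = 0 := by
          intro j hj
          rw [Polynomial.eval_mul, descPochhammer_eval_eq_descFactorial,
            Nat.descFactorial_eq_zero_iff_lt.mpr hj]
          simp
        rcases le_total e K with he | he
        · rw [← Finset.sum_subset (Finset.range_mono (Nat.succ_le_succ he))]
          · exact Finset.sum_congr rfl fun j hj => hterm j (by
              have := Finset.mem_range.mp hj; omega)
          · intro j _ hj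
            rw [hu j (by simpa using hj), mul_zero]
        · rw [← Finset.sum_subset (Finset.range_mono (Nat.succ_le_succ he))]
          · exact Finset.sum_congr rfl fun j hj => hterm j (by
              have := Finset.mem_range.mp hj; omega)
          · intro j _ hj
            exact hzero1 j (by simpa using hj)
      rw [h1] at h2
      exact (mul_eq_zero.mp h2).resolve_right (pow_ne_zero _ hk)
    · rw [Finset.card_image_of_injective _ (fun a b hab => by
        have : 2 * a + 1 = 2 * b + 1 := by exact_mod_cast hab
        omega), Finset.card_range]
      refine lt_of_le_of_lt (Polynomial.natDegree_sum_le_of_forall_le (n := e) _ _ ?_) hem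
      intro j hj
      refine (Polynomial.natDegree_C_mul_le _ _).trans ?_
      rw [descPochhammer_natDegree]
      have := Finset.mem_range.mp hj
      omega
  have hc := congrArg (fun q => Polynomial.coeff q e) hQ0
  simp only [hQ, Polynomial.finsetSum_coeff, Polynomial.coeff_C_mul, Polynomial.coeff_zero] at hc
  rw [Finset.sum_range_succ, Finset.sum_eq_zero, zero_add] at hc
  · have hlead : (descPochhammer ℂ e).coeff e = 1 := by
      have := (monic_descPochhammer ℂ e).coeff_natDegree
      rwa [descPochhammer_natDegree] at this
    rw [hlead, mul_one, div_eq_zero_iff] at hc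
    refine hc.resolve_right (mul_ne_zero (pow_ne_zero _ hk) ?_)
    exact_mod_cast e.factorial_ne_zero
  · intro j hj
    rw [Polynomial.coeff_eq_zero_of_natDegree_lt, mul_zero]
    rw [descPochhammer_natDegree]
    exact Finset.mem_range.mp hj

/-- The leading term of a quasi-invariant quasi-polynomial is divisible by `(v, x)^m`. -/
lemma linForm_pow_dvd_homogeneousComponent {v : Fin n → ℂ} (hv : pairing v v ≠ 0) {k : ℂ}
    (hk : k ≠ 0) {m d : ℕ} {p : MvPolynomial (Fin n) ℂ}
    (hd : ∀ r, d < r → homogeneousComponent r p = 0)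
    (hq : ∀ s < m, restr v ((twist v k ^ (2 * s + 1)) p) = 0) :
    linForm v ^ m ∣ homogeneousComponent d p := by
  suffices H : ∀ e ≤ m, linForm v ^ e ∣ homogeneousComponent d p from H m le_rfl
  intro e
  induction e with
  | zero => simp
  | succ e ih =>
    intro hem
    obtain ⟨q, hq'⟩ := ih (by omega)
    -- Take the degree d-e part of the odd-order conditions. The `j`-th normal derivative
    -- contributes through the component of degree d-e+j, which is zero for j > e. The preceding
    -- lemma then isolates j = e, that is, the top component of `p`.
    have key : restr v (((dirDeriv v).toLinearMap ^ e) (homogeneousComponent d p)) = 0 := by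
      rcases lt_or_ge d e with hde | hde
      · rw [ext_homogeneousComponent
          (p := ((dirDeriv v).toLinearMap ^ e) (homogeneousComponent d p)), map_zero]
        intro r
        rw [homogeneousComponent_dirDeriv_pow,
          homogeneousComponent_of_mem (homogeneousComponent_isHomogeneous d p),
          if_neg (by omega), map_zero]
      · refine MvPolynomial.funext fun x => ?_
        rw [map_zero]
        have := leading_eq_zero_of_descFactorial (e := e) (m := m) (by omega) hk
          (fun j => eval x (restr v (((dirDeriv v).toLinearMap ^ j)
            (homogeneousComponent (d - e + j) p)))) ?_ ?_
        · simpa [Nat.sub_add_cancel hde] using this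
        · intro j hj
          rw [hd _ (by omega)]
          simp
        · intro s hs
          have h1 := congrArg (fun f => eval x (homogeneousComponent (d - e) f)) (hq s hs)
          simp only [twist_pow, homogeneousComponent_restr, map_sum, map_smul,
            homogeneousComponent_dirDeriv_pow, map_zero, smul_eval] at h1
          exact h1
    rw [hq'] at key
    obtain ⟨g, hg⟩ := dirDeriv_pow_linForm_pow_mul v e q
    rw [hg, map_add, map_mul (restr v) (C _) q, map_mul (restr v) (linForm v) g, restr_linForm hv,
      zero_mul, add_zero] at key
    have hC : restr v (C ((e.factorial : ℂ) * pairing v v ^ e)) ≠ 0 := by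
      rw [restr, aeval_C]
      simp only [algebraMap_eq, ne_eq, map_eq_zero, mul_eq_zero, not_or]
      exact ⟨by exact_mod_cast e.factorial_ne_zero, pow_ne_zero _ hv⟩
    have h2 := (linForm_dvd_iff hv q).mpr ((mul_eq_zero.mp key).resolve_left hC)
    rw [hq', pow_succ]
    exact mul_dvd_mul_left _ h2

/-- Polynomials of degree less than `d`. -/
def degLT (n d : ℕ) : Submodule ℂ (MvPolynomial (Fin n) ℂ) where
  carrier := {p | ∀ r, d ≤ r → homogeneousComponent r p = 0}
  add_mem' hp hq r hr := by rw [map_add, hp r hr, hq r hr, add_zero]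
  zero_mem' r _ := map_zero _
  smul_mem' c p hp r hr := by rw [map_smul, hp r hr, smul_zero]

lemma degLT_mono {d e : ℕ} (h : d ≤ e) : degLT n d ≤ degLT n e :=
  fun _ hp r hr => hp r (h.trans hr)

lemma mem_degLT_of_isHomogeneous {d e : ℕ} {p : MvPolynomial (Fin n) ℂ} (hp : p.IsHomogeneous d)
    (h : d < e) : p ∈ degLT n e := fun r hr => by
  rw [homogeneousComponent_of_mem hp, if_neg (by omega)]

lemma mem_degLT_of_support {d : ℕ} {p : MvPolynomial (Fin n) ℂ}
    (h : ∀ a ∈ p.support, a.degree < d) : p ∈ degLT n d := fun r hr =>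
  homogeneousComponent_eq_zero' _ _ fun a ha => by have := h a ha; omega

lemma exists_mem_degLT (p : MvPolynomial (Fin n) ℂ) : ∃ d, p ∈ degLT n d :=
  ⟨p.totalDegree + 1, fun r hr => homogeneousComponent_eq_zero _ _ (by omega)⟩

lemma degLT_zero_eq {p : MvPolynomial (Fin n) ℂ} (h : p ∈ degLT n 0) : p = 0 :=
  ext_homogeneousComponent fun r => h r (Nat.zero_le r)

lemma mem_degLT_of_succ {d : ℕ} {p : MvPolynomial (Fin n) ℂ} (h : p ∈ degLT n (d + 1))
    (h0 : homogeneousComponent d p = 0) : p ∈ degLT n d := fun r hr => by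
  rcases hr.eq_or_lt with rfl | hr
  · exact h0
  · exact h r hr

lemma support_degree_lt_of_mem_degLT {d : ℕ} {p : MvPolynomial (Fin n) ℂ} (h : p ∈ degLT n d)
    {a : Fin n →₀ ℕ} (ha : a ∈ p.support) : a.degree < d := by
  by_contra hlt
  have := congrArg (coeff a) (h a.degree (by omega))
  rw [coeff_homogeneousComponent, if_pos rfl, coeff_zero] at this
  exact (mem_support_iff.mp ha) this

lemma mul_mem_degLT {d e : ℕ} {p q : MvPolynomial (Fin n) ℂ} (hp : p.IsHomogeneous e)
    (hq : q ∈ degLT n d) : p * q ∈ degLT n (e + d) := by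
  refine mem_degLT_of_support fun a ha => ?_
  classical
  have hm := support_mul p q ha
  obtain ⟨b, hb, c, hc, rfl⟩ := Finset.mem_add.mp hm
  have h1 : b.degree = e := by
    by_contra hne
    exact (mem_support_iff.mp hb) (hp.coeff_eq_zero hne)
  have h2 := support_degree_lt_of_mem_degLT hq hc
  rw [map_add, h1]
  omega

lemma exists_homogeneousComponent_ne_zero {d : ℕ} {p : MvPolynomial (Fin n) ℂ}
    (h : p ∈ degLT n d) (hp : p ≠ 0) :
    ∃ r < d, homogeneousComponent r p ≠ 0 ∧ p ∈ degLT n (r + 1) := by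
  induction d with
  | zero => exact absurd (degLT_zero_eq h) hp
  | succ d ih =>
    by_cases h0 : homogeneousComponent d p = 0
    · obtain ⟨r, hr, h1⟩ := ih (mem_degLT_of_succ h h0)
      exact ⟨r, by omega, h1⟩
    · exact ⟨d, by omega, h0, h⟩

/-! ### Quasi-invariance in terms of polynomials -/

namespace Arrangement

/-- The vector with index `i` in `ℂⁿ`. -/
def root (A : Arrangement n ι) (i : ι) : Fin n → ℂ := toComplex (A.vec i)

lemma form_eq_pairing (A : Arrangement n ι) (i : ι) (x : Fin n → ℂ) :
    A.form i x = pairing (A.root i) x := rfl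

lemma pairing_root_self (A : Arrangement n ι) (i : ι) : pairing (A.root i) (A.root i) ≠ 0 := by
  rw [root, pairing_toComplex, Complex.ofReal_ne_zero]
  intro h
  apply A.vec_ne_zero i
  funext j
  have := (Finset.sum_eq_zero_iff_of_nonneg fun j _ => mul_self_nonneg (A.vec i j)).mp h j
    (Finset.mem_univ j)
  simpa using this

/-- The polynomials `p` such that `p(x) e^{(x, λ)}` is quasi-invariant. -/
def twistedQI (A : Arrangement n ι) (lam : Fin n → ℂ) : Submodule ℂ (MvPolynomial (Fin n) ℂ) where
  carrier := {p | ∀ i, ∀ s < A.mult i,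
    restr (A.root i) ((twist (A.root i) (pairing (A.root i) lam) ^ (2 * s + 1)) p) = 0}
  add_mem' hp hq i s hs := by rw [map_add, map_add, hp i s hs, hq i s hs, add_zero]
  zero_mem' i s _ := by rw [map_zero, map_zero]
  smul_mem' c p hp i s hs := by rw [map_smul, map_smul, hp i s hs, smul_zero]

lemma quasiInvariant_polyExp_iff (A : Arrangement n ι) (lam : Fin n → ℂ)
    (p : MvPolynomial (Fin n) ℂ) :
    A.QuasiInvariant (fun x => eval x p * Complex.exp (pairing x lam)) ↔
      p ∈ A.twistedQI lam := by
  refine forall_congr' fun i => forall₂_congr fun s _ => ?_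
  rw [show A.root i = toComplex (A.vec i) from rfl,
    restr_eq_zero_iff_real (A.pairing_root_self i)]
  refine forall_congr' fun x => imp_congr_right fun _ => ?_
  rw [normalDeriv, iteratedDeriv_polyExp_line]
  simp [Complex.exp_ne_zero]

lemma not_linForm_dvd (A : Arrangement n ι) {i j : ι} (hij : i ≠ j) :
    ¬ linForm (A.root i) ∣ linForm (A.root j) := by
  rw [linForm_dvd_iff (A.pairing_root_self i)]
  intro h
  have hx : ∀ x, pairing (A.root j)
      (x - (pairing (A.root i) x / pairing (A.root i) (A.root i)) • A.root i) = 0 := fun x => by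
    rw [← eval_linForm, ← eval_restr, h, map_zero]
  have hli := (LinearIndependent.pair_iff.mp (A.noncollinear hij))
    ((∑ k, A.vec j k * A.vec i k) / ∑ k, A.vec i k * A.vec i k) (-1) ?_
  · simpa using hli.2
  · funext k
    have := hx (Pi.single k 1)
    rw [sub_eq_add_neg, pairing_add_right, pairing_neg_right, pairing_smul_right, pairing_single,
      pairing_single, root, root, pairing_toComplex, pairing_toComplex] at this
    simp only [toComplex] at this
    have h' : A.vec j k + -(A.vec i k / (∑ k, A.vec i k * A.vec i k) *
        ∑ k, A.vec j k * A.vec i k) = 0 := by exact_mod_cast this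
    simp only [Pi.add_apply, Pi.smul_apply, smul_eq_mul, Pi.zero_apply]
    rw [← neg_eq_zero, ← h']
    ring

variable [Fintype ι]

/-- `A_m` as a polynomial. -/
def discrPoly (A : Arrangement n ι) : MvPolynomial (Fin n) ℂ :=
  ∏ i, linForm (A.root i) ^ A.mult i

@[simp]
lemma eval_discrPoly (A : Arrangement n ι) (x : Fin n → ℂ) :
    eval x A.discrPoly = A.discr x := by
  simp [discrPoly, discr, form_eq_pairing]

lemma discrPoly_isHomogeneous (A : Arrangement n ι) : A.discrPoly.IsHomogeneous A.totalMult :=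
  IsHomogeneous.prod _ _ _ fun i _ => by simpa using (linForm_isHomogeneous (A.root i)).pow _

lemma discrPoly_ne_zero (A : Arrangement n ι) : A.discrPoly ≠ 0 :=
  Finset.prod_ne_zero_iff.mpr fun i _ => pow_ne_zero _ (linForm_ne_zero (A.pairing_root_self i))

lemma discr_ne_zero (A : Arrangement n ι) {x : Fin n → ℂ} (hx : x ∈ A.regular) : A.discr x ≠ 0 :=
  Finset.prod_ne_zero_iff.mpr fun i _ => pow_ne_zero _ (hx i)

/-- Each power (α,x)^{m_α} divides the leading part separately. The linear forms are prime and, by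
noncollinearity, pairwise non-associated, so the powers multiply together. Regularity of λ supplies
(α,λ) ≠ 0, without which the twisted conditions lose their force. -/
lemma discrPoly_dvd (A : Arrangement n ι) {lam : Fin n → ℂ} (hlam : lam ∈ A.regular) {d : ℕ}
    {p : MvPolynomial (Fin n) ℂ} (hp : p ∈ A.twistedQI lam) (hd : p ∈ degLT n (d + 1)) :
    A.discrPoly ∣ homogeneousComponent d p := by
  classical
  suffices H : ∀ S : Finset ι, ∏ i ∈ S, linForm (A.root i) ^ A.mult i ∣
      homogeneousComponent d p from H Finset.univ
  intro S
  induction S using Finset.induction_on with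
  | empty => simp
  | insert i S hi ih =>
    rw [Finset.prod_insert hi]
    obtain ⟨q, hq⟩ := ih
    have h1 : linForm (A.root i) ^ A.mult i ∣ homogeneousComponent d p :=
      linForm_pow_dvd_homogeneousComponent (A.pairing_root_self i) (hlam i)
        (fun r hr => hd r hr) (hp i)
    have hprime := linForm_prime (A.pairing_root_self i)
    rw [hq] at h1 ⊢
    rw [mul_comm]
    refine mul_dvd_mul_left _ (hprime.pow_dvd_of_dvd_mul_left _ ?_ h1)
    rw [hprime.dvd_finsetProd_iff]
    rintro ⟨j, hj, hdvd⟩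
    exact A.not_linForm_dvd (fun h : i = j => hi (by rwa [h])) (hprime.dvd_of_dvd_pow hdvd)

lemma totalMult_le_of_dvd (A : Arrangement n ι) {r : ℕ} {h : MvPolynomial (Fin n) ℂ}
    (hr : h.IsHomogeneous r) (h0 : h ≠ 0) (hdvd : A.discrPoly ∣ h) : A.totalMult ≤ r := by
  obtain ⟨q, rfl⟩ := hdvd
  have hq : q ≠ 0 := right_ne_zero_of_mul h0
  have := hr.totalDegree h0
  rw [totalDegree_mul_of_isDomain A.discrPoly_ne_zero hq,
    A.discrPoly_isHomogeneous.totalDegree A.discrPoly_ne_zero] at this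
  omega

/-- A quasi-invariant quasi-polynomial of degree less than `|m|` is zero. -/
lemma eq_zero_of_mem_twistedQI (A : Arrangement n ι) {lam : Fin n → ℂ} (hlam : lam ∈ A.regular)
    {p : MvPolynomial (Fin n) ℂ} (hp : p ∈ A.twistedQI lam) (hd : p ∈ degLT n A.totalMult) :
    p = 0 := by
  by_contra h0
  obtain ⟨r, hr, h1, h2⟩ := exists_homogeneousComponent_ne_zero hd h0
  have := A.totalMult_le_of_dvd (homogeneousComponent_isHomogeneous r p) h1
    (A.discrPoly_dvd hlam hp h2)
  omega

end Arrangement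

/-! ### Density of the complement of a hypersurface -/

/-- On the complex line from any point to a point where `p` does not vanish, `p` is a nonzero
polynomial in one variable, with finitely many zeros. -/
lemma dense_eval_ne_zero {p : MvPolynomial (Fin n) ℂ} (hp : p ≠ 0) :
    Dense {x : Fin n → ℂ | eval x p ≠ 0} := by
  intro x0
  obtain ⟨x1, hx1⟩ : ∃ x1, eval x1 p ≠ 0 := by
    by_contra! h
    exact hp (MvPolynomial.funext fun x => by rw [h, map_zero])
  set q : Polynomial ℂ := aeval (fun j => Polynomial.C (x0 j) +
    Polynomial.X * Polynomial.C (x1 j - x0 j)) p with hq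
  have hqe : ∀ t : ℂ, q.eval t = eval (x0 + t • (x1 - x0)) p := by
    intro t
    have : (Polynomial.evalRingHom t).comp (aeval (fun j => Polynomial.C (x0 j) +
        Polynomial.X * Polynomial.C (x1 j - x0 j))).toRingHom = eval (x0 + t • (x1 - x0)) := by
      refine MvPolynomial.ringHom_ext (fun c => ?_) (fun j => ?_) <;> simp
    exact congrArg (fun f => f p) this
  have hq0 : q ≠ 0 := by
    intro h
    apply hx1
    have := hqe 1
    rw [h] at this
    simpa using this.symm
  have hd : Dense {t : ℂ | q.eval t ≠ 0} := by
    have hfin : {t : ℂ | q.eval t = 0}.Finite := by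
      refine (q.roots.toFinset.finite_toSet).subset fun t ht => ?_
      simpa [hq0] using ht
    exact hfin.countable.dense_compl ℂ
  have hcont : Continuous fun t : ℂ => x0 + t • (x1 - x0) := by fun_prop
  have := map_mem_closure hcont (hd 0) (t := {x | eval x p ≠ 0}) fun t ht => by
    simpa [← hqe] using ht
  simpa using this

lemma continuous_eval (p : MvPolynomial (Fin n) ℂ) : Continuous fun x : Fin n → ℂ => eval x p :=
  MvPolynomial.continuous_eval p

lemma eq_of_eq_on_eval_ne_zero {p : MvPolynomial (Fin n) ℂ} (hp : p ≠ 0) {f g : (Fin n → ℂ) → ℂ}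
    (hf : Continuous f) (hg : Continuous g) (h : ∀ x, eval x p ≠ 0 → f x = g x) : f = g :=
  hf.ext_on (dense_eval_ne_zero hp) hg h

/-- A continuous function that is the quotient of two polynomials is a polynomial. -/
lemma dvd_of_continuous {d : MvPolynomial (Fin n) ℂ} (hd : d ≠ 0) :
    ∀ {N : MvPolynomial (Fin n) ℂ} {g : (Fin n → ℂ) → ℂ}, Continuous g →
      (∀ x, eval x d * g x = eval x N) → d ∣ N := by
  induction d using WfDvdMonoid.induction_on_irreducible with
  | zero => exact absurd rfl hd
  | unit u hu => exact fun _ _ => hu.dvd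
  | mul a i ha hi ih =>
    intro N g hg h
    have hprime : Prime i := hi.prime
    -- `N` vanishes wherever the irreducible factor `i` does, so the Nullstellensatz for the prime
    -- ideal (i) gives divisibility. Continuity of `g` then allows `i` to be cancelled across its
    -- zero set.
    have hiN : i ∣ N := by
      have : (Ideal.span {i}).IsPrime := (Ideal.span_singleton_prime hprime.ne_zero).mpr hprime
      rw [← Ideal.mem_span_singleton, ← IsPrime.vanishingIdeal_zeroLocus (Ideal.span {i}) (K := ℂ)]
      intro x hx
      have hx0 : eval x i = 0 := by
        simpa [aeval_eq_eval] using hx i (Ideal.mem_span_singleton_self i)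
      rw [aeval_eq_eval]
      change eval x N = 0
      rw [← h x, map_mul, hx0, zero_mul, zero_mul]
    obtain ⟨N', rfl⟩ := hiN
    refine mul_dvd_mul_left _ (ih ha hg fun x => ?_)
    refine congrFun (eq_of_eq_on_eval_ne_zero hprime.ne_zero
      (f := fun x => eval x a * g x) (g := fun x => eval x N') ?_ ?_ ?_) x
    · exact (continuous_eval a).mul hg
    · exact continuous_eval N'
    · intro y hy
      have := h y
      rw [map_mul, map_mul, mul_assoc] at this
      exact mul_left_cancel₀ hy this

namespace Arrangement

/-- The product of the linear forms of the arrangement. -/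
def formProd [Fintype ι] (A : Arrangement n ι) : MvPolynomial (Fin n) ℂ :=
  ∏ i, linForm (A.root i)

variable [Fintype ι]

lemma formProd_ne_zero (A : Arrangement n ι) : A.formProd ≠ 0 :=
  Finset.prod_ne_zero_iff.mpr fun i _ => linForm_ne_zero (A.pairing_root_self i)

lemma mem_regular_iff (A : Arrangement n ι) (x : Fin n → ℂ) :
    x ∈ A.regular ↔ eval x A.formProd ≠ 0 := by
  simp [formProd, regular, form_eq_pairing, Finset.prod_eq_zero_iff]

lemma exists_real_regular (A : Arrangement n ι) : ∃ ξ : Fin n → ℝ, toComplex ξ ∈ A.regular := by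
  by_contra! h
  refine A.formProd_ne_zero (MvPolynomial.funext_set (fun _ => Set.range ((↑) : ℝ → ℂ))
    (fun _ => Set.infinite_range_of_injective Complex.ofReal_injective) fun x hx => ?_)
  have hx' : ∀ j, ∃ r : ℝ, (r : ℂ) = x j := fun j => hx j (Set.mem_univ j)
  choose y hy using hx'
  have hxy : x = toComplex y := funext fun j => (hy j).symm
  have := h y
  rw [mem_regular_iff, not_not] at this
  rw [hxy, this, map_zero]

lemma eq_of_eq_on_regular (A : Arrangement n ι) {f g : (Fin n → ℂ) → ℂ} (hf : Continuous f)
    (hg : Continuous g) (h : ∀ x ∈ A.regular, f x = g x) : f = g :=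
  eq_of_eq_on_eval_ne_zero A.formProd_ne_zero hf hg fun x hx =>
    h x ((A.mem_regular_iff x).mpr hx)

lemma isOpen_regular (A : Arrangement n ι) : IsOpen A.regular := by
  have : A.regular = {x | eval x A.formProd ≠ 0} := Set.ext A.mem_regular_iff
  rw [this]
  exact isOpen_ne_fun (continuous_eval _) continuous_const

end Arrangement

/-! ### Polynomials in two sets of variables -/

/-- Specialization of the second set of variables. -/
def specR (lam : Fin n → ℂ) : MvPolynomial (Fin n ⊕ Fin n) ℂ →ₐ[ℂ] MvPolynomial (Fin n) ℂ :=
  aeval (Sum.elim X fun j => C (lam j))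

/-- Specialization of the first set of variables. -/
def specL (x : Fin n → ℂ) : MvPolynomial (Fin n ⊕ Fin n) ℂ →ₐ[ℂ] MvPolynomial (Fin n) ℂ :=
  aeval (Sum.elim (fun j => C (x j)) X)

lemma eval_specR (x lam : Fin n → ℂ) (W : MvPolynomial (Fin n ⊕ Fin n) ℂ) :
    eval x (specR lam W) = eval (Sum.elim x lam) W := by
  have : (eval x).comp (specR lam).toRingHom = eval (Sum.elim x lam) := by
    refine MvPolynomial.ringHom_ext (fun c => by simp [specR]) ?_
    rintro (j | j) <;> simp [specR]
  exact congrArg (fun f => f W) this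

lemma eval_specL (x lam : Fin n → ℂ) (W : MvPolynomial (Fin n ⊕ Fin n) ℂ) :
    eval lam (specL x W) = eval (Sum.elim x lam) W := by
  have : (eval lam).comp (specL x).toRingHom = eval (Sum.elim x lam) := by
    refine MvPolynomial.ringHom_ext (fun c => by simp [specL]) ?_
    rintro (j | j) <;> simp [specL]
  exact congrArg (fun f => f W) this

/-- A polynomial in the first set of variables. -/
abbrev inL (p : MvPolynomial (Fin n) ℂ) : MvPolynomial (Fin n ⊕ Fin n) ℂ := rename Sum.inl p

/-- A polynomial in the second set of variables. -/
abbrev inR (p : MvPolynomial (Fin n) ℂ) : MvPolynomial (Fin n ⊕ Fin n) ℂ := rename Sum.inr p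

@[simp]
lemma specR_inL (lam : Fin n → ℂ) (p : MvPolynomial (Fin n) ℂ) : specR lam (inL p) = p :=
  MvPolynomial.funext fun x => by
    rw [eval_specR, eval_rename]; rfl

@[simp]
lemma specR_inR (lam : Fin n → ℂ) (p : MvPolynomial (Fin n) ℂ) :
    specR lam (inR p) = C (eval lam p) :=
  MvPolynomial.funext fun x => by
    rw [eval_specR, eval_rename, eval_C]; rfl

@[simp]
lemma specL_inR (lam : Fin n → ℂ) (p : MvPolynomial (Fin n) ℂ) : specL lam (inR p) = p :=
  MvPolynomial.funext fun x => by
    rw [eval_specL, eval_rename]; rfl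

@[simp]
lemma specL_inL (lam : Fin n → ℂ) (p : MvPolynomial (Fin n) ℂ) :
    specL lam (inL p) = C (eval lam p) :=
  MvPolynomial.funext fun x => by
    rw [eval_specL, eval_rename, eval_C]; rfl

lemma biPoly_ext {W W' : MvPolynomial (Fin n ⊕ Fin n) ℂ}
    (h : ∀ x lam, eval (Sum.elim x lam) W = eval (Sum.elim x lam) W') : W = W' :=
  MvPolynomial.funext fun z => by
    simpa using h (z ∘ Sum.inl) (z ∘ Sum.inr)

@[elab_as_elim]
lemma biPoly_induction {motive : MvPolynomial (Fin n ⊕ Fin n) ℂ → Prop}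
    (add : ∀ W W', motive W → motive W' → motive (W + W'))
    (mul : ∀ p q, motive (inL p * inR q)) (W : MvPolynomial (Fin n ⊕ Fin n) ℂ) : motive W := by
  have H : W ∈ AddSubmonoid.closure (Set.range fun pq : MvPolynomial (Fin n) ℂ ×
      MvPolynomial (Fin n) ℂ => inL pq.1 * inR pq.2) := by
    induction W using MvPolynomial.induction_on with
    | C a => exact AddSubmonoid.subset_closure ⟨(C a, 1), by simp⟩
    | add p q hp hq => exact add_mem hp hq
    | mul_X W j hW =>
      induction hW using AddSubmonoid.closure_induction with
      | mem V hV =>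
        obtain ⟨⟨p, q⟩, rfl⟩ := hV
        rcases j with j | j
        · exact AddSubmonoid.subset_closure ⟨(p * X j, q), by simp; ring⟩
        · exact AddSubmonoid.subset_closure ⟨(p, q * X j), by simp; ring⟩
      | zero => simp
      | add V V' _ _ hV hV' => rw [add_mul]; exact add_mem hV hV'
  induction H using AddSubmonoid.closure_induction with
  | mem V hV => obtain ⟨⟨p, q⟩, rfl⟩ := hV; exact mul p q
  | zero => simpa using mul 0 0
  | add V V' _ _ hV hV' => exact add _ _ hV hV'

/-- Vectors depending polynomially on λ are handled through functionals: each scalar they produce is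
a polynomial in λ. This is the form of polynomial dependence that `exists_cramer` asks for. -/
lemma exists_eval_eq_dual_specR (W : MvPolynomial (Fin n ⊕ Fin n) ℂ)
    (g : MvPolynomial (Fin n) ℂ →ₗ[ℂ] ℂ) :
    ∃ q : MvPolynomial (Fin n) ℂ, ∀ lam, g (specR lam W) = eval lam q := by
  induction W using biPoly_induction with
  | add W W' h h' =>
    obtain ⟨q, hq⟩ := h
    obtain ⟨q', hq'⟩ := h'
    exact ⟨q + q', fun lam => by rw [map_add, map_add, map_add, hq, hq']⟩
  | mul p q =>
    refine ⟨C (g p) * q, fun lam => ?_⟩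
    rw [map_mul, specR_inL, specR_inR, mul_comm, ← smul_eq_C_mul, map_smul, map_mul, eval_C,
      smul_eq_mul, mul_comm]

/-- The derivation `(v, ∂/∂x)` in the first set of variables. -/
def dirDerivL (v : Fin n → ℂ) : Derivation ℂ (MvPolynomial (Fin n ⊕ Fin n) ℂ)
    (MvPolynomial (Fin n ⊕ Fin n) ℂ) :=
  mkDerivation ℂ (Sum.elim (fun j => C (v j)) 0)

/-- The derivation `(v, ∂/∂λ)` in the second set of variables. -/
def dirDerivR (v : Fin n → ℂ) : Derivation ℂ (MvPolynomial (Fin n ⊕ Fin n) ℂ)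
    (MvPolynomial (Fin n ⊕ Fin n) ℂ) :=
  mkDerivation ℂ (Sum.elim 0 fun j => C (v j))

lemma dirDerivL_inL (v : Fin n → ℂ) (p : MvPolynomial (Fin n) ℂ) :
    dirDerivL v (inL p) = inL (dirDeriv v p) := by
  induction p using MvPolynomial.induction_on with
  | C a => simp [dirDerivL]
  | add p q hp hq => simp only [map_add, hp, hq]
  | mul_X p j hp =>
    simp only [map_mul, Derivation.leibniz, hp, rename_X, dirDerivL, mkDerivation_X] at hp ⊢
    simp

lemma dirDerivL_inR (v : Fin n → ℂ) (p : MvPolynomial (Fin n) ℂ) :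
    dirDerivL v (inR p) = 0 := by
  induction p using MvPolynomial.induction_on with
  | C a => simp [dirDerivL]
  | add p q hp hq => simp only [map_add, hp, hq, add_zero]
  | mul_X p j hp =>
    simp only [map_mul, Derivation.leibniz, hp, rename_X, dirDerivL, mkDerivation_X] at hp ⊢
    simp

lemma dirDerivR_inR (v : Fin n → ℂ) (p : MvPolynomial (Fin n) ℂ) :
    dirDerivR v (inR p) = inR (dirDeriv v p) := by
  induction p using MvPolynomial.induction_on with
  | C a => simp [dirDerivR]
  | add p q hp hq => simp only [map_add, hp, hq]
  | mul_X p j hp =>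
    simp only [map_mul, Derivation.leibniz, hp, rename_X, dirDerivR, mkDerivation_X] at hp ⊢
    simp

lemma dirDerivR_inL (v : Fin n → ℂ) (p : MvPolynomial (Fin n) ℂ) :
    dirDerivR v (inL p) = 0 := by
  induction p using MvPolynomial.induction_on with
  | C a => simp [dirDerivR]
  | add p q hp hq => simp only [map_add, hp, hq, add_zero]
  | mul_X p j hp =>
    simp only [map_mul, Derivation.leibniz, hp, rename_X, dirDerivR, mkDerivation_X] at hp ⊢
    simp

lemma specR_dirDerivL (v lam : Fin n → ℂ) (W : MvPolynomial (Fin n ⊕ Fin n) ℂ) :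
    specR lam (dirDerivL v W) = dirDeriv v (specR lam W) := by
  induction W using biPoly_induction with
  | add W W' h h' => simp only [map_add, h, h']
  | mul p q =>
    simp only [Derivation.leibniz, dirDerivL_inL, dirDerivL_inR, map_add, map_mul, smul_eq_mul,
      specR_inL, specR_inR, dirDeriv_C, map_zero]

lemma specL_dirDerivR (v x : Fin n → ℂ) (W : MvPolynomial (Fin n ⊕ Fin n) ℂ) :
    specL x (dirDerivR v W) = dirDeriv v (specL x W) := by
  induction W using biPoly_induction with
  | add W W' h h' => simp only [map_add, h, h']
  | mul p q =>
    simp only [Derivation.leibniz, dirDerivR_inL, dirDerivR_inR, map_add, map_mul, smul_eq_mul,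
      specL_inL, specL_inR, dirDeriv_C, map_zero]

lemma dirDerivL_dirDerivR (v w : Fin n → ℂ) (W : MvPolynomial (Fin n ⊕ Fin n) ℂ) :
    dirDerivL v (dirDerivR w W) = dirDerivR w (dirDerivL v W) := by
  induction W using biPoly_induction with
  | add W W' h h' => simp only [map_add, h, h']
  | mul p q =>
    simp only [Derivation.leibniz, dirDerivR_inL, dirDerivR_inR, dirDerivL_inL, dirDerivL_inR,
      smul_eq_mul, mul_zero, zero_add, add_zero]
    ring

/-- `e^{-(x,λ)} ∘ (v, ∂/∂x) ∘ e^{(x,λ)}`. -/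
def twistL (v : Fin n → ℂ) : Module.End ℂ (MvPolynomial (Fin n ⊕ Fin n) ℂ) :=
  (dirDerivL v).toLinearMap + LinearMap.mulLeft ℂ (inR (linForm v))

/-- `e^{-(x,λ)} ∘ (v, ∂/∂λ) ∘ e^{(x,λ)}`. -/
def twistR (v : Fin n → ℂ) : Module.End ℂ (MvPolynomial (Fin n ⊕ Fin n) ℂ) :=
  (dirDerivR v).toLinearMap + LinearMap.mulLeft ℂ (inL (linForm v))

lemma twistL_apply (v : Fin n → ℂ) (W : MvPolynomial (Fin n ⊕ Fin n) ℂ) :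
    twistL v W = dirDerivL v W + inR (linForm v) * W := rfl

lemma twistR_apply (v : Fin n → ℂ) (W : MvPolynomial (Fin n ⊕ Fin n) ℂ) :
    twistR v W = dirDerivR v W + inL (linForm v) * W := rfl

lemma specR_twistL (v lam : Fin n → ℂ) (W : MvPolynomial (Fin n ⊕ Fin n) ℂ) :
    specR lam (twistL v W) = twist v (pairing v lam) (specR lam W) := by
  rw [twistL_apply, twist_apply, map_add, map_mul, specR_inR, specR_dirDerivL, eval_linForm,
    smul_eq_C_mul]

lemma specR_twistL_pow (v lam : Fin n → ℂ) (k : ℕ) (W : MvPolynomial (Fin n ⊕ Fin n) ℂ) :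
    specR lam ((twistL v ^ k) W) = (twist v (pairing v lam) ^ k) (specR lam W) := by
  induction k with
  | zero => rfl
  | succ k ih => rw [pow_succ', pow_succ', Module.End.mul_apply, Module.End.mul_apply,
      specR_twistL, ih]

lemma specL_twistR (v x : Fin n → ℂ) (W : MvPolynomial (Fin n ⊕ Fin n) ℂ) :
    specL x (twistR v W) = twist v (pairing v x) (specL x W) := by
  rw [twistR_apply, twist_apply, map_add, map_mul, specL_inL, specL_dirDerivR, eval_linForm,
    smul_eq_C_mul]

/-- Both operators are conjugates of partial derivatives by the same exponential e^{(x,λ)}. The two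
cross terms, each equal to (v,w), cancel. -/
lemma commute_twistL_twistR (v w : Fin n → ℂ) : Commute (twistL v) (twistR w) := by
  refine LinearMap.ext fun W => ?_
  rw [Module.End.mul_apply, Module.End.mul_apply]
  simp only [twistL_apply, twistR_apply, map_add, Derivation.leibniz, smul_eq_mul,
    dirDerivL_dirDerivR, dirDerivR_inR, dirDerivL_inL, dirDeriv_linForm, pairing_comm v w,
    rename_C]
  ring

/-! ### Linear systems depending polynomially on parameters -/

/-- Cramer's rule with parameters: the solution of a linear system with polynomial data is rational,
with one denominator for all unknowns. Independence at a single parameter value is enough to make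
that denominator nonzero. -/
lemma exists_cramer {B T : Type*} [Fintype B] [AddCommGroup T] [Module ℂ T]
    {u : B → (Fin n → ℂ) → T} {v : (Fin n → ℂ) → T}
    (hu : ∀ b, ∀ g : T →ₗ[ℂ] ℂ, ∃ q : MvPolynomial (Fin n) ℂ, ∀ lam, g (u b lam) = eval lam q)
    (hv : ∀ g : T →ₗ[ℂ] ℂ, ∃ q : MvPolynomial (Fin n) ℂ, ∀ lam, g (v lam) = eval lam q)
    {lam₁ : Fin n → ℂ} (hli : LinearIndependent ℂ fun b => u b lam₁) :
    ∃ d : MvPolynomial (Fin n) ℂ, d ≠ 0 ∧ ∃ N : B → MvPolynomial (Fin n) ℂ,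
      ∀ lam (c : B → ℂ), ∑ b, c b • u b lam = v lam → ∀ b, eval lam d * c b = eval lam (N b) := by
  classical
  -- A left inverse at `lam₁` reduces the possibly infinite system to a square one whose matrix is
  -- the identity at `lam₁`, so its determinant there is 1.
  obtain ⟨G, hG⟩ := (Fintype.linearCombination ℂ fun b => u b lam₁).exists_leftInverse_of_injective
    (LinearMap.ker_eq_bot.mpr hli.fintypeLinearCombination_injective)
  choose Q hQ using fun b b' => hu b' ((LinearMap.proj b).comp G)
  choose W hW using fun b => hv ((LinearMap.proj b).comp G)
  have hdet : ∀ lam, eval lam (Matrix.of Q).det =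
      (Matrix.of fun b b' => eval lam (Q b b')).det := fun lam => by
    rw [RingHom.map_det]; rfl
  refine ⟨(Matrix.of Q).det, ?_, fun b => ∑ b', (Matrix.of Q).adjugate b b' * W b', ?_⟩
  · intro h0
    have h1 := hdet lam₁
    rw [h0, map_zero] at h1
    have : (Matrix.of fun b b' => eval lam₁ (Q b b')) = (1 : Matrix B B ℂ) := by
      ext b b'
      rw [Matrix.of_apply, ← hQ b b' lam₁]
      have := congrArg (fun f => f (Pi.single b' 1) b) hG
      simp only [LinearMap.comp_apply, Fintype.linearCombination_apply_single, one_smul,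
        LinearMap.id_apply] at this
      rw [LinearMap.comp_apply, LinearMap.proj_apply, this, Matrix.one_apply, Pi.single_apply]
    rw [this, Matrix.det_one] at h1
    exact zero_ne_one h1
  · intro lam c hc b
    set M : Matrix B B ℂ := Matrix.of fun b b' => eval lam (Q b b') with hM
    have hadj : ∀ b b', eval lam ((Matrix.of Q).adjugate b b') = M.adjugate b b' := fun b b' => by
      have := RingHom.map_adjugate (eval lam) (Matrix.of Q)
      exact congrArg (fun N : Matrix B B ℂ => N b b') this
    have hMc : M.mulVec c = fun b => eval lam (W b) := by
      funext b
      rw [← hW b lam, ← hc, map_sum]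
      simp only [Matrix.mulVec, dotProduct, map_smul, smul_eq_mul, hM, Matrix.of_apply, ← hQ]
      exact Finset.sum_congr rfl fun _ _ => mul_comm _ _
    have key : M.adjugate.mulVec (M.mulVec c) = M.det • c := by
      rw [Matrix.mulVec_mulVec, Matrix.adjugate_mul, Matrix.smul_mulVec, Matrix.one_mulVec]
    have kb := congrFun key b
    rw [hMc] at kb
    rw [map_sum, hdet, ← hM]
    simp only [map_mul, hadj]
    exact kb.symm

/-! ### The Baker–Akhiezer function is a quasi-polynomial in both variables -/

namespace Arrangement

/-- The linear conditions defining `A.twistedQI lam`. -/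
def condMap (A : Arrangement n ι) (lam : Fin n → ℂ) :
    MvPolynomial (Fin n) ℂ →ₗ[ℂ] ((Σ i : ι, Fin (A.mult i)) → MvPolynomial (Fin n) ℂ) :=
  LinearMap.pi fun κ => (restr (A.root κ.1)).toLinearMap ∘ₗ
    (twist (A.root κ.1) (pairing (A.root κ.1) lam) ^ (2 * (κ.2 : ℕ) + 1))

lemma condMap_eq_zero_iff (A : Arrangement n ι) (lam : Fin n → ℂ) (p : MvPolynomial (Fin n) ℂ) :
    A.condMap lam p = 0 ↔ p ∈ A.twistedQI lam :=
  ⟨fun h i s hs => congrFun h ⟨i, ⟨s, hs⟩⟩, fun h => funext fun κ => h κ.1 κ.2 κ.2.2⟩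

variable [Fintype ι] {A : Arrangement n ι} {φ : (Fin n → ℂ) → (Fin n → ℂ) → ℂ}

lemma monomial_mul_eval_eq (a : Fin n →₀ ℕ) (x : Fin n → ℂ) (c : ℂ) :
    eval x (monomial a c) = c * eval x (monomial a 1) := by
  simp [eval_monomial]

lemma exists_finset_degree_lt (n d : ℕ) : ∃ S : Finset (Fin n →₀ ℕ), ∀ a, a ∈ S ↔ a.degree < d :=
  ⟨(Finsupp.finite_of_degree_lt d).toFinset, by simp⟩

lemma sum_coeff_smul_monomial {d : ℕ} {S : Finset (Fin n →₀ ℕ)} (hS : ∀ a, a ∈ S ↔ a.degree < d)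
    {p : MvPolynomial (Fin n) ℂ} (h : p ∈ degLT n d) :
    ∑ b : S, coeff (b : Fin n →₀ ℕ) p • monomial (b : Fin n →₀ ℕ) (1 : ℂ) = p := by
  rw [Finset.sum_coe_sort _ fun a : Fin n →₀ ℕ => coeff a p • monomial a (1 : ℂ)]
  conv_rhs => rw [p.as_sum]
  refine (Finset.sum_subset (s₁ := p.support) (fun a ha => ?_) fun a _ ha => ?_).symm.trans ?_
  · exact (hS a).mpr (support_degree_lt_of_mem_degLT h ha)
  · rw [notMem_support_iff.mp ha, zero_smul]
  · exact Finset.sum_congr rfl fun a _ => by rw [smul_monomial, smul_eq_mul, mul_one]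

lemma coeff_sum_monomial {S : Finset (Fin n →₀ ℕ)} (g : S → ℂ) (b : S) :
    coeff (b : Fin n →₀ ℕ) (∑ b : S, monomial (b : Fin n →₀ ℕ) (g b)) = g b := by
  classical
  rw [coeff_sum, Finset.sum_eq_single b]
  · rw [coeff_monomial, if_pos rfl]
  · intro b' _ hne
    rw [coeff_monomial, if_neg fun h => hne (Subtype.ext h)]
  · exact fun h => absurd (Finset.mem_univ b) h

/-- The numerator `A_m(x) A_m(λ) + ∑_a x^a c_a(λ)`. -/
def biNum (A : Arrangement n ι) (S : Finset (Fin n →₀ ℕ))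
    (c : (Fin n →₀ ℕ) → MvPolynomial (Fin n) ℂ) : MvPolynomial (Fin n ⊕ Fin n) ℂ :=
  inL A.discrPoly * inR A.discrPoly + ∑ a ∈ S, inL (monomial a 1) * inR (c a)

lemma eval_biNum (S : Finset (Fin n →₀ ℕ)) (c : (Fin n →₀ ℕ) → MvPolynomial (Fin n) ℂ)
    (x lam : Fin n → ℂ) : eval (Sum.elim x lam) (A.biNum S c) =
      A.discr x * A.discr lam + ∑ a ∈ S, eval x (monomial a 1) * eval lam (c a) := by
  rw [← eval_specR, biNum, map_add, map_mul, map_sum]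
  simp only [map_mul, specR_inL, specR_inR, map_add, map_sum, eval_C, eval_discrPoly]

lemma exists_eval_eq_dual_condMap (A : Arrangement n ι) (W : MvPolynomial (Fin n ⊕ Fin n) ℂ)
    (g : ((Σ i : ι, Fin (A.mult i)) → MvPolynomial (Fin n) ℂ) →ₗ[ℂ] ℂ) :
    ∃ q : MvPolynomial (Fin n) ℂ, ∀ lam, g (A.condMap lam (specR lam W)) = eval lam q := by
  classical
  choose q hq using fun κ : Σ i : ι, Fin (A.mult i) => exists_eval_eq_dual_specR
    ((twistL (A.root κ.1) ^ (2 * (κ.2 : ℕ) + 1)) W)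
    (g ∘ₗ LinearMap.single ℂ (fun _ => MvPolynomial (Fin n) ℂ) κ ∘ₗ
      (restr (A.root κ.1)).toLinearMap)
  refine ⟨∑ κ, q κ, fun lam => ?_⟩
  rw [map_sum, ← LinearMap.sum_single_apply (φ := fun _ => MvPolynomial (Fin n) ℂ)
    (A.condMap lam (specR lam W)), map_sum]
  refine Finset.sum_congr rfl fun κ _ => ?_
  rw [← hq κ lam, specR_twistL_pow]
  rfl

/-- A linear relation would be a quasi-invariant quasi-polynomial of degree below |m|. -/
lemma linearIndependent_condMap {S : Finset (Fin n →₀ ℕ)}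
    (hS : ∀ a, a ∈ S ↔ a.degree < A.totalMult) {lam : Fin n → ℂ} (hlam : lam ∈ A.regular) :
    LinearIndependent ℂ fun b : S => A.condMap lam (monomial (b : Fin n →₀ ℕ) 1) := by
  rw [Fintype.linearIndependent_iff]
  intro g hg b
  have hg' : A.condMap lam (∑ b : S, monomial (b : Fin n →₀ ℕ) (g b)) = 0 := by
    rw [map_sum, ← hg]
    refine Finset.sum_congr rfl fun b _ => ?_
    rw [← LinearMap.map_smul, smul_monomial, smul_eq_mul, mul_one]
  rw [condMap_eq_zero_iff] at hg'
  have hz := A.eq_zero_of_mem_twistedQI hlam hg'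
    (Submodule.sum_mem _ fun b _ => mem_degLT_of_isHomogeneous (isHomogeneous_monomial _ rfl)
      ((hS b).mp b.2))
  rw [← coeff_sum_monomial g b, hz, coeff_zero]

/-- The coefficients of a quasi-invariant quasi-polynomial with leading term `A_m(x) A_m(λ)` are
rational functions of `λ`. -/
lemma exists_coeff_rational (A : Arrangement n ι) {S : Finset (Fin n →₀ ℕ)}
    (hS : ∀ a, a ∈ S ↔ a.degree < A.totalMult) :
    ∃ d : MvPolynomial (Fin n) ℂ, d ≠ 0 ∧ ∃ N : S → MvPolynomial (Fin n) ℂ,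
      ∀ (lam : Fin n → ℂ) (p : MvPolynomial (Fin n) ℂ),
        p ∈ degLT n A.totalMult → C (A.discr lam) * A.discrPoly + p ∈ A.twistedQI lam →
          ∀ b : S, eval lam d * coeff (b : Fin n →₀ ℕ) p = eval lam (N b) := by
  obtain ⟨ξ, hξ⟩ := A.exists_real_regular
  obtain ⟨d, hd0, N, hN⟩ := exists_cramer
    (v := fun lam => A.condMap lam (-(C (A.discr lam) * A.discrPoly)))
    (u := fun (b : S) lam => A.condMap lam (monomial (b : Fin n →₀ ℕ) 1))
    (fun b g => by
      obtain ⟨q, hq⟩ := A.exists_eval_eq_dual_condMap (inL (monomial (b : Fin n →₀ ℕ) 1)) g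
      exact ⟨q, fun lam => by rw [← hq lam, specR_inL]⟩)
    (fun g => by
      obtain ⟨q, hq⟩ := A.exists_eval_eq_dual_condMap (-(inR A.discrPoly * inL A.discrPoly)) g
      refine ⟨q, fun lam => ?_⟩
      rw [← hq lam, map_neg (specR lam), map_mul (specR lam), specR_inL, specR_inR, eval_discrPoly])
    (linearIndependent_condMap hS hξ)
  refine ⟨d, hd0, N, fun lam p hp hq => hN lam (fun b => coeff (b : Fin n →₀ ℕ) p) ?_⟩
  have hlin := congrArg (A.condMap lam) (sum_coeff_smul_monomial hS hp)
  rw [map_sum] at hlin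
  simp only [LinearMap.map_smul] at hlin
  rw [hlin, ← sub_eq_zero, ← map_sub, condMap_eq_zero_iff]
  rwa [show p - -(C (A.discr lam) * A.discrPoly) = C (A.discr lam) * A.discrPoly + p by ring]

/-- The quasi-invariance conditions determine the lower coefficients of P as rational functions of
λ. Continuity in λ rules out poles, so P is a polynomial in both variables, also at the λ lying on
the hyperplanes. -/
theorem IsBakerAkhiezer.exists_biNum (hφ : A.IsBakerAkhiezer φ) :
    ∃ (S : Finset (Fin n →₀ ℕ)) (c : (Fin n →₀ ℕ) → MvPolynomial (Fin n) ℂ),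
      (∀ a ∈ S, a.degree < A.totalMult) ∧ ∀ x lam,
        φ x lam = eval (Sum.elim x lam) (A.biNum S c) * Complex.exp (pairing x lam) := by
  classical
  choose R hRdeg hR using hφ.form_eq
  have hRlt : ∀ lam, R lam ∈ degLT n A.totalMult := fun lam => mem_degLT_of_support (hRdeg lam)
  have hQI : ∀ lam, C (A.discr lam) * A.discrPoly + R lam ∈ A.twistedQI lam := by
    intro lam
    rw [← quasiInvariant_polyExp_iff]
    convert hφ.quasiInvariant lam using 2 with x
    rw [hR lam x, map_add, map_mul, eval_C, eval_discrPoly, mul_comm (A.discr lam)]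
  obtain ⟨B, hB⟩ := exists_finset_degree_lt n A.totalMult
  obtain ⟨d, hd0, N, hN⟩ := A.exists_coeff_rational hB
  have hNR : ∀ lam (b : B), eval lam d * coeff (b : Fin n →₀ ℕ) (R lam) = eval lam (N b) :=
    fun lam => hN lam _ (hRlt lam) (hQI lam)
  have hReval : ∀ lam x, eval x (R lam) =
      ∑ b : B, coeff (b : Fin n →₀ ℕ) (R lam) * eval x (monomial (b : Fin n →₀ ℕ) 1) := by
    intro lam x
    conv_lhs => rw [← sum_coeff_smul_monomial hB (hRlt lam)]
    simp only [map_sum, smul_eval]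
  have hcontR : ∀ x, Continuous fun lam => eval x (R lam) := by
    intro x
    have : (fun lam => eval x (R lam)) =
        fun lam => φ x lam * Complex.exp (-pairing x lam) - A.discr x * A.discr lam := by
      funext lam
      rw [hR lam x, mul_assoc, ← Complex.exp_add, add_neg_cancel, Complex.exp_zero]
      ring
    rw [this]
    have h1 := hφ.continuous_right x
    have h2 : Continuous fun lam => A.discr lam := by
      simpa using continuous_eval A.discrPoly
    have h3 : Continuous fun lam => pairing x lam := by unfold pairing; fun_prop
    fun_prop
  -- Continuity is known only for the values P(x,λ) at fixed x, so `d` is first seen to divide ∑ x^b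
  -- N_b for every x. Testing against functionals on the quotient by (d) gives a polynomial in x
  -- that vanishes identically, hence has zero coefficients.
  have hdvd : ∀ b : B, d ∣ N b := by
    intro b
    set I : Submodule ℂ (MvPolynomial (Fin n) ℂ) := (Ideal.span {d}).restrictScalars ℂ
    suffices h : I.mkQ (N b) = 0 by
      rw [Submodule.mkQ_apply, Submodule.Quotient.mk_eq_zero] at h
      exact Ideal.mem_span_singleton.mp h
    rw [← Module.forall_dual_apply_eq_zero_iff ℂ]
    intro f
    have hz : ∑ b : B, monomial (b : Fin n →₀ ℕ) (f (I.mkQ (N b))) = 0 := by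
      refine MvPolynomial.funext fun x => ?_
      have hx : d ∣ ∑ b : B, eval x (monomial (b : Fin n →₀ ℕ) 1) • N b := by
        refine dvd_of_continuous hd0 (hcontR x) fun lam => ?_
        rw [hReval, Finset.mul_sum, map_sum]
        refine Finset.sum_congr rfl fun b _ => ?_
        rw [smul_eval, ← hNR lam b]
        ring
      have hx' : I.mkQ (∑ b : B, eval x (monomial (b : Fin n →₀ ℕ) 1) • N b) = 0 := by
        rw [Submodule.mkQ_apply, Submodule.Quotient.mk_eq_zero]
        exact Ideal.mem_span_singleton.mpr hx
      have hx'' := congrArg f hx'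
      simp only [map_sum, map_smul, map_zero, smul_eq_mul] at hx''
      rw [map_sum, map_zero, ← hx'']
      refine Finset.sum_congr rfl fun b _ => ?_
      rw [monomial_mul_eval_eq, mul_comm]
    rw [← coeff_sum_monomial (fun b : B => f (I.mkQ (N b))) b, hz, coeff_zero]
  choose c hc using hdvd
  refine ⟨B, fun a => if h : a ∈ B then c ⟨a, h⟩ else 0, fun a ha => (hB a).mp ha,
    fun x lam => ?_⟩
  rw [hR lam x, eval_biNum]
  congr 2
  have hfun := eq_of_eq_on_eval_ne_zero hd0 (hcontR x)
    (g := fun lam => ∑ b : B, eval x (monomial (b : Fin n →₀ ℕ) 1) * eval lam (c b))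
    (continuous_finsetSum _ fun b _ => continuous_const.mul (continuous_eval _)) fun lam hlam => by
      refine mul_left_cancel₀ hlam ?_
      rw [hReval, Finset.mul_sum, Finset.mul_sum]
      refine Finset.sum_congr rfl fun b _ => ?_
      rw [← mul_assoc, hNR lam b, hc b, map_mul]
      ring
  rw [congrFun hfun lam, ← Finset.sum_coe_sort B]
  refine Finset.sum_congr rfl fun b _ => ?_
  rw [dif_pos b.2]

end Arrangement

/-! ### Scaling and further facts on homogeneous components -/

lemma eval_smul_of_isHomogeneous {p : MvPolynomial (Fin n) ℂ} {d : ℕ} (hp : p.IsHomogeneous d)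
    (t : ℂ) (x : Fin n → ℂ) : eval (t • x) p = t ^ d * eval x p := by
  rw [eval_eq', eval_eq', Finset.mul_sum]
  refine Finset.sum_congr rfl fun a ha => ?_
  have hd : ∑ i, a i = d := by
    rw [← Finsupp.degree_eq_sum]
    by_contra h
    exact (mem_support_iff.mp ha) (hp.coeff_eq_zero h)
  simp only [Pi.smul_apply, smul_eq_mul, mul_pow, Finset.prod_mul_distrib,
    Finset.prod_pow_eq_pow_sum, hd]
  ring

lemma homogeneousComponent_mul_of_isHomogeneous {p : MvPolynomial (Fin n) ℂ} {e : ℕ}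
    (hp : p.IsHomogeneous e) (d : ℕ) (q : MvPolynomial (Fin n) ℂ) :
    homogeneousComponent (e + d) (p * q) = p * homogeneousComponent d q := by
  induction q using MvPolynomial.induction_on' with
  | add q q' hq hq' => rw [mul_add, map_add, map_add, hq, hq', mul_add]
  | monomial a c =>
    have hm : (monomial a c).IsHomogeneous a.degree := isHomogeneous_monomial c rfl
    rw [homogeneousComponent_of_mem hm, homogeneousComponent_of_mem (hp.mul hm)]
    simp

lemma sum_homogeneousComponent_of_mem_degLT {d : ℕ} {p : MvPolynomial (Fin n) ℂ}
    (h : p ∈ degLT n d) : ∑ r ∈ Finset.range d, homogeneousComponent r p = p := by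
  conv_rhs => rw [← sum_homogeneousComponent p]
  rcases le_total d (p.totalDegree + 1) with hd | hd
  · refine Finset.sum_subset (Finset.range_mono hd) fun r _ hr => h r (by simpa using hr)
  · refine (Finset.sum_subset (Finset.range_mono hd) fun r _ hr => ?_).symm
    exact homogeneousComponent_eq_zero _ _ (by simpa using hr)

/-- The substitution `x ↦ t x`. -/
def scale (t : ℂ) : MvPolynomial (Fin n) ℂ →ₐ[ℂ] MvPolynomial (Fin n) ℂ :=
  aeval fun j => C t * X j

lemma eval_scale (t : ℂ) (x : Fin n → ℂ) (p : MvPolynomial (Fin n) ℂ) :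
    eval x (scale t p) = eval (t • x) p := by
  have : (eval x).comp (scale t).toRingHom = eval (t • x) :=
    MvPolynomial.ringHom_ext (fun c => by simp [scale]) fun j => by simp [scale]
  exact congrArg (fun f => f p) this

lemma scale_of_isHomogeneous {p : MvPolynomial (Fin n) ℂ} {d : ℕ} (hp : p.IsHomogeneous d)
    (t : ℂ) : scale t p = t ^ d • p :=
  MvPolynomial.funext fun x => by
    rw [eval_scale, eval_smul_of_isHomogeneous hp, smul_eval]

lemma dirDeriv_scale (v : Fin n → ℂ) (t : ℂ) (p : MvPolynomial (Fin n) ℂ) :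
    dirDeriv v (scale t p) = t • scale t (dirDeriv v p) := by
  induction p using MvPolynomial.induction_on with
  | C a => simp [scale]
  | add p q hp hq => simp only [map_add, hp, hq, smul_add]
  | mul_X p j hp =>
    have hX : scale t (X j) = C t * X j := by simp [scale]
    have hC : scale t (C (v j) : MvPolynomial (Fin n) ℂ) = C (v j) := by simp [scale]
    simp only [map_mul (scale t), Derivation.leibniz, hp, hX, smul_eq_mul, dirDeriv_X, dirDeriv_C,
      map_add (scale t), hC, smul_eq_C_mul]
    ring

lemma twist_scale (v : Fin n → ℂ) (c t : ℂ) (p : MvPolynomial (Fin n) ℂ) :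
    twist v (t * c) (scale t p) = t • scale t (twist v c p) := by
  rw [twist_apply, twist_apply, dirDeriv_scale, map_add, map_smul, smul_add, smul_smul]

lemma twist_pow_scale (v : Fin n → ℂ) (c t : ℂ) (k : ℕ) (p : MvPolynomial (Fin n) ℂ) :
    (twist v (t * c) ^ k) (scale t p) = t ^ k • scale t ((twist v c ^ k) p) := by
  induction k with
  | zero => simp
  | succ k ih =>
    rw [pow_succ', Module.End.mul_apply, ih, map_smul, twist_scale, smul_smul, ← pow_succ,
      pow_succ' (twist v c), Module.End.mul_apply]

lemma restr_scale (v : Fin n → ℂ) (t : ℂ) (p : MvPolynomial (Fin n) ℂ) :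
    restr v (scale t p) = scale t (restr v p) :=
  MvPolynomial.funext fun x => by
    rw [eval_restr, eval_scale, eval_scale, eval_restr, smul_sub, pairing_smul_right, smul_smul,
      mul_div_assoc]

lemma Arrangement.scale_mem_twistedQI {A : Arrangement n ι} {lam : Fin n → ℂ}
    {p : MvPolynomial (Fin n) ℂ} (h : p ∈ A.twistedQI lam) (t : ℂ) :
    scale t p ∈ A.twistedQI (t • lam) := fun i s hs => by
  rw [pairing_smul_right, twist_pow_scale, map_smul, restr_scale, h i s hs, map_zero, smul_zero]

lemma Arrangement.smul_mem_regular {A : Arrangement n ι} {lam : Fin n → ℂ} (h : lam ∈ A.regular)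
    {t : ℂ} (ht : t ≠ 0) : t • lam ∈ A.regular := fun i => by
  rw [form_eq_pairing, pairing_smul_right]
  exact mul_ne_zero ht (h i)

/-! ### Derivatives in the spectral variable -/

lemma exists_eval_eq_dual_specR_deriv (W : MvPolynomial (Fin n ⊕ Fin n) ℂ)
    (g : MvPolynomial (Fin n) ℂ →ₗ[ℂ] ℂ) :
    ∃ q : MvPolynomial (Fin n) ℂ, (∀ lam, g (specR lam W) = eval lam q) ∧
      ∀ v lam, g (specR lam (dirDerivR v W)) = eval lam (dirDeriv v q) := by
  induction W using biPoly_induction with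
  | add W W' h h' =>
    obtain ⟨q, hq⟩ := h
    obtain ⟨q', hq'⟩ := h'
    exact ⟨q + q', fun lam => by rw [map_add, map_add, map_add, hq.1, hq'.1], fun v lam => by
      simp only [map_add, hq.2, hq'.2]⟩
  | mul p q =>
    have key : ∀ lam (q : MvPolynomial (Fin n) ℂ),
        g (specR lam (inL p * inR q)) = eval lam (C (g p) * q) := fun lam q => by
      rw [map_mul, specR_inL, specR_inR, mul_comm, ← smul_eq_C_mul, map_smul, map_mul, eval_C,
        smul_eq_mul, mul_comm]
    refine ⟨C (g p) * q, fun lam => key lam q, fun v lam => ?_⟩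
    rw [Derivation.leibniz, dirDerivR_inL, dirDerivR_inR, smul_zero, add_zero, smul_eq_mul, key,
      Derivation.leibniz, dirDeriv_C, smul_zero, add_zero, smul_eq_mul]

/-- A linear condition on the x-coefficients that holds for all λ may be differentiated in λ. Degree
bounds and hyperplane conditions pass to λ-derivatives by this. -/
lemma dual_specR_dirDerivR_eq_zero {W : MvPolynomial (Fin n ⊕ Fin n) ℂ}
    {g : MvPolynomial (Fin n) ℂ →ₗ[ℂ] ℂ} {c : ℂ} (h : ∀ lam, g (specR lam W) = c)
    (v lam : Fin n → ℂ) : g (specR lam (dirDerivR v W)) = 0 := by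
  obtain ⟨q, hq, hq'⟩ := exists_eval_eq_dual_specR_deriv W g
  have : q = C c := MvPolynomial.funext fun x => by rw [← hq, h, eval_C]
  rw [hq', this, dirDeriv_C, map_zero]

lemma specR_dirDerivR_mem_degLT {W : MvPolynomial (Fin n ⊕ Fin n) ℂ} {d : ℕ}
    (h : ∀ lam, specR lam W ∈ degLT n d) (v lam : Fin n → ℂ) :
    specR lam (dirDerivR v W) ∈ degLT n d := fun r hr => by
  refine MvPolynomial.ext _ _ fun a => ?_
  rw [coeff_zero]
  refine dual_specR_dirDerivR_eq_zero
    (g := (MvPolynomial.lcoeff ℂ a).comp (homogeneousComponent r)) (c := 0) (fun lam => ?_) v lam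
  rw [LinearMap.comp_apply, h lam r hr, map_zero]

lemma specR_twistR (v lam : Fin n → ℂ) (W : MvPolynomial (Fin n ⊕ Fin n) ℂ) :
    specR lam (twistR v W) = specR lam (dirDerivR v W) + linForm v * specR lam W := by
  rw [twistR_apply, map_add, map_mul, specR_inL]

lemma restr_specR_twistR {u : Fin n → ℂ} {W : MvPolynomial (Fin n ⊕ Fin n) ℂ}
    (h : ∀ lam, restr u (specR lam W) = 0) (v lam : Fin n → ℂ) :
    restr u (specR lam (twistR v W)) = 0 := by
  rw [specR_twistR, map_add, map_mul, h, mul_zero, add_zero]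
  refine MvPolynomial.ext _ _ fun a => ?_
  rw [coeff_zero]
  refine dual_specR_dirDerivR_eq_zero
    (g := (MvPolynomial.lcoeff ℂ a).comp (restr u).toLinearMap) (c := 0) (fun lam => ?_) v lam
  rw [LinearMap.comp_apply, AlgHom.toLinearMap_apply, h lam, map_zero]

lemma Arrangement.specR_twistR_mem_twistedQI {A : Arrangement n ι}
    {W : MvPolynomial (Fin n ⊕ Fin n) ℂ} (h : ∀ lam, specR lam W ∈ A.twistedQI lam)
    (v lam : Fin n → ℂ) : specR lam (twistR v W) ∈ A.twistedQI lam := fun i s hs => by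
  rw [← specR_twistL_pow, ← Module.End.mul_apply, ((commute_twistL_twistR _ v).pow_left _).eq,
    Module.End.mul_apply]
  refine restr_specR_twistR (fun lam => ?_) v lam
  rw [specR_twistL_pow]
  exact h lam i s hs

lemma restr_twist_pow_mul_eq_zero (v : Fin n → ℂ) (c : ℂ) (k : ℕ) :
    ∀ p q : MvPolynomial (Fin n) ℂ, (∀ a b, a + b = k →
      restr v ((twist v 0 ^ a) p) * restr v ((twist v c ^ b) q) = 0) →
      restr v ((twist v c ^ k) (p * q)) = 0 := by
  induction k with
  | zero => intro p q h; simpa using h 0 0 rfl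
  | succ k ih =>
    intro p q h
    have h1 : twist v c (p * q) = twist v 0 p * q + p * twist v c q := by
      simp only [twist_apply, Derivation.leibniz, smul_eq_mul, smul_eq_C_mul, map_zero]
      ring
    rw [pow_succ, Module.End.mul_apply, h1, map_add, map_add, ih, ih, add_zero]
    · intro a b hab
      rw [← Module.End.mul_apply, ← pow_succ]
      exact h a (b + 1) (by omega)
    · intro a b hab
      rw [← Module.End.mul_apply, ← pow_succ]
      exact h (a + 1) b (by omega)

/-- In the Leibniz expansion of a derivative of odd order, one of the two orders is odd. It is at
most the total order, so that factor vanishes on the hyperplane. -/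
lemma Arrangement.mul_mem_twistedQI {A : Arrangement n ι} {lam : Fin n → ℂ}
    {p q : MvPolynomial (Fin n) ℂ} (hp : p ∈ A.twistedQI 0) (hq : q ∈ A.twistedQI lam) :
    p * q ∈ A.twistedQI lam := by
  intro i s hs
  refine restr_twist_pow_mul_eq_zero _ _ _ p q fun a b hab => ?_
  rcases Nat.even_or_odd a with ha | ha
  · obtain ⟨r, hr⟩ : Odd b := by
      rcases Nat.even_or_odd b with hb | hb
      · exact absurd (hab ▸ ha.add hb) (by simp)
      · exact hb
    rw [hr, hq i r (by omega), mul_zero]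
  · obtain ⟨r, hr⟩ := ha
    have := hp i r (by omega)
    rw [pairing_zero_right] at this
    rw [hr, this, zero_mul]

/-! ### The numerator of a Baker-Akhiezer function: uniqueness and scaling -/

/-- The substitution `λ ↦ t λ` in the second group of variables. -/
def scaleR (t : ℂ) : MvPolynomial (Fin n ⊕ Fin n) ℂ →ₐ[ℂ] MvPolynomial (Fin n ⊕ Fin n) ℂ :=
  aeval (Sum.elim (fun j => X (Sum.inl j)) fun j => C t * X (Sum.inr j))

/-- The substitution `x ↦ t x` in the first group of variables. -/
def scaleL (t : ℂ) : MvPolynomial (Fin n ⊕ Fin n) ℂ →ₐ[ℂ] MvPolynomial (Fin n ⊕ Fin n) ℂ :=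
  aeval (Sum.elim (fun j => C t * X (Sum.inl j)) fun j => X (Sum.inr j))

lemma eval_scaleR (t : ℂ) (x lam : Fin n → ℂ) (W : MvPolynomial (Fin n ⊕ Fin n) ℂ) :
    eval (Sum.elim x lam) (scaleR t W) = eval (Sum.elim x (t • lam)) W := by
  have : (eval (Sum.elim x lam)).comp (scaleR t).toRingHom = eval (Sum.elim x (t • lam)) :=
    MvPolynomial.ringHom_ext (fun c => by simp [scaleR]) fun j => by
      rcases j with j | j <;> simp [scaleR]
  exact congrArg (fun f => f W) this

lemma eval_scaleL (t : ℂ) (x lam : Fin n → ℂ) (W : MvPolynomial (Fin n ⊕ Fin n) ℂ) :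
    eval (Sum.elim x lam) (scaleL t W) = eval (Sum.elim (t • x) lam) W := by
  have : (eval (Sum.elim x lam)).comp (scaleL t).toRingHom = eval (Sum.elim (t • x) lam) :=
    MvPolynomial.ringHom_ext (fun c => by simp [scaleL]) fun j => by
      rcases j with j | j <;> simp [scaleL]
  exact congrArg (fun f => f W) this

/-- `W` is the polynomial factor of a Baker-Akhiezer function of the arrangement. -/
structure Arrangement.IsBANum [Fintype ι] (A : Arrangement n ι)
    (W : MvPolynomial (Fin n ⊕ Fin n) ℂ) : Prop where
  qi : ∀ lam, specR lam W ∈ A.twistedQI lam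
  top : ∀ lam, specR lam W - C (A.discr lam) * A.discrPoly ∈ degLT n A.totalMult

namespace Arrangement

variable [Fintype ι] {A : Arrangement n ι} {φ : (Fin n → ℂ) → (Fin n → ℂ) → ℂ}
  {W : MvPolynomial (Fin n ⊕ Fin n) ℂ}

lemma specR_biNum (S : Finset (Fin n →₀ ℕ)) (c : (Fin n →₀ ℕ) → MvPolynomial (Fin n) ℂ)
    (lam : Fin n → ℂ) : specR lam (A.biNum S c) =
      C (A.discr lam) * A.discrPoly + ∑ a ∈ S, monomial a (eval lam (c a)) :=
  MvPolynomial.funext fun x => by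
    rw [eval_specR, eval_biNum, map_add, map_mul, eval_C, eval_discrPoly, map_sum, mul_comm]
    congr 1
    refine Finset.sum_congr rfl fun a _ => ?_
    rw [monomial_mul_eval_eq a x (eval lam (c a)), mul_comm]

lemma IsBakerAkhiezer.isBANum (hφ : A.IsBakerAkhiezer φ) {S : Finset (Fin n →₀ ℕ)}
    {c : (Fin n →₀ ℕ) → MvPolynomial (Fin n) ℂ} (hS : ∀ a ∈ S, a.degree < A.totalMult)
    (h : ∀ x lam, φ x lam =
      eval (Sum.elim x lam) (A.biNum S c) * Complex.exp (pairing x lam)) :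
    A.IsBANum (A.biNum S c) where
  qi lam := by
    rw [← quasiInvariant_polyExp_iff]
    simpa only [eval_specR, h] using hφ.quasiInvariant lam
  top lam := by
    rw [specR_biNum, add_sub_cancel_left]
    exact Submodule.sum_mem _ fun a ha =>
      mem_degLT_of_isHomogeneous (isHomogeneous_monomial _ rfl) (hS a ha)

lemma IsBANum.mem_degLT (hW : A.IsBANum W) (lam : Fin n → ℂ) :
    specR lam W ∈ degLT n (A.totalMult + 1) := by
  have := add_mem (degLT_mono (Nat.le_succ _) (hW.top lam))
    (mem_degLT_of_isHomogeneous ((isHomogeneous_C (Fin n) (A.discr lam)).mul A.discrPoly_isHomogeneous)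
      (by omega : 0 + A.totalMult < A.totalMult + 1))
  rwa [sub_add_cancel] at this

lemma specR_eq_of_top_eq {lam : Fin n → ℂ} (hlam : lam ∈ A.regular) {p q : MvPolynomial (Fin n) ℂ}
    (hp : p ∈ A.twistedQI lam) (hq : q ∈ A.twistedQI lam)
    (h : p - q ∈ degLT n A.totalMult) : p = q :=
  sub_eq_zero.mp (A.eq_zero_of_mem_twistedQI hlam (sub_mem hp hq) h)

lemma biPoly_ext_regular {W W' : MvPolynomial (Fin n ⊕ Fin n) ℂ}
    (h : ∀ lam ∈ A.regular, specR lam W = specR lam W') : W = W' := by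
  refine biPoly_ext fun x lam => ?_
  rw [← eval_specL, ← eval_specL]
  refine congrFun (A.eq_of_eq_on_regular (continuous_eval (specL x W))
    (continuous_eval (specL x W')) fun lam hlam => ?_) lam
  rw [eval_specL, eval_specL, ← eval_specR, ← eval_specR, h lam hlam]

lemma IsBANum.unique {W' : MvPolynomial (Fin n ⊕ Fin n) ℂ} (hW : A.IsBANum W)
    (hW' : A.IsBANum W') : W = W' :=
  biPoly_ext_regular fun lam hlam => specR_eq_of_top_eq hlam (hW.qi lam) (hW'.qi lam) <| by
    simpa using sub_mem (hW.top lam) (hW'.top lam)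

lemma discr_smul (t : ℂ) (x : Fin n → ℂ) : A.discr (t • x) = t ^ A.totalMult * A.discr x := by
  rw [← eval_discrPoly, eval_smul_of_isHomogeneous A.discrPoly_isHomogeneous, eval_discrPoly]

/-- Dilating x by t preserves quasi-invariance with λ replaced by tλ, and the leading terms agree
because A_m is homogeneous of degree |m|. Uniqueness at regular λ does the rest. -/
lemma IsBANum.eval_smul (hW : A.IsBANum W) (t : ℂ) (x lam : Fin n → ℂ) :
    eval (Sum.elim (t • x) lam) W = eval (Sum.elim x (t • lam)) W := by
  have key : ∀ t : ℂ, t ≠ 0 → scaleL t W = scaleR t W := by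
    intro t ht
    refine biPoly_ext_regular (A := A) fun lam hlam => ?_
    have hL : specR lam (scaleL t W) = scale t (specR lam W) := MvPolynomial.funext fun x => by
      rw [eval_specR, eval_scaleL, eval_scale, eval_specR]
    have hR : specR lam (scaleR t W) = specR (t • lam) W := MvPolynomial.funext fun x => by
      rw [eval_specR, eval_scaleR, eval_specR]
    rw [hL, hR]
    refine specR_eq_of_top_eq (smul_mem_regular hlam ht) (scale_mem_twistedQI (hW.qi lam) t)
      (hW.qi (t • lam)) ?_
    have h1 : scale t (specR lam W - C (A.discr lam) * A.discrPoly) ∈ degLT n A.totalMult := by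
      rw [← sum_homogeneousComponent_of_mem_degLT (hW.top lam), map_sum]
      refine Submodule.sum_mem _ fun r hr => ?_
      rw [scale_of_isHomogeneous (homogeneousComponent_isHomogeneous r _)]
      exact Submodule.smul_mem _ _ (mem_degLT_of_isHomogeneous
        (homogeneousComponent_isHomogeneous r _) (Finset.mem_range.mp hr))
    have h2 := sub_mem h1 (hW.top (t • lam))
    have h3 : scale t (C (A.discr lam) * A.discrPoly) = C (A.discr (t • lam)) * A.discrPoly := by
      rw [← smul_eq_C_mul, map_smul, scale_of_isHomogeneous A.discrPoly_isHomogeneous, discr_smul,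
        smul_smul, smul_eq_C_mul, mul_comm (A.discr lam)]
    rwa [map_sub, h3, sub_sub_sub_cancel_right] at h2
  have hc : ∀ y : ℂ → (Fin n → ℂ) × (Fin n → ℂ), Continuous y →
      Continuous fun t => eval (Sum.elim (y t).1 (y t).2) W := fun y hy => by
    refine (MvPolynomial.continuous_eval W).comp (continuous_pi fun j => ?_)
    rcases j with j | j
    · exact (continuous_apply j).comp hy.fst
    · exact (continuous_apply j).comp hy.snd
  -- Uniqueness needs tλ regular, hence t ≠ 0. The value t = 0, used for `specL_zero`, follows by
  -- continuity.
  have hd : Dense {t : ℂ | t ≠ 0} := dense_compl_singleton 0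
  refine congrFun (Continuous.ext_on hd (hc (fun t => (t • x, lam)) (by fun_prop))
    (hc (fun t => (x, t • lam)) (by fun_prop)) fun t ht => ?_) t
  simp only [← eval_scaleL, ← eval_scaleR, key t ht]

lemma IsBANum.scaleL_eq_scaleR (hW : A.IsBANum W) (t : ℂ) : scaleL t W = scaleR t W :=
  biPoly_ext fun x lam => by rw [eval_scaleL, eval_scaleR, hW.eval_smul]

/-- The scaling identity at t = 0 and x = 0. Independence of φ(0,λ) from λ is what makes the
normalisation at the origin effective in `bispectral`. -/
lemma IsBANum.specL_zero (hW : A.IsBANum W) : specL 0 W = C (eval 0 W) :=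
  MvPolynomial.funext fun lam => by
    have := hW.eval_smul 0 0 lam
    rw [smul_zero, zero_smul] at this
    rw [eval_specL, eval_C, this]
    congr 2
    ext j
    rcases j with j | j <;> rfl

/-! ### Spanning by derivatives in the spectral variable -/

/-- `∏_j (∂/∂λ_j + x_j)^(a_j)`. -/
def _root_.BakerAkhiezer.twistMulti (a : Fin n →₀ ℕ) (W : MvPolynomial (Fin n ⊕ Fin n) ℂ) :
    MvPolynomial (Fin n ⊕ Fin n) ℂ :=
  (List.finRange n).foldr (fun j g => (twistR (Pi.single j 1))^[a j] g) W

/-- Carries along the degree and the monomial that each application of ∂/∂λ_j + x_j contributes to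
the leading part. -/
lemma twistMulti_induction {motive : ℕ → MvPolynomial (Fin n) ℂ →
      MvPolynomial (Fin n ⊕ Fin n) ℂ → Prop}
    (step : ∀ j d p W, motive d p W →
      motive (d + 1) (X j * p) (twistR (Pi.single j 1) W))
    {d : ℕ} {p : MvPolynomial (Fin n) ℂ} (h : motive d p W) (a : Fin n →₀ ℕ) :
    motive (d + a.degree) (p * monomial a 1) (twistMulti a W) := by
  have h1 : ∀ (l : List (Fin n)), motive (d + (l.map fun j => a j).sum)
      (p * (l.map fun j => X j ^ a j).prod)
      (l.foldr (fun j g => (twistR (Pi.single j 1))^[a j] g) W) := by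
    intro l
    induction l with
    | nil => simpa using h
    | cons j l ih =>
      have h2 : ∀ k d p W, motive d p W →
          motive (d + k) (X j ^ k * p) ((twistR (Pi.single j 1))^[k] W) := by
        intro k
        induction k with
        | zero => intro d p W h; simpa using h
        | succ k ihk =>
          intro d p W h
          rw [Function.iterate_succ_apply', ← add_assoc, pow_succ', mul_assoc]
          exact step _ _ _ _ (ihk _ _ _ h)
      have := h2 (a j) _ _ _ ih
      simp only [List.map_cons, List.sum_cons, List.prod_cons, List.foldr_cons]
      convert this using 1 <;> ring
  have := h1 (List.finRange n)
  unfold twistMulti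
  convert this using 1
  · rw [Finsupp.degree_eq_sum, ← List.sum_ofFn, List.ofFn_eq_map]
  · congr 1
    rw [monomial_eq, C_1, one_mul, Finsupp.prod_fintype _ _ fun _ => pow_zero _, ← List.prod_ofFn,
      List.ofFn_eq_map]

/-- The top degree part in `x` of `W` is `A_m(λ) p(x)`, of degree `d`. -/
def HasTop (A : Arrangement n ι) (d : ℕ) (p : MvPolynomial (Fin n) ℂ)
    (W : MvPolynomial (Fin n ⊕ Fin n) ℂ) : Prop :=
  p.IsHomogeneous d ∧ (∀ lam, specR lam W ∈ A.twistedQI lam) ∧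
    ∀ lam, specR lam W - C (A.discr lam) * p ∈ degLT n d

lemma HasTop.mem_degLT {d : ℕ} {p : MvPolynomial (Fin n) ℂ} (h : A.HasTop d p W)
    (lam : Fin n → ℂ) : specR lam W ∈ degLT n (d + 1) := by
  have := add_mem (degLT_mono (Nat.le_succ _) (h.2.2 lam))
    (mem_degLT_of_isHomogeneous ((isHomogeneous_C (Fin n) (A.discr lam)).mul h.1)
      (by omega : 0 + d < d + 1))
  rwa [sub_add_cancel] at this

/-- Differentiating in λ leaves the x-degree bound unchanged, so only the multiplication by x_j
reaches the new top degree. -/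
lemma HasTop.twistR {d : ℕ} {p : MvPolynomial (Fin n) ℂ} (h : A.HasTop d p W) (j : Fin n) :
    A.HasTop (d + 1) (X j * p) (twistR (Pi.single j 1) W) := by
  refine ⟨by rw [add_comm]; exact (isHomogeneous_X ℂ j).mul h.1,
    specR_twistR_mem_twistedQI h.2.1 _, fun lam => ?_⟩
  have hX : linForm (Pi.single j 1 : Fin n → ℂ) = X j := MvPolynomial.funext fun x => by
    rw [eval_linForm, pairing_comm, pairing_single, eval_X]
  rw [specR_twistR, hX, show specR lam (dirDerivR (Pi.single j 1) W) + X j * specR lam W -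
      C (A.discr lam) * (X j * p) = specR lam (dirDerivR (Pi.single j 1) W) +
      X j * (specR lam W - C (A.discr lam) * p) by ring]
  refine add_mem (specR_dirDerivR_mem_degLT h.mem_degLT _ _) ?_
  rw [add_comm]
  exact mul_mem_degLT (isHomogeneous_X ℂ j) (h.2.2 lam)

lemma IsBANum.hasTop (hW : A.IsBANum W) (a : Fin n →₀ ℕ) :
    A.HasTop (A.totalMult + a.degree) (A.discrPoly * monomial a 1) (twistMulti a W) :=
  twistMulti_induction (motive := A.HasTop) (fun j _ _ _ h => h.twistR j)
    ⟨A.discrPoly_isHomogeneous, hW.qi, hW.top⟩ a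

/-- Triangular elimination. The top part of `p` is A_m g', and the λ-derivatives of order `d` have
top parts A_m(λ)A_m(x)x^a with |a| = d. A combination of them removes the top part, which lowers the
degree until rigidity applies. -/
lemma IsBANum.mem_span_twistMulti (hW : A.IsBANum W) {lam : Fin n → ℂ} (hlam : lam ∈ A.regular)
    (d : ℕ) : ∀ p ∈ A.twistedQI lam, p ∈ degLT n (A.totalMult + d) →
      p ∈ Submodule.span ℂ ((fun a => specR lam (twistMulti a W)) '' {a | a.degree < d}) := by
  induction d with
  | zero =>
    intro p hp hd
    rw [A.eq_zero_of_mem_twistedQI hlam hp hd]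
    exact zero_mem _
  | succ d ih =>
    intro p hp hd
    rw [← add_assoc] at hd
    obtain ⟨g, hg⟩ := A.discrPoly_dvd hlam hp hd
    set g' := homogeneousComponent d g with hg'
    have hpp : homogeneousComponent (A.totalMult + d) p = A.discrPoly * g' := by
      rw [← homogeneousComponent_mul_of_isHomogeneous A.discrPoly_isHomogeneous, ← hg,
        homogeneousComponent_of_mem (homogeneousComponent_isHomogeneous _ p), if_pos rfl]
    have hdeg : ∀ a ∈ g'.support, a.degree = d := fun a ha => by
      by_contra h
      exact mem_support_iff.mp ha ((homogeneousComponent_isHomogeneous d g).coeff_eq_zero h)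
    have h0 := A.discr_ne_zero hlam
    set r := ∑ a ∈ g'.support, ((A.discr lam)⁻¹ * coeff a g') • specR lam (twistMulti a W) with hr
    have hrspan : r ∈ Submodule.span ℂ
        ((fun a => specR lam (twistMulti a W)) '' {a | a.degree < d + 1}) :=
      Submodule.sum_mem _ fun a ha => Submodule.smul_mem _ _ (Submodule.subset_span
        ⟨a, by simp [hdeg a ha], rfl⟩)
    have hrQI : r ∈ A.twistedQI lam :=
      Submodule.sum_mem _ fun a _ => Submodule.smul_mem _ _ ((hW.hasTop a).2.1 lam)
    have hrtop : r - A.discrPoly * g' ∈ degLT n (A.totalMult + d) := by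
      have : r - A.discrPoly * g' = ∑ a ∈ g'.support, ((A.discr lam)⁻¹ * coeff a g') •
          (specR lam (twistMulti a W) - C (A.discr lam) * (A.discrPoly * monomial a 1)) := by
        have h2 : A.discrPoly * g' =
            ∑ a ∈ g'.support, A.discrPoly * monomial a (coeff a g') := by
          conv_lhs => rw [g'.as_sum, Finset.mul_sum]
        rw [hr, h2, ← Finset.sum_sub_distrib]
        refine Finset.sum_congr rfl fun a _ => ?_
        rw [smul_sub, ← smul_eq_C_mul, smul_smul, mul_right_comm, inv_mul_cancel₀ h0, one_mul,
          ← mul_smul_comm, smul_monomial, smul_eq_mul, mul_one]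
      rw [this]
      refine Submodule.sum_mem _ fun a ha => Submodule.smul_mem _ _ ?_
      have := (hW.hasTop a).2.2 lam
      rwa [hdeg a ha] at this
    have hrest : p - r ∈ degLT n (A.totalMult + d) := by
      have h1 : p - A.discrPoly * g' ∈ degLT n (A.totalMult + d) := by
        refine mem_degLT_of_succ (sub_mem hd ?_) ?_
        · exact mem_degLT_of_isHomogeneous (A.discrPoly_isHomogeneous.mul
            (homogeneousComponent_isHomogeneous d g)) (by omega)
        · rw [map_sub, homogeneousComponent_mul_of_isHomogeneous A.discrPoly_isHomogeneous, hpp,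
            hg', homogeneousComponent_of_mem (homogeneousComponent_isHomogeneous d g), if_pos rfl,
            sub_self]
      simpa using sub_mem h1 hrtop
    have hle : Submodule.span ℂ ((fun a => specR lam (twistMulti a W)) '' {a | a.degree < d}) ≤
        Submodule.span ℂ ((fun a => specR lam (twistMulti a W)) '' {a | a.degree < d + 1}) := by
      refine Submodule.span_mono (Set.image_mono ?_)
      intro a ha
      exact Nat.lt_succ_of_lt ha
    have := add_mem (hle (ih _ (sub_mem hp hrQI) hrest)) hrspan
    rwa [sub_add_cancel] at this

end Arrangement

/-! ### Differential operators in the spectral variable -/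

lemma mul_mem_degLT_of_mem {d e : ℕ} {p q : MvPolynomial (Fin n) ℂ} (hp : p ∈ degLT n d)
    (hq : q ∈ degLT n (e + 1)) : p * q ∈ degLT n (e + d) := by
  rw [← sum_homogeneousComponent_of_mem_degLT hp, Finset.sum_mul]
  refine Submodule.sum_mem _ fun r hr => degLT_mono ?_
    (mul_mem_degLT (homogeneousComponent_isHomogeneous r p) hq)
  have := Finset.mem_range.mp hr
  omega

lemma partialDeriv_polyExp_right (j : Fin n) (x : Fin n → ℂ)
    (W : MvPolynomial (Fin n ⊕ Fin n) ℂ) :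
    partialDeriv j (fun y => eval (Sum.elim x y) W * Complex.exp (pairing x y)) =
      fun y => eval (Sum.elim x y) (twistR (Pi.single j 1) W) * Complex.exp (pairing x y) := by
  funext y
  have := lineDeriv_polyExp (specL x W) y (Pi.single j 1) x
  rw [← specL_twistR, eval_specL] at this
  simp only [eval_specL, pairing_comm _ x] at this
  exact this

lemma multiDeriv_polyExp_right (a : Fin n →₀ ℕ) (x : Fin n → ℂ)
    (W : MvPolynomial (Fin n ⊕ Fin n) ℂ) :
    multiDeriv a (fun y => eval (Sum.elim x y) W * Complex.exp (pairing x y)) =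
      fun y => eval (Sum.elim x y) (twistMulti a W) * Complex.exp (pairing x y) := by
  unfold multiDeriv twistMulti
  induction List.finRange n with
  | nil => rfl
  | cons j l ih =>
    rw [List.foldr_cons, List.foldr_cons, ih]
    generalize List.foldr _ W l = W'
    induction a j generalizing W' with
    | zero => rfl
    | succ k ihk =>
      rw [Function.iterate_succ_apply, Function.iterate_succ_apply, partialDeriv_polyExp_right, ihk]

/-- The first normal derivative of x² is 2(α,x), which vanishes on the hyperplane; the third and
higher ones are zero. -/
lemma Arrangement.sum_sq_mem_twistedQI {A : Arrangement n ι} :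
    (∑ j, X j ^ 2 : MvPolynomial (Fin n) ℂ) ∈ A.twistedQI 0 := by
  intro i s _
  have h1 : twist (A.root i) 0 (∑ j, X j ^ 2 : MvPolynomial (Fin n) ℂ) =
      C 2 * linForm (A.root i) := by
    rw [twist_apply, zero_smul, add_zero, map_sum, linForm, Finset.mul_sum]
    refine Finset.sum_congr rfl fun j _ => ?_
    rw [Derivation.leibniz_pow, dirDeriv_X]
    simp only [nsmul_eq_mul, smul_eq_mul, Nat.cast_ofNat, pow_one, Nat.add_one_sub_one, map_ofNat]
    ring
  rw [pairing_zero_right, pow_succ, Module.End.mul_apply, h1]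
  rcases s with _ | s
  · simp [restr_linForm (A.pairing_root_self i)]
  · have h2 : (twist (A.root i) 0 ^ 2) (C 2 * linForm (A.root i)) = 0 := by
      simp [pow_two, twist_apply, Derivation.leibniz, dirDeriv_linForm]
    rw [mul_add, pow_add, Module.End.mul_apply, mul_one, h2, map_zero, map_zero]

namespace Arrangement

variable [Fintype ι] {A : Arrangement n ι} {W : MvPolynomial (Fin n ⊕ Fin n) ℂ}

/-- The leading parts A_m(λ)A_m(x)x^a with |a| maximal are independent; induction on the order then
clears the rest. -/
lemma IsBANum.eq_zero_of_sum_twistMulti (hW : A.IsBANum W) {lam : Fin n → ℂ}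
    (hlam : lam ∈ A.regular) (c : (Fin n →₀ ℕ) → ℂ) (d : ℕ) :
    ∀ s : Finset (Fin n →₀ ℕ), (∀ a ∈ s, a.degree < d) →
      ∑ a ∈ s, c a • specR lam (twistMulti a W) = 0 → ∀ a ∈ s, c a = 0 := by
  induction d with
  | zero => intro s hs _ a ha; exact absurd (hs a ha) (Nat.not_lt_zero _)
  | succ d ih =>
    intro s hs h
    have hcomp : ∀ a ∈ s, homogeneousComponent (A.totalMult + d) (specR lam (twistMulti a W)) =
        if a.degree = d then C (A.discr lam) * (A.discrPoly * monomial a 1) else 0 := by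
      intro a ha
      split_ifs with had
      · have h1 := (hW.hasTop a).2.2 lam (A.totalMult + d) (by omega)
        rw [map_sub, sub_eq_zero] at h1
        rw [h1, ← smul_eq_C_mul, map_smul, homogeneousComponent_mul_of_isHomogeneous
          A.discrPoly_isHomogeneous, homogeneousComponent_of_mem (isHomogeneous_monomial _ had),
          if_pos rfl]
      · exact (hW.hasTop a).mem_degLT lam _ (by have := hs a ha; omega)
    have hsum : ∑ a ∈ s with a.degree = d, c a • monomial a (1 : ℂ) = 0 := by
      have h1 := congrArg (homogeneousComponent (A.totalMult + d)) h
      rw [map_sum, map_zero, Finset.sum_congr rfl fun a ha => by rw [map_smul, hcomp a ha]] at h1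
      simp only [smul_ite, smul_zero, ← Finset.sum_filter] at h1
      have h2 : C (A.discr lam) * A.discrPoly *
          ∑ a ∈ s with a.degree = d, c a • monomial a (1 : ℂ) = 0 := by
        rw [← h1, Finset.mul_sum]
        exact Finset.sum_congr rfl fun a _ => by rw [mul_smul_comm, mul_assoc]
      exact (mul_eq_zero.mp h2).resolve_left (mul_ne_zero
        (by simpa using A.discr_ne_zero hlam) A.discrPoly_ne_zero)
    have hd0 : ∀ a ∈ s, a.degree = d → c a = 0 := by
      intro a ha had
      have := congrArg (coeff a) hsum
      classical
      simp only [smul_monomial, smul_eq_mul, mul_one, coeff_sum, coeff_monomial, coeff_zero] at this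
      rwa [Finset.sum_ite_eq' _ a, if_pos (Finset.mem_filter.mpr ⟨ha, had⟩)] at this
    intro a ha
    by_cases had : a.degree = d
    · exact hd0 a ha had
    refine ih (s.filter fun a => a.degree ≠ d) (fun a ha => ?_) ?_ a (Finset.mem_filter.mpr ⟨ha, had⟩)
    · obtain ⟨h1, h2⟩ := Finset.mem_filter.mp ha
      have := hs a h1
      omega
    · rw [← h]
      refine Finset.sum_subset (Finset.filter_subset _ _) fun a ha ha' => ?_
      have : a.degree = d := by
        by_contra hne
        exact ha' (Finset.mem_filter.mpr ⟨ha, hne⟩)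
      rw [hd0 a ha this, zero_smul]

/-- For `p` quasi-invariant, `p(x) φ(x, λ)` is obtained from `φ` by a differential operator in
`λ` with rational coefficients. -/
theorem IsBANum.exists_operator (hW : A.IsBANum W) {p : MvPolynomial (Fin n) ℂ}
    (hp : p ∈ A.twistedQI 0) :
    ∃ D : RatDiffOp n, inR D.den * inL p * W = D.num.sum fun a c => inR c * twistMulti a W := by
  obtain ⟨d, hd⟩ := exists_mem_degLT p
  obtain ⟨S, hS⟩ := exists_finset_degree_lt n d
  obtain ⟨lam₁, hlam₁⟩ := A.exists_real_regular
  have hli : LinearIndependent ℂ fun b : S =>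
      specR (toComplex lam₁) (twistMulti (b : Fin n →₀ ℕ) W) := by
    rw [Fintype.linearIndependent_iff]
    intro g hg b
    classical
    have := hW.eq_zero_of_sum_twistMulti hlam₁ (fun a => if h : a ∈ S then g ⟨a, h⟩ else 0) d S
      (fun a ha => (hS a).mp ha) (by
        rw [← hg, ← Finset.sum_coe_sort S]
        exact Finset.sum_congr rfl fun b _ => by rw [dif_pos b.2]) b b.2
    simpa using this
  obtain ⟨den, hden, N, hN⟩ := exists_cramer
    (u := fun (b : S) lam => specR lam (twistMulti (b : Fin n →₀ ℕ) W))
    (v := fun lam => specR lam (inL p * W))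
    (fun b g => exists_eval_eq_dual_specR _ g) (fun g => exists_eval_eq_dual_specR _ g) hli
  classical
  refine ⟨⟨den, hden, Finsupp.onFinset S (fun a => if h : a ∈ S then N ⟨a, h⟩ else 0)
    fun a ha => by by_contra h; simp [h] at ha⟩, ?_⟩
  rw [Finsupp.onFinset_sum _ fun a => by simp, ← Finset.sum_coe_sort S]
  refine biPoly_ext_regular (A := A) fun lam hlam => ?_
  -- At each regular λ the coefficients exist by elimination. `hN` shows that they are the values of
  -- fixed rational functions with denominator `den`.
  have hmem := hW.mem_span_twistMulti hlam d (specR lam (inL p * W))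
    (by rw [map_mul, specR_inL]; exact mul_mem_twistedQI hp (hW.qi lam))
    (by rw [map_mul, specR_inL]; exact mul_mem_degLT_of_mem hd (hW.mem_degLT lam))
  have himage : ((fun a => specR lam (twistMulti a W)) '' {a | a.degree < d}) =
      Set.range fun b : S => specR lam (twistMulti (b : Fin n →₀ ℕ) W) := by
    ext q
    simp [← hS]
  rw [himage, Submodule.mem_span_range_iff_exists_fun] at hmem
  obtain ⟨c, hc⟩ := hmem
  rw [mul_assoc, map_mul, ← hc, map_sum, Finset.mul_sum, specR_inR]
  refine Finset.sum_congr rfl fun b _ => ?_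
  rw [map_mul, dif_pos b.2, specR_inR, ← hN lam c hc b, smul_eq_C_mul, map_mul, mul_assoc]

/-! ### The bispectral equation -/

lemma discr_mul_sum_dirDeriv (A : Arrangement n ι) (v : Fin n → ℂ) {lam : Fin n → ℂ}
    (hlam : lam ∈ A.regular) : eval lam (dirDeriv v A.discrPoly) =
      A.discr lam * ∑ i, A.mult i / A.form i lam * pairing (A.root i) v := by
  have key : ∀ s : Finset ι, eval lam (dirDeriv v (∏ i ∈ s, linForm (A.root i) ^ A.mult i)) =
      (∏ i ∈ s, A.form i lam ^ A.mult i) *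
        ∑ i ∈ s, A.mult i / A.form i lam * pairing (A.root i) v := by
    intro s
    classical
    induction s using Finset.induction_on with
    | empty => simp
    | insert i s hi ih =>
      have hfi : A.form i lam ≠ 0 := hlam i
      have hpow : (A.mult i : ℂ) * A.form i lam ^ (A.mult i - 1) =
          A.form i lam ^ A.mult i * (A.mult i / A.form i lam) := by
        rcases Nat.eq_zero_or_pos (A.mult i) with h | h
        · simp [h]
        · obtain ⟨k, hk⟩ := Nat.exists_eq_succ_of_ne_zero h.ne'
          rw [hk, Nat.succ_sub_one, pow_succ]
          field_simp
      rw [Finset.prod_insert hi, Finset.prod_insert hi, Finset.sum_insert hi, Derivation.leibniz,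
        map_add, smul_eq_mul, smul_eq_mul, map_mul, map_mul, ih, Derivation.leibniz_pow,
        dirDeriv_linForm, map_prod, pairing_comm v]
      simp only [map_pow, eval_linForm, ← form_eq_pairing, smul_eq_mul, nsmul_eq_mul, map_mul,
        map_natCast, eval_C]
      linear_combination (∏ i ∈ s, A.form i lam ^ A.mult i) * A.form i v * hpow
  exact key Finset.univ

lemma linForm_single (j : Fin n) : linForm (Pi.single j 1 : Fin n → ℂ) = X j :=
  MvPolynomial.funext fun x => by
    rw [eval_linForm, pairing_comm, pairing_single, eval_X]

/-- The difference `Y` of the two sides, stripped of the exponential, is quasi-invariant of degree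
at most |m|, hence a multiple of P(·,λ). It vanishes at x = 0 while P(0,λ) = φ(0,0) ≠ 0, so the
multiple is zero. -/
theorem IsBANum.bispectral (hW : A.IsBANum W) (h0 : eval 0 W ≠ 0) (x : Fin n → ℂ)
    {lam : Fin n → ℂ} (hlam : lam ∈ A.regular) :
    ∑ j, eval (Sum.elim x lam) (twistR (Pi.single j 1) (twistR (Pi.single j 1) W)) -
      ∑ i, 2 * (A.mult i : ℂ) / A.form i lam * eval (Sum.elim x lam) (twistR (A.root i) W) =
    pairing x x * eval (Sum.elim x lam) W := by
  set D : (Fin n → ℂ) → MvPolynomial (Fin n) ℂ := fun v => specR lam (dirDerivR v W) with hD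
  set D2 : Fin n → MvPolynomial (Fin n) ℂ :=
    fun j => specR lam (dirDerivR (Pi.single j 1) (dirDerivR (Pi.single j 1) W)) with hD2
  set p := specR lam W with hp
  set c : ι → ℂ := fun i => 2 * (A.mult i : ℂ) / A.form i lam with hc
  set Y : MvPolynomial (Fin n) ℂ :=
    ∑ j, specR lam (twistR (Pi.single j 1) (twistR (Pi.single j 1) W)) -
      ∑ i, c i • specR lam (twistR (A.root i) W) - (∑ j, X j ^ 2) * p with hY
  have hYeq : Y = ∑ j, D2 j - ∑ i, c i • D (A.root i) +
      (∑ j, 2 * X j * D (Pi.single j 1) - ∑ i, c i • (linForm (A.root i) * p)) := by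
    have h1 : ∀ v, specR lam (twistR v W) = D v + linForm v * p := fun v => specR_twistR v lam W
    have h2 : ∀ j, specR lam (twistR (Pi.single j 1) (twistR (Pi.single j 1) W)) =
        D2 j + 2 * X j * D (Pi.single j 1) + X j ^ 2 * p := fun j => by
      rw [specR_twistR, h1, twistR_apply, map_add, Derivation.leibniz, dirDerivR_inL, smul_zero,
        add_zero, smul_eq_mul, map_add, map_mul, specR_inL, linForm_single]
      simp only [hD, hD2]
      ring
    simp only [hY, h1, h2, smul_add, Finset.sum_add_distrib, Finset.sum_mul]
    ring
  have hYQI : Y ∈ A.twistedQI lam := by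
    have h1 := fun v => specR_twistR_mem_twistedQI hW.qi v
    exact sub_mem (sub_mem (Submodule.sum_mem _ fun j _ => specR_twistR_mem_twistedQI (h1 _) _ _)
      (Submodule.sum_mem _ fun i _ => Submodule.smul_mem _ _ (h1 _ _)))
      (mul_mem_twistedQI sum_sq_mem_twistedQI (hW.qi lam))
  -- The x² terms have already cancelled in `hYeq`. The potential terms of degree |m|+1 cancel
  -- because the logarithmic gradient of A_m(λ) is ∑ m_α α/(α,λ), which is why L has the
  -- coefficients 2m_α.
  have hYdeg : Y ∈ degLT n (A.totalMult + 1) := by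
    set a : (Fin n → ℂ) → ℂ := fun v => eval lam (dirDeriv v A.discrPoly)
    have hQ : ∀ v, D v - C (a v) * A.discrPoly ∈ degLT n A.totalMult := fun v => by
      have := specR_dirDerivR_mem_degLT (W := W - inR A.discrPoly * inL A.discrPoly)
        (d := A.totalMult) (fun lam => by
          rw [map_sub, map_mul, specR_inL, specR_inR, eval_discrPoly]; exact hW.top lam) v lam
      rwa [map_sub, map_sub, Derivation.leibniz, dirDerivR_inL, dirDerivR_inR, smul_zero, zero_add,
        smul_eq_mul, map_mul, specR_inR, specR_inL, mul_comm] at this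
    have hzero : ∑ j, 2 * X j * C (a (Pi.single j 1)) -
        ∑ i, c i • (linForm (A.root i) * C (A.discr lam)) = 0 := by
      refine MvPolynomial.funext fun y => ?_
      simp only [map_sub, map_sum, map_mul, eval_X, eval_C, smul_eval, map_ofNat, map_zero, a,
        A.discr_mul_sum_dirDeriv _ hlam, pairing_single, eval_linForm]
      rw [sub_eq_zero]
      simp only [pairing, Finset.mul_sum, Finset.sum_mul]
      rw [Finset.sum_comm]
      refine Finset.sum_congr rfl fun i _ => Finset.sum_congr rfl fun j _ => ?_
      simp only [hc]
      ring
    have hgrp : ∑ j, 2 * X j * D (Pi.single j 1) - ∑ i, c i • (linForm (A.root i) * p) =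
        ∑ j, (2 : ℂ) • (X j * (D (Pi.single j 1) - C (a (Pi.single j 1)) * A.discrPoly)) -
          ∑ i, c i • (linForm (A.root i) * (p - C (A.discr lam) * A.discrPoly)) := by
      rw [← sub_eq_zero]
      have h3 := congrArg (· * A.discrPoly) hzero
      simp only [zero_mul, sub_mul, Finset.sum_mul] at h3
      rw [← h3]
      simp only [mul_sub, smul_sub, Finset.sum_sub_distrib, smul_eq_C_mul, map_ofNat]
      simp only [← mul_assoc]
      ring
    rw [hYeq, hgrp]
    have hD1 := fun v lam => specR_dirDerivR_mem_degLT hW.mem_degLT v lam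
    refine add_mem (sub_mem (Submodule.sum_mem _ fun j _ => specR_dirDerivR_mem_degLT (hD1 _) _ _)
      (Submodule.sum_mem _ fun i _ => Submodule.smul_mem _ _ (hD1 _ _)))
      (sub_mem (Submodule.sum_mem _ fun j _ => Submodule.smul_mem _ _ ?_)
      (Submodule.sum_mem _ fun i _ => Submodule.smul_mem _ _ ?_))
    · rw [add_comm]; exact mul_mem_degLT (isHomogeneous_X ℂ j) (hQ _)
    · rw [add_comm]; exact mul_mem_degLT (linForm_isHomogeneous _) (hW.top lam)
  -- P(0,λ) is constant, so all its λ-derivatives vanish; the remaining terms of `Y` contain a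
  -- factor x.
  have hDzero : ∀ v, eval 0 (D v) = 0 := fun v => by
    rw [hD, eval_specR, ← eval_specL, specL_dirDerivR, hW.specL_zero, dirDeriv_C, map_zero]
  have hY0 : eval 0 Y = 0 := by
    have hD20 : ∀ j, eval 0 (D2 j) = 0 := fun j => by
      rw [hD2, eval_specR, ← eval_specL, specL_dirDerivR, specL_dirDerivR, hW.specL_zero,
        dirDeriv_C, map_zero, map_zero]
    simp only [hYeq, map_add, map_sub, map_sum, smul_eval, map_mul, hDzero, hD20, eval_linForm,
      pairing_zero_right, zero_mul, mul_zero, Finset.sum_const_zero, sub_zero, add_zero]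
  have hYzero : Y = 0 := by
    have := hW.mem_span_twistMulti hlam 1 Y hYQI hYdeg
    have himage : ((fun a => specR lam (twistMulti a W)) '' {a | a.degree < 1}) = {p} := by
      have : {a : Fin n →₀ ℕ | a.degree < 1} = {0} := by
        ext a; simp [Finsupp.degree_eq_zero_iff]
      rw [this, Set.image_singleton]
      congr 2
      unfold twistMulti
      induction List.finRange n with
      | nil => rfl
      | cons j l ih => simp
    rw [himage, Submodule.mem_span_singleton] at this
    obtain ⟨z, hz⟩ := this
    have hp0 : eval 0 p = eval 0 W := by
      rw [hp, eval_specR, ← eval_specL, hW.specL_zero, eval_C]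
    rw [← hz, smul_eval, hp0] at hY0
    rw [← hz, (mul_eq_zero.mp hY0).resolve_right h0, zero_smul]
  have := congrArg (eval x) hYzero
  simp only [hY, map_sub, map_sum, map_mul, map_pow, eval_X, smul_eval, eval_specR, hp] at this
  rw [map_zero, sub_eq_zero] at this
  rw [this, pairing]
  simp only [sq]

end Arrangement

/-! ### Taylor components -/

/-- The power series `W(s λ, u)` in `s`, with coefficients polynomials in `u`. -/
def specS (lam : Fin n → ℂ) :
    MvPolynomial (Fin n ⊕ Fin n) ℂ →+* PowerSeries (MvPolynomial (Fin n) ℂ) :=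
  eval₂Hom (PowerSeries.C.comp C) (Sum.elim
    (fun j => PowerSeries.C (C (lam j)) * PowerSeries.X) fun j => PowerSeries.C (X j))

lemma specS_C (lam : Fin n → ℂ) (c : ℂ) : specS lam (C c) = PowerSeries.C (C c) :=
  eval₂Hom_C _ _ c

lemma specS_X_inl (lam : Fin n → ℂ) (j : Fin n) :
    specS lam (X (Sum.inl j)) = PowerSeries.C (C (lam j)) * PowerSeries.X :=
  eval₂Hom_X' _ _ _

lemma specS_X_inr (lam : Fin n → ℂ) (j : Fin n) :
    specS lam (X (Sum.inr j)) = PowerSeries.C (X j) :=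
  eval₂Hom_X' _ _ _

/-- The power series `exp (s (λ, u))` in `s`. -/
def expS (lam : Fin n → ℂ) : PowerSeries (MvPolynomial (Fin n) ℂ) :=
  PowerSeries.mk fun j => C ((j.factorial : ℂ)⁻¹) * linForm lam ^ j

/-- The coefficient of `s ^ N` in `W(s λ, u) exp (s (λ, u))`, a polynomial in `u`. -/
def taylor (lam : Fin n → ℂ) (W : MvPolynomial (Fin n ⊕ Fin n) ℂ) (N : ℕ) :
    MvPolynomial (Fin n) ℂ :=
  PowerSeries.coeff N (specS lam W * expS lam)

lemma taylor_add (lam : Fin n → ℂ) (W W' : MvPolynomial (Fin n ⊕ Fin n) ℂ) (N : ℕ) :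
    taylor lam (W + W') N = taylor lam W N + taylor lam W' N := by
  rw [taylor, map_add, add_mul, map_add]; rfl

lemma taylor_sum (lam : Fin n → ℂ) {κ : Type*} (s : Finset κ)
    (W : κ → MvPolynomial (Fin n ⊕ Fin n) ℂ) (N : ℕ) :
    taylor lam (∑ i ∈ s, W i) N = ∑ i ∈ s, taylor lam (W i) N := by
  rw [taylor, map_sum, Finset.sum_mul, map_sum]; rfl

lemma specS_inR (lam : Fin n → ℂ) (p : MvPolynomial (Fin n) ℂ) :
    specS lam (inR p) = PowerSeries.C p := by
  induction p using MvPolynomial.induction_on with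
  | C a => rw [inR, rename_C, specS_C]
  | add p q hp hq => simp only [inR, map_add] at *; rw [hp, hq]
  | mul_X p j hp =>
    simp only [inR, map_mul, rename_X] at *
    rw [hp, specS_X_inr]

lemma taylor_inR_mul (lam : Fin n → ℂ) (p : MvPolynomial (Fin n) ℂ)
    (W : MvPolynomial (Fin n ⊕ Fin n) ℂ) (N : ℕ) :
    taylor lam (inR p * W) N = p * taylor lam W N := by
  rw [taylor, map_mul (specS lam), specS_inR, mul_assoc, PowerSeries.coeff_C_mul]; rfl

lemma specS_inL_of_isHomogeneous (lam : Fin n → ℂ) {p : MvPolynomial (Fin n) ℂ} {d : ℕ}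
    (hp : p.IsHomogeneous d) :
    specS lam (inL p) = PowerSeries.C (C (eval lam p)) * PowerSeries.X ^ d := by
  rw [specS, inL, coe_eval₂Hom, eval₂_rename, eval₂_eq', eval_eq', map_sum, map_sum, Finset.sum_mul]
  refine Finset.sum_congr rfl fun a ha => ?_
  have hd : ∑ i, a i = d := by
    rw [← Finsupp.degree_eq_sum]
    by_contra h
    exact (mem_support_iff.mp ha) (hp.coeff_eq_zero h)
  simp only [Function.comp_apply, Sum.elim_inl, mul_pow, Finset.prod_mul_distrib,
    Finset.prod_pow_eq_pow_sum, hd, map_mul, map_prod, map_pow]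
  rw [mul_assoc, RingHom.comp_apply]

lemma taylor_inL_mul_of_isHomogeneous (lam : Fin n → ℂ) {p : MvPolynomial (Fin n) ℂ} {d : ℕ}
    (hp : p.IsHomogeneous d) (W : MvPolynomial (Fin n ⊕ Fin n) ℂ) (N : ℕ) :
    taylor lam (inL p * W) N = if d ≤ N then eval lam p • taylor lam W (N - d) else 0 := by
  rw [taylor, map_mul (specS lam), specS_inL_of_isHomogeneous lam hp, mul_assoc, mul_assoc,
    PowerSeries.coeff_C_mul, PowerSeries.coeff_X_pow_mul']
  split_ifs
  · rw [smul_eq_C_mul]; rfl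
  · rw [mul_zero]

lemma taylor_inL_mul (lam : Fin n → ℂ) (p : MvPolynomial (Fin n) ℂ)
    (W : MvPolynomial (Fin n ⊕ Fin n) ℂ) (N : ℕ) :
    taylor lam (inL p * W) N =
      ∑ i ∈ Finset.range (N + 1), eval lam (homogeneousComponent i p) • taylor lam W (N - i) := by
  obtain ⟨d, hd⟩ := exists_mem_degLT p
  have hd' := degLT_mono (le_max_left d (N + 1)) hd
  conv_lhs => rw [← sum_homogeneousComponent_of_mem_degLT hd', inL, map_sum, Finset.sum_mul,
    taylor_sum]
  rw [Finset.sum_congr rfl fun i _ =>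
    taylor_inL_mul_of_isHomogeneous lam (homogeneousComponent_isHomogeneous i p) W N,
    ← Finset.sum_filter]
  refine Finset.sum_congr ?_ fun _ _ => rfl
  ext i
  simp only [Finset.mem_filter, Finset.mem_range]
  omega

/-- The coefficientwise derivative of a power series. -/
def coeffDeriv (v : Fin n → ℂ) (f : PowerSeries (MvPolynomial (Fin n) ℂ)) :
    PowerSeries (MvPolynomial (Fin n) ℂ) :=
  PowerSeries.mk fun N => dirDeriv v (PowerSeries.coeff N f)

lemma coeffDeriv_add (v : Fin n → ℂ) (f g : PowerSeries (MvPolynomial (Fin n) ℂ)) :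
    coeffDeriv v (f + g) = coeffDeriv v f + coeffDeriv v g := by
  ext1 N
  simp [coeffDeriv]

lemma coeffDeriv_mul (v : Fin n → ℂ) (f g : PowerSeries (MvPolynomial (Fin n) ℂ)) :
    coeffDeriv v (f * g) = coeffDeriv v f * g + f * coeffDeriv v g := by
  ext1 N
  simp only [coeffDeriv, map_add, PowerSeries.coeff_mul, PowerSeries.coeff_mk, map_sum,
    Derivation.leibniz, smul_eq_mul, Finset.sum_add_distrib]
  rw [add_comm]
  congr 1
  exact Finset.sum_congr rfl fun _ _ => mul_comm _ _

lemma coeffDeriv_C (v : Fin n → ℂ) (p : MvPolynomial (Fin n) ℂ) :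
    coeffDeriv v (PowerSeries.C p) = PowerSeries.C (dirDeriv v p) := by
  ext1 N
  simp only [coeffDeriv, PowerSeries.coeff_mk, PowerSeries.coeff_C]
  split_ifs <;> simp

lemma coeffDeriv_X (v : Fin n → ℂ) : coeffDeriv v PowerSeries.X = 0 := by
  ext1 N
  simp only [coeffDeriv, PowerSeries.coeff_mk, PowerSeries.coeff_X, map_zero]
  split_ifs <;> simp

lemma coeffDeriv_specS (v lam : Fin n → ℂ) (W : MvPolynomial (Fin n ⊕ Fin n) ℂ) :
    coeffDeriv v (specS lam W) = specS lam (dirDerivR v W) := by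
  induction W using MvPolynomial.induction_on with
  | C a =>
    have h2 : dirDerivR v (C a : MvPolynomial (Fin n ⊕ Fin n) ℂ) = 0 := (dirDerivR v).map_algebraMap a
    rw [specS_C, h2, coeffDeriv_C, dirDeriv_C, map_zero, map_zero]
  | add p q hp hq => rw [map_add, coeffDeriv_add, hp, hq, map_add, map_add]
  | mul_X p j hp =>
    have hX : coeffDeriv v (specS lam (X j)) = specS lam (dirDerivR v (X j)) := by
      rcases j with j | j
      · have := dirDerivR_inL v (X j)
        rw [inL, rename_X] at this
        rw [this, map_zero, specS_X_inl, coeffDeriv_mul, coeffDeriv_C,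
          coeffDeriv_X, dirDeriv_C, map_zero, zero_mul, mul_zero, add_zero]
      · have := dirDerivR_inR v (X j)
        rw [inR, rename_X] at this
        rw [this, specS_inR, specS_X_inr, coeffDeriv_C]
    rw [map_mul, coeffDeriv_mul, hp, hX, Derivation.leibniz, map_add, smul_eq_mul, smul_eq_mul,
      map_mul, map_mul, add_comm, mul_comm (specS lam (X j))]

lemma coeffDeriv_expS (v lam : Fin n → ℂ) :
    coeffDeriv v (expS lam) = PowerSeries.C (C (pairing v lam)) * PowerSeries.X * expS lam := by
  ext1 N
  rw [mul_assoc, PowerSeries.coeff_C_mul]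
  simp only [coeffDeriv, expS, PowerSeries.coeff_mk]
  rcases N with _ | N
  · simp
  · rw [PowerSeries.coeff_succ_X_mul, PowerSeries.coeff_mk, Derivation.leibniz, dirDeriv_C,
      smul_zero, add_zero, Derivation.leibniz_pow, dirDeriv_linForm, Nat.add_sub_cancel,
      smul_eq_mul, smul_eq_mul, nsmul_eq_mul, Nat.factorial_succ]
    have : (((N + 1 : ℕ) * N.factorial : ℕ) : ℂ)⁻¹ * (N + 1 : ℕ) = (N.factorial : ℂ)⁻¹ := by
      push_cast
      have : (N : ℂ) + 1 ≠ 0 := by exact_mod_cast N.succ_ne_zero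
      field_simp
    rw [← this, map_mul, map_natCast]
    ring

/-- Differentiation in u commutes with extracting the coefficient of s^N. Since u occupies the
second slot, the derivative of P·exp is expressed by `twistR`. -/
theorem dirDeriv_taylor (v lam : Fin n → ℂ) (W : MvPolynomial (Fin n ⊕ Fin n) ℂ) (N : ℕ) :
    dirDeriv v (taylor lam W N) = taylor lam (twistR v W) N := by
  have h : coeffDeriv v (specS lam W * expS lam) = specS lam (twistR v W) * expS lam := by
    rw [coeffDeriv_mul, coeffDeriv_specS, coeffDeriv_expS, twistR_apply, map_add, map_mul,
      specS_inL_of_isHomogeneous lam (linForm_isHomogeneous v), eval_linForm, pow_one]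
    ring
  rw [taylor, taylor, ← h, coeffDeriv, PowerSeries.coeff_mk]

lemma rescale_C (a b : MvPolynomial (Fin n) ℂ) :
    PowerSeries.rescale a (PowerSeries.C b) = PowerSeries.C b := by
  ext1 N
  rw [PowerSeries.coeff_rescale, PowerSeries.coeff_C]
  split_ifs with h <;> simp [h]

lemma taylor_smul (t : ℂ) (lam : Fin n → ℂ) (W : MvPolynomial (Fin n ⊕ Fin n) ℂ) (N : ℕ) :
    taylor (t • lam) W N = t ^ N • taylor lam W N := by
  have h1 : specS (t • lam) = (PowerSeries.rescale (C t)).comp (specS lam) := by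
    refine MvPolynomial.ringHom_ext (fun c => ?_) fun j => ?_
    · rw [RingHom.comp_apply, specS_C, specS_C, rescale_C]
    · rcases j with j | j
      · rw [RingHom.comp_apply, specS_X_inl, specS_X_inl, map_mul, rescale_C,
          PowerSeries.rescale_X, Pi.smul_apply, smul_eq_mul, map_mul, map_mul]
        ring
      · rw [RingHom.comp_apply, specS_X_inr, specS_X_inr, rescale_C]
  have hl : linForm (t • lam) = C t * linForm lam := MvPolynomial.funext fun x => by
    simp [eval_linForm, pairing_smul_left]
  have h2 : expS (t • lam) = PowerSeries.rescale (C t) (expS lam) := by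
    ext1 N
    rw [PowerSeries.coeff_rescale, expS, expS, PowerSeries.coeff_mk, PowerSeries.coeff_mk, hl]
    ring
  rw [taylor, h1, h2, RingHom.comp_apply, ← map_mul, PowerSeries.coeff_rescale, smul_eq_C_mul,
    map_pow]
  rfl

/-- Dilating u by t has the same effect on φ(sλ,u) as dilating s, so the coefficient of s^N is
multiplied by t^N. -/
lemma scale_taylor (t : ℂ) (lam : Fin n → ℂ) {W : MvPolynomial (Fin n ⊕ Fin n) ℂ}
    (h : scaleL t W = scaleR t W) (N : ℕ) :
    scale t (taylor lam W N) = t ^ N • taylor lam W N := by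
  have h1 : (PowerSeries.map (scale t).toRingHom).comp (specS lam) =
      (specS lam).comp (scaleR t).toRingHom := by
    refine MvPolynomial.ringHom_ext (fun c => ?_) fun j => ?_
    · have h2 : scaleR t (C c : MvPolynomial (Fin n ⊕ Fin n) ℂ) = C c := (scaleR t).commutes c
      simp [specS_C, h2]
    · rcases j with j | j
      · simp [specS_X_inl, scaleR]
      · simp [scaleR, specS_C, specS_X_inr]
        simp [scale]
  have h2 : (specS lam).comp (scaleL t).toRingHom = specS (t • lam) := by
    refine MvPolynomial.ringHom_ext (fun c => ?_) fun j => ?_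
    · have h2 : scaleL t (C c : MvPolynomial (Fin n ⊕ Fin n) ℂ) = C c := (scaleL t).commutes c
      simp [specS_C, h2]
    · rcases j with j | j
      · simp [scaleL, specS_C, specS_X_inl, mul_assoc]
      · simp [specS_X_inr, scaleL]
  have hl : scale t (linForm lam) = linForm (t • lam) := MvPolynomial.funext fun x => by
    rw [eval_scale, eval_linForm, eval_linForm, pairing_smul_left, pairing_smul_right]
  have h3 : PowerSeries.map (scale t).toRingHom (expS lam) = expS (t • lam) := by
    ext1 N
    simp [expS, hl]
  have h4 : PowerSeries.map (scale t).toRingHom (specS lam W) = specS (t • lam) W := by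
    rw [← h2]
    change ((PowerSeries.map (scale t).toRingHom).comp (specS lam)) W = specS lam (scaleL t W)
    rw [h1, h]
    rfl
  rw [← taylor_smul, taylor, taylor, ← h3, ← h4, ← map_mul, PowerSeries.coeff_map]
  rfl

/-- Dilation by 2 multiplies the component of degree r by 2^r, and these eigenvalues are distinct.
-/
lemma isHomogeneous_of_scale_two {p : MvPolynomial (Fin n) ℂ} {N : ℕ}
    (h : scale 2 p = (2 : ℂ) ^ N • p) : p.IsHomogeneous N := by
  have hcomp : ∀ r, r ≠ N → homogeneousComponent r p = 0 := by
    intro r hr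
    have h1 : homogeneousComponent r (scale 2 p) = (2 : ℂ) ^ r • homogeneousComponent r p := by
      obtain ⟨d, hd⟩ := exists_mem_degLT p
      have hd' := degLT_mono (le_max_left d (r + 1)) hd
      conv_lhs => rw [← sum_homogeneousComponent_of_mem_degLT hd', map_sum, map_sum]
      rw [Finset.sum_eq_single r]
      · rw [scale_of_isHomogeneous (homogeneousComponent_isHomogeneous r p), map_smul,
          homogeneousComponent_of_mem (homogeneousComponent_isHomogeneous r p), if_pos rfl]
      · intro b _ hb
        rw [scale_of_isHomogeneous (homogeneousComponent_isHomogeneous b p), map_smul,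
          homogeneousComponent_of_mem (homogeneousComponent_isHomogeneous b p), if_neg hb.symm,
          smul_zero]
      · intro hr
        exact absurd (Finset.mem_range.mpr (by omega)) hr
    rw [h, map_smul, ← sub_eq_zero, ← sub_smul] at h1
    refine (smul_eq_zero.mp h1).resolve_left (sub_ne_zero.mpr fun h2 => hr ?_)
    have h3 : (2 : ℕ) ^ N = 2 ^ r := by exact_mod_cast h2
    exact (Nat.pow_right_injective le_rfl h3).symm
  obtain ⟨d, hd⟩ := exists_mem_degLT p
  have hd' := degLT_mono (le_max_left d (N + 1)) hd
  rw [← sum_homogeneousComponent_of_mem_degLT hd', Finset.sum_eq_single N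
    (fun b _ hb => hcomp b hb) fun hN => absurd (Finset.mem_range.mpr (by omega)) hN]
  exact homogeneousComponent_isHomogeneous N p

lemma Arrangement.IsBANum.taylor_isHomogeneous [Fintype ι] {A : Arrangement n ι}
    {W : MvPolynomial (Fin n ⊕ Fin n) ℂ} (hW : A.IsBANum W) (lam : Fin n → ℂ) (N : ℕ) :
    (taylor lam W N).IsHomogeneous N :=
  isHomogeneous_of_scale_two (scale_taylor 2 lam (hW.scaleL_eq_scaleR 2) N)

/-! ### The equations satisfied by the Taylor components -/

lemma partialDeriv_eval (j : Fin n) (p : MvPolynomial (Fin n) ℂ) :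
    partialDeriv j (fun y => eval y p) = fun y => eval y (dirDeriv (Pi.single j 1) p) :=
  funext fun x => lineDeriv_eval p x _

lemma multiDeriv_taylor (a : Fin n →₀ ℕ) (lam : Fin n → ℂ) (W : MvPolynomial (Fin n ⊕ Fin n) ℂ)
    (N : ℕ) : multiDeriv a (fun y => eval y (taylor lam W N)) =
      fun y => eval y (taylor lam (twistMulti a W) N) := by
  unfold multiDeriv twistMulti
  induction List.finRange n with
  | nil => rfl
  | cons j l ih =>
    rw [List.foldr_cons, List.foldr_cons, ih]
    generalize List.foldr _ W l = W'
    induction a j generalizing W' with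
    | zero => rfl
    | succ k ihk =>
      rw [Function.iterate_succ_apply, Function.iterate_succ_apply, partialDeriv_eval,
        dirDeriv_taylor, ihk]

/-- Compares coefficients of s^N in the operator identity: multiplication by p(sλ) distributes its
homogeneous parts over the Taylor components. -/
lemma taylor_operator {D : RatDiffOp n} {p : MvPolynomial (Fin n) ℂ}
    {W : MvPolynomial (Fin n ⊕ Fin n) ℂ}
    (hD : inR D.den * inL p * W = D.num.sum fun a c => inR c * twistMulti a W)
    (lam : Fin n → ℂ) (N : ℕ) {x : Fin n → ℂ} (hx : eval x D.den ≠ 0) :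
    D.apply (fun y => eval y (taylor lam W N)) x =
      eval x (∑ i ∈ Finset.range (N + 1),
        eval lam (homogeneousComponent i p) • taylor lam W (N - i)) := by
  have h := congrArg (fun W => eval x (taylor lam W N)) hD
  simp only [mul_assoc, taylor_inR_mul, taylor_inL_mul, Finsupp.sum, taylor_sum, map_mul] at h
  rw [map_sum] at h
  rw [RatDiffOp.apply, Finsupp.sum, div_eq_iff hx, mul_comm, map_sum, h, map_sum]
  refine Finset.sum_congr rfl fun a _ => ?_
  rw [multiDeriv_taylor, map_mul]

namespace Arrangement

variable [Fintype ι] {A : Arrangement n ι} {W : MvPolynomial (Fin n ⊕ Fin n) ℂ}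

lemma L_eval (A : Arrangement n ι) (p : MvPolynomial (Fin n) ℂ) (u : Fin n → ℂ) :
    A.L (fun y => eval y p) u =
      ∑ j, eval u (dirDeriv (Pi.single j 1) (dirDeriv (Pi.single j 1) p)) -
        ∑ i, 2 * (A.mult i : ℂ) / A.form i u * eval u (dirDeriv (A.root i) p) := by
  simp only [L, partialDeriv_eval, lineDeriv_eval]
  rfl

/-- The coefficient of s^N in L_uφ(sλ,u) = s²λ²φ(sλ,u). To stay within polynomials, the equation is
first multiplied by the product `F` of all the linear forms; `G i` is the cleared coefficient of the
first-order term for α_i. -/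
theorem IsBANum.L_taylor (hW : A.IsBANum W) (h0 : eval 0 W ≠ 0) (lam : Fin n → ℂ) (N : ℕ)
    {u : Fin n → ℂ} (hu : u ∈ A.regular) :
    A.L (fun y => eval y (taylor lam W N)) u =
      if 2 ≤ N then pairing lam lam * eval u (taylor lam W (N - 2)) else 0 := by
  classical
  set F := A.formProd with hF
  set G : ι → MvPolynomial (Fin n) ℂ :=
    fun i => C (2 * (A.mult i : ℂ)) * ∏ k ∈ Finset.univ.erase i, linForm (A.root k) with hG
  have hGF : ∀ i, ∀ y ∈ A.regular,
      eval y (G i) = 2 * (A.mult i : ℂ) / A.form i y * eval y F := fun i y hy => by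
    have : eval y F = A.form i y * ∏ k ∈ Finset.univ.erase i, A.form k y := by
      rw [Finset.mul_prod_erase _ (fun k => A.form k y) (Finset.mem_univ i), hF, formProd, map_prod]
      simp only [eval_linForm, form_eq_pairing]
    rw [this, hG]
    simp only [map_mul, eval_C, map_prod, eval_linForm, ← form_eq_pairing]
    have := hy i
    field_simp
  obtain ⟨Q, hQ2, hQ⟩ : ∃ Q : MvPolynomial (Fin n) ℂ, Q.IsHomogeneous 2 ∧
      ∀ x, eval x Q = pairing x x :=
    ⟨∑ j, X j ^ 2, IsHomogeneous.sum _ _ _ fun j _ => by simpa using (isHomogeneous_X ℂ j).pow 2,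
      fun x => by simp only [map_sum, map_mul, eval_X, pairing, sq]⟩
  have key : ∑ j, inR F * twistR (Pi.single j 1) (twistR (Pi.single j 1) W) =
      ∑ i, inR (G i) * twistR (A.root i) W + inR F * (inL Q * W) := by
    refine biPoly_ext_regular (A := A) fun y hy => MvPolynomial.funext fun x => ?_
    have h := hW.bispectral h0 x hy
    simp only [map_sum, map_add, map_mul, specR_inL, specR_inR, eval_C, eval_specR, hQ,
      hGF _ y hy]
    rw [← Finset.mul_sum, ← h, mul_sub, add_sub_left_comm, Finset.mul_sum _ _ (eval y F),
      Finset.mul_sum _ _ (eval y F), left_eq_add, sub_eq_zero]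
    exact Finset.sum_congr rfl fun i _ => by ring
  have h2 := congrArg (fun W => eval u (taylor lam W N)) key
  simp only [taylor_add, taylor_sum, taylor_inR_mul, taylor_inL_mul_of_isHomogeneous lam hQ2,
    map_sum, map_add, map_mul, ← dirDeriv_taylor, hGF _ u hu] at h2
  have hF0 : eval u F ≠ 0 := (A.mem_regular_iff u).mp hu
  have h3 : eval u (if 2 ≤ N then eval lam Q • taylor lam W (N - 2) else 0) =
      if 2 ≤ N then pairing lam lam * eval u (taylor lam W (N - 2)) else 0 := by
    split_ifs
    · rw [smul_eval, hQ]
    · rw [map_zero]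
  rw [L_eval, ← h3]
  refine mul_left_cancel₀ hF0 ?_
  rw [mul_sub, Finset.mul_sum, h2, Finset.mul_sum, sub_eq_iff_eq_add, add_comm]
  congr 1
  exact Finset.sum_congr rfl fun i _ => by ring

lemma IsBANum.taylor_zero (hW : A.IsBANum W) (lam : Fin n → ℂ) :
    taylor lam W 0 = C (eval 0 W) := by
  have h : taylor lam W 0 = specL 0 W := by
    rw [taylor, PowerSeries.coeff_zero_eq_constantCoeff, map_mul]
    have h1 : PowerSeries.constantCoeff (expS lam) = 1 := by
      rw [← PowerSeries.coeff_zero_eq_constantCoeff_apply, expS, PowerSeries.coeff_mk]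
      simp
    rw [h1, mul_one]
    have : (PowerSeries.constantCoeff).comp (specS lam) =
        (specL 0 : MvPolynomial (Fin n ⊕ Fin n) ℂ →ₐ[ℂ] MvPolynomial (Fin n) ℂ).toRingHom := by
      refine MvPolynomial.ringHom_ext (fun c => ?_) fun j => ?_
      · have h2 : specL 0 (C c : MvPolynomial (Fin n ⊕ Fin n) ℂ) = C c := (specL 0).commutes c
        simp [specS_C, h2]
      · rcases j with j | j
        · simp [specS_X_inl, specL]
        · simp [specS_X_inr, specL]
    exact congrArg (fun f => f W) this
  rw [h, hW.specL_zero]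

end Arrangement

/-! ### Convergence of the Taylor expansion -/

lemma taylor_C (lam : Fin n → ℂ) (c : ℂ) (N : ℕ) :
    taylor lam (C c) N = C (c * (N.factorial : ℂ)⁻¹) * linForm lam ^ N := by
  rw [taylor, specS_C, PowerSeries.coeff_C_mul, expS, PowerSeries.coeff_mk, map_mul, mul_assoc]

lemma taylor_mul_X_inr (lam : Fin n → ℂ) (W : MvPolynomial (Fin n ⊕ Fin n) ℂ) (j : Fin n) (N : ℕ) :
    taylor lam (W * X (Sum.inr j)) N = X j * taylor lam W N := by
  rw [mul_comm, ← taylor_inR_mul, inR, rename_X]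

lemma taylor_mul_X_inl_zero (lam : Fin n → ℂ) (W : MvPolynomial (Fin n ⊕ Fin n) ℂ) (j : Fin n) :
    taylor lam (W * X (Sum.inl j)) 0 = 0 := by
  have := taylor_inL_mul_of_isHomogeneous lam (isHomogeneous_X ℂ j) W 0
  rwa [inL, rename_X, mul_comm, if_neg (by omega)] at this

lemma taylor_mul_X_inl_succ (lam : Fin n → ℂ) (W : MvPolynomial (Fin n ⊕ Fin n) ℂ) (j : Fin n)
    (N : ℕ) : taylor lam (W * X (Sum.inl j)) (N + 1) = lam j • taylor lam W N := by
  have := taylor_inL_mul_of_isHomogeneous lam (isHomogeneous_X ℂ j) W (N + 1)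
  rwa [inL, rename_X, mul_comm, if_pos (by omega), eval_X] at this

lemma hasSum_taylor (lam u : Fin n → ℂ) (W : MvPolynomial (Fin n ⊕ Fin n) ℂ) :
    HasSum (fun N => eval u (taylor lam W N))
      (eval (Sum.elim lam u) W * Complex.exp (pairing lam u)) := by
  induction W using MvPolynomial.induction_on with
  | C c =>
    simp only [taylor_C, map_mul, eval_C, map_pow, eval_linForm, mul_assoc]
    refine HasSum.mul_left c ?_
    have := NormedSpace.expSeries_div_hasSum_exp (pairing lam u)
    rw [← Complex.exp_eq_exp_ℂ] at this
    simpa only [div_eq_inv_mul] using this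
  | add p q hp hq => simpa only [taylor_add, map_add, add_mul] using hp.add hq
  | mul_X p j hp =>
    rcases j with j | j
    · rw [hasSum_nat_add_iff' 1 |>.symm]
      simp only [Finset.sum_range_one, taylor_mul_X_inl_zero, map_zero, sub_zero,
        taylor_mul_X_inl_succ, smul_eval, map_mul, eval_X, Sum.elim_inl]
      rw [mul_right_comm, mul_comm]
      exact hp.mul_left (lam j)
    · simp only [taylor_mul_X_inr, map_mul, eval_X, Sum.elim_inr]
      rw [mul_right_comm, mul_comm]
      exact hp.mul_left (u j)

lemma norm_pairing_le (x y : Fin n → ℂ) : ‖pairing x y‖ ≤ ‖x‖ * ∑ j, ‖y j‖ := by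
  rw [pairing, Finset.mul_sum]
  refine (norm_sum_le _ _).trans (Finset.sum_le_sum fun j _ => ?_)
  rw [norm_mul]
  exact mul_le_mul_of_nonneg_right (norm_le_pi_norm x j) (norm_nonneg _)

/-- The bound does not depend on the number of terms. It provides the dominating function for
integrating the Taylor series term by term against the Gaussian weight. -/
lemma exists_sum_norm_taylor_le (lam : Fin n → ℂ) (W : MvPolynomial (Fin n ⊕ Fin n) ℂ) :
    ∃ K c : ℝ, 0 ≤ K ∧ 0 ≤ c ∧ ∀ u N, ∑ k ∈ Finset.range N, ‖eval u (taylor lam W k)‖ ≤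
      K * Real.exp (c * ∑ j, ‖u j‖) := by
  induction W using MvPolynomial.induction_on with
  | C a =>
    refine ⟨‖a‖, ‖lam‖, norm_nonneg _, norm_nonneg _, fun u N => ?_⟩
    have h : ∀ k, ‖eval u (taylor lam (C a) k)‖ ≤
        ‖a‖ * ((‖lam‖ * ∑ j, ‖u j‖) ^ k / k.factorial) := fun k => by
      simp only [taylor_C, map_mul, eval_C, map_pow, eval_linForm, norm_mul, norm_inv, norm_pow,
        Complex.norm_natCast, mul_assoc]
      rw [div_eq_inv_mul]
      gcongr
      exact norm_pairing_le lam u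
    refine (Finset.sum_le_sum fun k _ => h k).trans ?_
    rw [← Finset.mul_sum]
    exact mul_le_mul_of_nonneg_left (Real.sum_le_exp_of_nonneg
      (mul_nonneg (norm_nonneg _) (Finset.sum_nonneg fun _ _ => norm_nonneg _)) N) (norm_nonneg _)
  | add p q hp hq =>
    obtain ⟨K, c, hK, hc, h⟩ := hp
    obtain ⟨K', c', hK', hc', h'⟩ := hq
    refine ⟨K + K', max c c', by positivity, le_max_of_le_left hc, fun u N => ?_⟩
    simp only [taylor_add, map_add]
    have hu : 0 ≤ ∑ j, ‖u j‖ := Finset.sum_nonneg fun _ _ => norm_nonneg _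
    calc _ ≤ ∑ k ∈ Finset.range N, (‖eval u (taylor lam p k)‖ + ‖eval u (taylor lam q k)‖) :=
          Finset.sum_le_sum fun k _ => norm_add_le _ _
      _ ≤ K * Real.exp (c * ∑ j, ‖u j‖) + K' * Real.exp (c' * ∑ j, ‖u j‖) := by
          rw [Finset.sum_add_distrib]; exact add_le_add (h u N) (h' u N)
      _ ≤ _ := by
          rw [add_mul]
          gcongr
          · exact le_max_left _ _
          · exact le_max_right _ _
  | mul_X p j hp =>
    obtain ⟨K, c, hK, hc, h⟩ := hp
    rcases j with j | j
    · refine ⟨‖lam j‖ * K, c, by positivity, hc, fun u N => ?_⟩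
      rcases N with _ | N
      · simp only [Finset.range_zero, Finset.sum_empty]; positivity
      · rw [Finset.sum_range_succ']
        simp only [taylor_mul_X_inl_zero, taylor_mul_X_inl_succ, map_zero, norm_zero, add_zero,
          smul_eval, norm_mul, ← Finset.mul_sum, mul_assoc]
        exact mul_le_mul_of_nonneg_left (h u N) (norm_nonneg _)
    · refine ⟨K, c + 1, hK, by positivity, fun u N => ?_⟩
      simp only [taylor_mul_X_inr, map_mul, eval_X, norm_mul, ← Finset.mul_sum]
      rw [add_mul, Real.exp_add, one_mul, mul_comm (Real.exp _), mul_left_comm]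
      refine mul_le_mul ?_ (h u N) (Finset.sum_nonneg fun _ _ => norm_nonneg _)
        (Real.exp_pos _).le
      calc ‖u j‖ ≤ ∑ j, ‖u j‖ :=
            Finset.single_le_sum (f := fun j => ‖u j‖) (fun _ _ => norm_nonneg _) (Finset.mem_univ j)
        _ ≤ _ := (Real.add_one_le_exp _).trans' (by linarith)

/-! ### Complex conjugation -/

/-- Complex conjugation of the coefficients. -/
abbrev conj {σ : Type*} : MvPolynomial σ ℂ →+* MvPolynomial σ ℂ := map (starRingEnd ℂ)

/-! ### Contours and Gaussian bounds -/

/-- The point `-ξ + i y` of `ℂⁿ`. -/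
def contour (ξ y : Fin n → ℝ) : Fin n → ℂ := Complex.I • toComplex y - toComplex ξ

/-- `|y_1| + ⋯ + |y_n|`. -/
def l1 (y : Fin n → ℝ) : ℝ := ∑ j, |y j|

/-- `exp (-y² / 2)`. -/
def gauss (y : Fin n → ℝ) : ℝ := Real.exp (-(∑ j, y j ^ 2) / 2)

lemma l1_nonneg (y : Fin n → ℝ) : 0 ≤ l1 y := Finset.sum_nonneg fun _ _ => abs_nonneg _

lemma gauss_nonneg (y : Fin n → ℝ) : 0 ≤ gauss y := (Real.exp_pos _).le

@[fun_prop]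
lemma continuous_l1 : Continuous (l1 : (Fin n → ℝ) → ℝ) := by unfold l1; fun_prop

@[fun_prop]
lemma continuous_gauss : Continuous (gauss : (Fin n → ℝ) → ℝ) := by unfold gauss; fun_prop

@[fun_prop]
lemma continuous_toComplex : Continuous (toComplex : (Fin n → ℝ) → Fin n → ℂ) := by
  unfold toComplex; fun_prop

@[fun_prop]
lemma continuous_contour (ξ : Fin n → ℝ) : Continuous (contour ξ) := by unfold contour; fun_prop

lemma gauss_eq_prod (y : Fin n → ℝ) : gauss y = ∏ j, Real.exp (-(1 / 2) * y j ^ 2) := by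
  rw [gauss, ← Real.exp_sum, ← Finset.mul_sum]
  congr 1
  ring

lemma integral_gauss : ∫ y : Fin n → ℝ, gauss y = (2 * Real.pi) ^ ((n : ℝ) / 2) := by
  simp only [gauss_eq_prod]
  rw [integral_fintype_prod_volume_eq_pow (fun x : ℝ => Real.exp (-(1 / 2) * x ^ 2)),
    integral_gaussian, Fintype.card_fin, Real.sqrt_eq_rpow, ← Real.rpow_natCast,
    ← Real.rpow_mul (by positivity)]
  congr 1
  · ring
  · ring

/-- Completing the square gives c|y_j| ≤ c² + y_j²/4, which spends half of the Gaussian exponent on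
the exponential growth. -/
lemma integrable_bound (K c : ℝ) :
    Integrable fun y : Fin n → ℝ => K * Real.exp (c * l1 y) * gauss y := by
  have h1 : Integrable fun y : Fin n → ℝ => ∏ j, Real.exp (-(1 / 4) * y j ^ 2) :=
    Integrable.fintype_prod fun _ => integrable_exp_neg_mul_sq (by norm_num)
  refine (h1.const_mul (|K| * Real.exp (n * c ^ 2))).mono' (by fun_prop) (.of_forall fun y => ?_)
  rw [norm_mul, norm_mul, Real.norm_eq_abs, Real.norm_eq_abs, Real.norm_eq_abs,
    abs_of_pos (Real.exp_pos _), abs_of_nonneg (gauss_nonneg y), mul_assoc, mul_assoc]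
  refine mul_le_mul_of_nonneg_left ?_ (abs_nonneg _)
  rw [gauss, ← Real.exp_add, ← Real.exp_sum, ← Real.exp_add, Real.exp_le_exp, l1, Finset.mul_sum,
    neg_div, Finset.sum_div, ← Finset.sum_neg_distrib, ← Finset.sum_add_distrib]
  have : (n : ℝ) * c ^ 2 = ∑ _j : Fin n, c ^ 2 := by simp
  rw [this, ← Finset.sum_add_distrib]
  refine Finset.sum_le_sum fun j _ => ?_
  nlinarith [sq_nonneg (|y j| / 2 - c), sq_abs (y j)]

/-- The functions `G t`, `t ∈ S`, are bounded by a common exponential. -/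
def Tame {T : Type*} (S : Set T) (G : T → (Fin n → ℝ) → ℂ) : Prop :=
  ∃ K c : ℝ, 0 ≤ K ∧ 0 ≤ c ∧ ∀ t ∈ S, ∀ y, ‖G t y‖ ≤ K * Real.exp (c * l1 y)

namespace Tame

variable {T : Type*} {S : Set T} {G G' : T → (Fin n → ℝ) → ℂ}

lemma of_bounded (K : ℝ) (h : ∀ t ∈ S, ∀ y, ‖G t y‖ ≤ K) : Tame S G :=
  ⟨max K 0, 0, le_max_right _ _, le_rfl, fun t ht y => by
    simpa using Or.inl (h t ht y)⟩

lemma const (c : ℂ) : Tame S fun _ (_ : Fin n → ℝ) => c := of_bounded ‖c‖ fun _ _ _ => le_rfl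

lemma add (h : Tame S G) (h' : Tame S G') : Tame S fun t y => G t y + G' t y := by
  obtain ⟨K, c, hK, hc, h⟩ := h
  obtain ⟨K', c', hK', hc', h'⟩ := h'
  refine ⟨K + K', max c c', by positivity, le_max_of_le_left hc, fun t ht y => ?_⟩
  refine (norm_add_le _ _).trans ((add_le_add (h t ht y) (h' t ht y)).trans ?_)
  have := l1_nonneg y
  rw [add_mul]
  gcongr
  · exact le_max_left _ _
  · exact le_max_right _ _

lemma mul (h : Tame S G) (h' : Tame S G') : Tame S fun t y => G t y * G' t y := by
  obtain ⟨K, c, hK, hc, h⟩ := h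
  obtain ⟨K', c', hK', hc', h'⟩ := h'
  refine ⟨K * K', c + c', by positivity, by positivity, fun t ht y => ?_⟩
  rw [norm_mul, add_mul, Real.exp_add, mul_mul_mul_comm]
  exact mul_le_mul (h t ht y) (h' t ht y) (norm_nonneg _) (by positivity)

lemma sub (h : Tame S G) (h' : Tame S G') : Tame S fun t y => G t y - G' t y := by
  have := h.add ((const (-1)).mul h')
  simpa [sub_eq_add_neg] using this

lemma sum {κ : Type*} (s : Finset κ) {G : κ → T → (Fin n → ℝ) → ℂ} (h : ∀ i ∈ s, Tame S (G i)) :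
    Tame S fun t y => ∑ i ∈ s, G i t y := by
  classical
  induction s using Finset.induction_on with
  | empty => simpa using const 0
  | insert i s hi ih =>
    simp only [Finset.sum_insert hi]
    exact (h i (Finset.mem_insert_self _ _)).add
      (ih fun k hk => h k (Finset.mem_insert_of_mem hk))

lemma pow (h : Tame S G) (k : ℕ) : Tame S fun t y => G t y ^ k := by
  induction k with
  | zero => simpa using const 1
  | succ k ih => simpa only [pow_succ] using ih.mul h

lemma prod {κ : Type*} (s : Finset κ) {G : κ → T → (Fin n → ℝ) → ℂ} (h : ∀ i ∈ s, Tame S (G i)) :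
    Tame S fun t y => ∏ i ∈ s, G i t y := by
  classical
  induction s using Finset.induction_on with
  | empty => simpa using const 1
  | insert i s hi ih =>
    simp only [Finset.prod_insert hi]
    exact (h i (Finset.mem_insert_self _ _)).mul
      (ih fun k hk => h k (Finset.mem_insert_of_mem hk))

lemma eval_poly {z : T → (Fin n → ℝ) → Fin n → ℂ} (hz : ∀ j, Tame S fun t y => z t y j)
    (p : MvPolynomial (Fin n) ℂ) : Tame S fun t y => eval (z t y) p := by
  induction p using MvPolynomial.induction_on with
  | C a => simpa using const a
  | add p q hp hq => simpa using hp.add hq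
  | mul_X p j hp => simpa using hp.mul (hz j)

lemma exists_bound (h : Tame S G) :
    ∃ g : (Fin n → ℝ) → ℝ, Integrable g ∧ ∀ t ∈ S, ∀ y, ‖G t y * gauss y‖ ≤ g y := by
  obtain ⟨K, c, hK, hc, h⟩ := h
  refine ⟨_, integrable_bound K c, fun t ht y => ?_⟩
  rw [norm_mul, Complex.norm_real, Real.norm_eq_abs, abs_of_nonneg (gauss_nonneg y)]
  exact mul_le_mul_of_nonneg_right (h t ht y) (gauss_nonneg y)

end Tame

lemma contour_apply (ξ y : Fin n → ℝ) (j : Fin n) :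
    contour ξ y j = Complex.I * y j - ξ j := rfl

lemma tame_contour_apply {T : Type*} {S : Set T} {σ : T → ℝ} {τ : T → (Fin n → ℝ) → Fin n → ℝ}
    (ξ : Fin n → ℝ) (hσ : ∃ b, ∀ t ∈ S, |σ t| ≤ b)
    (hτ : ∀ j, Tame S fun t y => ((τ t y j : ℝ) : ℂ)) (j : Fin n) :
    Tame S fun t y => contour (σ t • ξ) (τ t y) j := by
  obtain ⟨b, hb⟩ := hσ
  simp only [contour_apply]
  refine ((Tame.const _).mul (hτ j)).sub (Tame.of_bounded (b * |ξ j|) fun t ht y => ?_)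
  rw [Complex.norm_real, Pi.smul_apply, smul_eq_mul, norm_mul, Real.norm_eq_abs, Real.norm_eq_abs]
  exact mul_le_mul_of_nonneg_right (hb t ht) (abs_nonneg _)

lemma tame_apply {T : Type*} {S : Set T} (j : Fin n) :
    Tame S fun _ (y : Fin n → ℝ) => ((y j : ℝ) : ℂ) :=
  ⟨1, 1, zero_le_one, zero_le_one, fun _ _ y => by
    rw [Complex.norm_real, Real.norm_eq_abs, one_mul, one_mul]
    calc |y j| ≤ l1 y :=
          Finset.single_le_sum (f := fun j => |y j|) (fun _ _ => abs_nonneg _) (Finset.mem_univ j)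
      _ ≤ _ := (Real.add_one_le_exp _).trans' (by linarith)⟩

lemma pairing_contour_self (ξ y : Fin n → ℝ) : (pairing (contour ξ y) (contour ξ y) / 2).re =
    ((∑ j, ξ j ^ 2) - ∑ j, y j ^ 2) / 2 := by
  have : pairing (contour ξ y) (contour ξ y) =
      ((∑ j, (ξ j ^ 2 - y j ^ 2) : ℝ) : ℂ) - 2 * Complex.I * ((∑ j, y j * ξ j : ℝ) : ℂ) := by
    simp only [pairing, contour_apply]
    push_cast
    rw [Finset.mul_sum, ← Finset.sum_sub_distrib]
    refine Finset.sum_congr rfl fun j _ => ?_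
    linear_combination (y j : ℂ) ^ 2 * Complex.I_sq
  rw [this, Finset.sum_sub_distrib]
  simp [Complex.sub_re, Complex.mul_re, -Complex.ofReal_pow]

lemma norm_exp_contour (ξ y : Fin n → ℝ) :
    ‖Complex.exp (pairing (contour ξ y) (contour ξ y) / 2)‖ =
      Real.exp ((∑ j, ξ j ^ 2) / 2) * gauss y := by
  rw [Complex.norm_exp, pairing_contour_self, gauss, ← Real.exp_add]
  congr 1
  ring

namespace Arrangement

variable (A : Arrangement n ι)

lemma re_form_contour (i : ι) (ξ y : Fin n → ℝ) :
    (A.form i (contour ξ y)).re = -∑ j, A.vec i j * ξ j := by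
  simp [form, contour_apply, pairing, toComplex]

lemma form_toComplex (i : ι) (ξ : Fin n → ℝ) :
    A.form i (toComplex ξ) = ((∑ j, A.vec i j * ξ j : ℝ) : ℂ) := pairing_toComplex _ _

variable {A}

/-- The real part of (α, iy-ξ) is -(α,ξ) for every y. So on a contour through a regular ξ the
denominators stay uniformly away from zero. -/
lemma le_norm_form_contour (i : ι) (ξ y : Fin n → ℝ) :
    ‖A.form i (toComplex ξ)‖ ≤ ‖A.form i (contour ξ y)‖ := by
  refine le_trans ?_ (Complex.abs_re_le_norm _)
  rw [re_form_contour, form_toComplex, abs_neg, Complex.norm_real, Real.norm_eq_abs]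

lemma contour_mem_regular {ξ : Fin n → ℝ} (hξ : toComplex ξ ∈ A.regular) (y : Fin n → ℝ) :
    contour ξ y ∈ A.regular := fun i => by
  rw [← norm_pos_iff]
  exact (norm_pos_iff.mpr (hξ i)).trans_le (le_norm_form_contour i ξ y)

lemma smul_real_mem_regular {ξ : Fin n → ℝ} (hξ : toComplex ξ ∈ A.regular) {s : ℝ} (hs : s ≠ 0) :
    toComplex (s • ξ) ∈ A.regular := by
  have : toComplex (s • ξ) = (s : ℂ) • toComplex ξ := by ext j; simp [toComplex]
  rw [this]
  exact smul_mem_regular hξ (by exact_mod_cast hs)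

lemma tame_inv_form {T : Type*} {S : Set T} {σ : T → ℝ} {τ : T → (Fin n → ℝ) → Fin n → ℝ}
    {ξ : Fin n → ℝ} (hξ : toComplex ξ ∈ A.regular) (hσ : ∃ a > 0, ∀ t ∈ S, a ≤ σ t) (i : ι) :
    Tame S fun t y => (A.form i (contour (σ t • ξ) (τ t y)))⁻¹ := by
  obtain ⟨a, ha, h⟩ := hσ
  refine Tame.of_bounded (a * ‖A.form i (toComplex ξ)‖)⁻¹ fun t ht y => ?_
  rw [norm_inv]
  have h0 : 0 < ‖A.form i (toComplex ξ)‖ := norm_pos_iff.mpr (hξ i)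
  have h1 : toComplex (σ t • ξ) = (σ t : ℂ) • toComplex ξ := by ext j; simp [toComplex]
  have h2 := le_norm_form_contour (A := A) i (σ t • ξ) (τ t y)
  rw [h1, form_eq_pairing, pairing_smul_right, norm_mul, Complex.norm_real, Real.norm_eq_abs] at h2
  refine inv_anti₀ (by positivity) (le_trans ?_ h2)
  exact mul_le_mul_of_nonneg_right ((h t ht).trans (le_abs_self _)) (norm_nonneg _)

lemma continuous_inv_form_comp {X : Type*} [TopologicalSpace X] {z : X → Fin n → ℂ}
    (hz : Continuous z) (h : ∀ x, z x ∈ A.regular) (i : ι) :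
    Continuous fun x => (A.form i (z x))⁻¹ := by
  refine Continuous.inv₀ ?_ fun x => h x i
  exact continuous_pairing.comp (continuous_const.prodMk hz)

variable [Fintype ι]

lemma tame_inv_discr {T : Type*} {S : Set T} {σ : T → ℝ} {τ : T → (Fin n → ℝ) → Fin n → ℝ}
    {ξ : Fin n → ℝ} (hξ : toComplex ξ ∈ A.regular) (hσ : ∃ a > 0, ∀ t ∈ S, a ≤ σ t) :
    Tame S fun t y => (A.discr (contour (σ t • ξ) (τ t y)))⁻¹ := by
  simp only [discr, ← Finset.prod_inv_distrib, ← inv_pow]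
  exact Tame.prod _ fun i _ => (tame_inv_form hξ hσ i).pow _

variable (A) in
/-- `exp (u² / 2) / A_m(u)²`. -/
def weight (u : Fin n → ℂ) : ℂ := Complex.exp (pairing u u / 2) / A.discr u ^ 2

/-- Dividing by `gauss` removes the decay of the weight; the remaining factor is bounded as long as
the dilation σ stays in a compact part of (0,∞). -/
lemma tame_weight {T : Type*} {S : Set T} {σ : T → ℝ}
    {ξ : Fin n → ℝ} (hξ : toComplex ξ ∈ A.regular) (hσ : ∃ a > 0, ∀ t ∈ S, a ≤ σ t)
    (hσ' : ∃ b, ∀ t ∈ S, |σ t| ≤ b) :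
    Tame S fun t y => A.weight (contour (σ t • ξ) y) * ((gauss y)⁻¹ : ℝ) := by
  have h1 : Tame S fun t (y : Fin n → ℝ) =>
      Complex.exp (pairing (contour (σ t • ξ) y) (contour (σ t • ξ) y) / 2) *
        ((gauss y)⁻¹ : ℝ) := by
    obtain ⟨b, hb⟩ := hσ'
    refine Tame.of_bounded (Real.exp (b ^ 2 * (∑ j, ξ j ^ 2) / 2)) fun t ht y => ?_
    have hg : 0 < gauss y := Real.exp_pos _
    rw [norm_mul, norm_exp_contour, Complex.norm_real, Real.norm_eq_abs, abs_inv,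
      abs_of_pos hg, mul_assoc, mul_inv_cancel₀ hg.ne', mul_one, Real.exp_le_exp]
    simp only [Pi.smul_apply, smul_eq_mul, mul_pow, ← Finset.mul_sum]
    have h1 := hb t ht
    have h2 : σ t ^ 2 ≤ b ^ 2 := by
      rw [← sq_abs]
      exact pow_le_pow_left₀ (abs_nonneg _) h1 2
    gcongr
  have h2 := h1.mul ((tame_inv_discr (τ := fun _ y => y) hξ hσ).pow 2)
  refine (congrArg (Tame S) ?_).mp h2
  funext t y
  rw [weight, div_eq_mul_inv, inv_pow]
  ring

lemma continuous_weight_comp {X : Type*} [TopologicalSpace X] {z : X → Fin n → ℂ}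
    (hz : Continuous z) (h : ∀ x, z x ∈ A.regular) : Continuous fun x => A.weight (z x) := by
  refine Continuous.div (Complex.continuous_exp.comp ?_) ?_
    fun x => pow_ne_zero 2 (A.discr_ne_zero (h x))
  · exact (continuous_pairing.comp (hz.prodMk hz)).div_const 2
  · simp only [← eval_discrPoly]
    exact ((continuous_eval _).comp hz).pow 2

end Arrangement

/-! ### Integration by parts and independence of the contour -/

namespace Arrangement

variable [Fintype ι] {A : Arrangement n ι} {ξ : Fin n → ℝ}

/-- The logarithmic derivative of the weight in the direction `v`. -/
def logGrad (A : Arrangement n ι) (v u : Fin n → ℂ) : ℂ :=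
  pairing v u - 2 * ∑ i, A.mult i * pairing (A.root i) v * (A.form i u)⁻¹

/-- The derivative of `q` times the weight in the direction `v`. -/
def weightedDeriv (A : Arrangement n ι) (v : Fin n → ℂ) (q : MvPolynomial (Fin n) ℂ)
    (u : Fin n → ℂ) : ℂ :=
  (eval u (dirDeriv v q) + eval u q * A.logGrad v u) * A.weight u

lemma dirDeriv_smul (c : ℂ) (v : Fin n → ℂ) (q : MvPolynomial (Fin n) ℂ) :
    dirDeriv (c • v) q = c • dirDeriv v q := by
  simp only [dirDeriv_eq_sum, Finset.smul_sum, Pi.smul_apply, smul_eq_mul, map_mul, smul_eq_C_mul,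
    mul_assoc]

lemma weightedDeriv_smul (c : ℂ) (v : Fin n → ℂ) (q : MvPolynomial (Fin n) ℂ) (u : Fin n → ℂ) :
    A.weightedDeriv (c • v) q u = c * A.weightedDeriv v q u := by
  have : A.logGrad (c • v) u = c * A.logGrad v u := by
    simp only [logGrad, pairing_smul_left, pairing_smul_right, mul_sub, Finset.mul_sum]
    congr 1
    exact Finset.sum_congr rfl fun i _ => by ring
  rw [weightedDeriv, weightedDeriv, this, dirDeriv_smul, smul_eval]
  ring

lemma hasDerivAt_weight_line {u v : Fin n → ℂ} {t : ℂ} (h : u + t • v ∈ A.regular) :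
    HasDerivAt (fun t : ℂ => A.weight (u + t • v))
      (A.logGrad v (u + t • v) * A.weight (u + t • v)) t := by
  have h1 : HasDerivAt (fun t : ℂ => pairing (u + t • v) (u + t • v) / 2)
      (pairing v (u + t • v)) t := by
    have h2 : (fun t : ℂ => pairing (u + t • v) (u + t • v) / 2) = fun t =>
        (pairing u u + 2 * t * pairing v u + t ^ 2 * pairing v v) / 2 := by
      funext t
      simp only [pairing_add_left, pairing_add_right, pairing_smul_left, pairing_smul_right,
        pairing_comm u v]
      ring
    rw [h2, pairing_add_right, pairing_smul_right]
    have h3 := ((((hasDerivAt_id t).const_mul 2).mul_const (pairing v u)).const_add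
      (pairing u u)).add ((hasDerivAt_pow 2 t).mul_const (pairing v v))
    refine (h3.div_const 2).congr_deriv ?_
    simp only [pow_one, Nat.cast_ofNat, Nat.add_one_sub_one]
    ring
  have h0 := A.discr_ne_zero h
  have h2 := hasDerivAt_eval_line A.discrPoly u v t
  rw [discr_mul_sum_dirDeriv A v h] at h2
  simp only [eval_discrPoly] at h2
  refine (h1.cexp.div (h2.pow 2) (pow_ne_zero 2 h0)).congr_deriv ?_
  rw [weight, logGrad]
  have : ∀ i, (A.mult i : ℂ) / A.form i (u + t • v) * pairing (A.root i) v =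
      A.mult i * pairing (A.root i) v * (A.form i (u + t • v))⁻¹ := fun i => by
    rw [div_eq_mul_inv]; ring
  simp only [this]
  field_simp
  simp
  ring

lemma hasDerivAt_mul_weight_line (q : MvPolynomial (Fin n) ℂ) {u v : Fin n → ℂ} {t : ℂ}
    (h : u + t • v ∈ A.regular) :
    HasDerivAt (fun t : ℂ => eval (u + t • v) q * A.weight (u + t • v))
      (A.weightedDeriv v q (u + t • v)) t := by
  refine ((hasDerivAt_eval_line q u v t).mul (hasDerivAt_weight_line h)).congr_deriv ?_
  rw [weightedDeriv]
  ring

lemma tame_eval (ξ : Fin n → ℝ) {S : Set ℝ} {b : ℝ} (hb : ∀ s ∈ S, |s| ≤ b)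
    (q : MvPolynomial (Fin n) ℂ) : Tame S fun s y => eval (contour (s • ξ) y) q :=
  Tame.eval_poly (tame_contour_apply ξ ⟨b, hb⟩ fun j => tame_apply j) q

lemma tame_weightedDeriv (hξ : toComplex ξ ∈ A.regular) {S : Set ℝ} {a b : ℝ} (ha : 0 < a)
    (has : ∀ s ∈ S, a ≤ s) (hb : ∀ s ∈ S, |s| ≤ b) (v : Fin n → ℂ) (q : MvPolynomial (Fin n) ℂ) :
    Tame S fun s y => A.weightedDeriv v q (contour (s • ξ) y) * ((gauss y)⁻¹ : ℝ) := by
  have hlog : Tame S fun s y => A.logGrad v (contour (s • ξ) y) := by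
    have h1 : Tame S fun s y => pairing v (contour (s • ξ) y) := by
      have := tame_eval ξ hb (linForm v)
      simpa only [eval_linForm] using this
    exact h1.sub ((Tame.const 2).mul (Tame.sum _ fun i _ =>
      (Tame.const _).mul (tame_inv_form (τ := fun _ y => y) hξ ⟨a, ha, has⟩ i)))
  simp only [weightedDeriv, mul_assoc]
  exact ((tame_eval ξ hb _).add ((tame_eval ξ hb q).mul hlog)).mul
    (tame_weight hξ ⟨a, ha, has⟩ ⟨b, hb⟩)

lemma continuous_mul_weight (hξ : toComplex ξ ∈ A.regular) (q : MvPolynomial (Fin n) ℂ) :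
    Continuous fun y => eval (contour ξ y) q * A.weight (contour ξ y) :=
  ((continuous_eval q).comp (continuous_contour ξ)).mul
    (continuous_weight_comp (continuous_contour ξ) (contour_mem_regular hξ))

lemma continuous_weightedDeriv (hξ : toComplex ξ ∈ A.regular) (v : Fin n → ℂ)
    (q : MvPolynomial (Fin n) ℂ) : Continuous fun y => A.weightedDeriv v q (contour ξ y) := by
  have hlog : Continuous fun y => A.logGrad v (contour ξ y) :=
    (continuous_pairing.comp (continuous_const.prodMk (continuous_contour ξ))).sub
      (continuous_const.mul (continuous_finsetSum _ fun i _ => continuous_const.mul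
        (continuous_inv_form_comp (continuous_contour ξ) (contour_mem_regular hξ) i)))
  exact (((continuous_eval _).comp (continuous_contour ξ)).add
    (((continuous_eval q).comp (continuous_contour ξ)).mul hlog)).mul
    (continuous_weight_comp (continuous_contour ξ) (contour_mem_regular hξ))

lemma _root_.BakerAkhiezer.Tame.exists_bound_of_inv {T : Type*} {S : Set T}
    {G : T → (Fin n → ℝ) → ℂ} (h : Tame S fun t y => G t y * ((gauss y)⁻¹ : ℝ)) :
    ∃ g : (Fin n → ℝ) → ℝ, Integrable g ∧ ∀ t ∈ S, ∀ y, ‖G t y‖ ≤ g y := by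
  obtain ⟨g, hg, hb⟩ := h.exists_bound
  refine ⟨g, hg, fun t ht y => ?_⟩
  have h1 := hb t ht y
  have h2 : (gauss y : ℂ) ≠ 0 := by exact_mod_cast (Real.exp_pos _).ne'
  rwa [Complex.ofReal_inv, mul_assoc, inv_mul_cancel₀ h2, mul_one] at h1

lemma integrable_mul_weight (hξ : toComplex ξ ∈ A.regular) (q : MvPolynomial (Fin n) ℂ) :
    Integrable fun y => eval (contour ξ y) q * A.weight (contour ξ y) := by
  have h : Tame ({1} : Set ℝ) fun s y => eval (contour (s • ξ) y) q *
      A.weight (contour (s • ξ) y) * ((gauss y)⁻¹ : ℝ) := by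
    simp only [mul_assoc]
    exact (tame_eval ξ (b := 1) (by simp) q).mul
      (tame_weight hξ ⟨1, one_pos, by simp⟩ ⟨1, by simp⟩)
  obtain ⟨g, hg, hb⟩ := h.exists_bound_of_inv
  refine hg.mono' (continuous_mul_weight hξ q).aestronglyMeasurable (.of_forall fun y => ?_)
  simpa using hb 1 rfl y

lemma integrable_weightedDeriv (hξ : toComplex ξ ∈ A.regular) (v : Fin n → ℂ)
    (q : MvPolynomial (Fin n) ℂ) : Integrable fun y => A.weightedDeriv v q (contour ξ y) := by
  have h := tame_weightedDeriv hξ (S := {1}) one_pos (b := 1) (by simp) (by simp) v q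
  obtain ⟨g, hg, hb⟩ := h.exists_bound_of_inv
  refine hg.mono' (continuous_weightedDeriv hξ v q).aestronglyMeasurable (.of_forall fun y => ?_)
  simpa using hb 1 rfl y

lemma contour_add_smul (ξ y v : Fin n → ℝ) (t : ℝ) :
    contour ξ (y + t • v) = contour ξ y + (t : ℂ) • (Complex.I • toComplex v) := by
  ext j
  simp [contour, toComplex]
  ring

/-- Moving y along v moves the contour point along iv, so the integrand is, up to the factor i, a
derivative in y of an integrable function. Integration by parts against the constant 1 gives zero.
-/
lemma integral_weightedDeriv (hξ : toComplex ξ ∈ A.regular) (v : Fin n → ℝ)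
    (q : MvPolynomial (Fin n) ℂ) : ∫ y, A.weightedDeriv (toComplex v) q (contour ξ y) = 0 := by
  have h := integral_bilinear_hasLineDerivAt_right_eq_neg_left_of_integrable
    (μ := (volume : Measure (Fin n → ℝ))) (f := fun _ => (1 : ℝ)) (f' := fun _ => (0 : ℝ))
    (g := fun y => eval (contour ξ y) q * A.weight (contour ξ y))
    (g' := fun y => A.weightedDeriv (Complex.I • toComplex v) q (contour ξ y))
    (v := v) (B := ContinuousLinearMap.lsmul ℝ ℝ)
    (by simp) (by simpa using integrable_weightedDeriv hξ _ q)
    (by simpa using integrable_mul_weight hξ q)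
    (fun y _ => by
      rw [HasLineDerivAt]
      exact hasDerivAt_const _ _)
    (fun y _ => by
      rw [HasLineDerivAt]
      simp only [contour_add_smul]
      have hreg : contour ξ y + (((0 : ℝ) : ℂ)) • (Complex.I • toComplex v) ∈ A.regular := by
        rw [← contour_add_smul]; exact contour_mem_regular hξ _
      have := (hasDerivAt_mul_weight_line q hreg).comp_ofReal
      simpa using this)
  simp only [ContinuousLinearMap.lsmul_apply, one_smul, zero_smul, integral_zero, neg_zero,
    weightedDeriv_smul] at h
  rw [integral_const_mul] at h
  exact (mul_eq_zero.mp h).resolve_left Complex.I_ne_zero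

/-- The integral of `q` against the weight on the contour `-ξ + i ℝⁿ`. -/
def gaussInt (A : Arrangement n ι) (ξ : Fin n → ℝ) (q : MvPolynomial (Fin n) ℂ) : ℂ :=
  ∫ y, eval (contour ξ y) q * A.weight (contour ξ y)

lemma gaussInt_add (hξ : toComplex ξ ∈ A.regular) (p q : MvPolynomial (Fin n) ℂ) :
    A.gaussInt ξ (p + q) = A.gaussInt ξ p + A.gaussInt ξ q := by
  simp only [gaussInt, map_add, add_mul]
  exact integral_add (integrable_mul_weight hξ p) (integrable_mul_weight hξ q)

lemma gaussInt_smul (ξ : Fin n → ℝ) (c : ℂ) (q : MvPolynomial (Fin n) ℂ) :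
    A.gaussInt ξ (c • q) = c * A.gaussInt ξ q := by
  simp only [gaussInt, smul_eval, mul_assoc]
  exact integral_const_mul _ _

/-- `gaussInt` as a linear functional. -/
def gaussIntLin (A : Arrangement n ι) (hξ : toComplex ξ ∈ A.regular) :
    MvPolynomial (Fin n) ℂ →ₗ[ℂ] ℂ where
  toFun := A.gaussInt ξ
  map_add' := gaussInt_add hξ
  map_smul' := gaussInt_smul ξ

/-- The s-derivative of the integrand on the contour through -sξ is its derivative in the direction
-ξ, whose integral vanishes. Dilating ξ never crosses a hyperplane, and only dilations are needed
later. -/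
lemma hasDerivAt_gaussInt_smul (hξ : toComplex ξ ∈ A.regular) (q : MvPolynomial (Fin n) ℂ)
    {s : ℝ} (hs : 0 < s) : HasDerivAt (fun s : ℝ => A.gaussInt (s • ξ) q) 0 s := by
  have hsub : ∀ (t : ℝ) (y : Fin n → ℝ), contour (t • ξ) y =
      contour 0 y + (t : ℂ) • ((-1 : ℂ) • toComplex ξ) := fun t y => by
    ext j
    simp [contour, toComplex]
    ring
  -- Radius s/2 keeps t between s/2 and 2s, so one dominating function serves the whole ball.
  have hball : ∀ t ∈ Metric.ball s (s / 2), s / 2 ≤ t ∧ |t| ≤ 2 * s := fun t ht => by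
    rw [Metric.mem_ball, Real.dist_eq, abs_lt] at ht
    exact ⟨by linarith, abs_le.mpr ⟨by linarith, by linarith⟩⟩
  have hreg : ∀ t ∈ Metric.ball s (s / 2), toComplex (t • ξ) ∈ A.regular := fun t ht =>
    smul_real_mem_regular hξ (by have := (hball t ht).1; linarith)
  have htame := tame_weightedDeriv hξ (S := Metric.ball s (s / 2)) (half_pos hs)
    (fun t ht => (hball t ht).1) (fun t ht => (hball t ht).2) ((-1 : ℂ) • toComplex ξ) q
  obtain ⟨g, hg, hb⟩ := htame.exists_bound_of_inv
  have hs' : s ∈ Metric.ball s (s / 2) := Metric.mem_ball_self (half_pos hs)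
  have h := hasDerivAt_integral_of_dominated_loc_of_deriv_le (μ := (volume : Measure (Fin n → ℝ)))
    (F := fun (t : ℝ) y => eval (contour (t • ξ) y) q * A.weight (contour (t • ξ) y))
    (F' := fun t y => A.weightedDeriv ((-1 : ℂ) • toComplex ξ) q (contour (t • ξ) y))
    (Metric.ball_mem_nhds s (half_pos hs))
    (Filter.eventually_of_mem (Metric.ball_mem_nhds s (half_pos hs)) fun t ht =>
      (continuous_mul_weight (hreg t ht) q).aestronglyMeasurable)
    (integrable_mul_weight (hreg s hs') q)
    (continuous_weightedDeriv (hreg s hs') _ q).aestronglyMeasurable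
    (.of_forall fun y t ht => hb t ht y) hg
    (.of_forall fun y t ht => by
      have hr := contour_mem_regular (hreg t ht) y
      rw [hsub] at hr
      have := (hasDerivAt_mul_weight_line q hr).comp_ofReal
      simpa only [← hsub] using this)
  refine h.2.congr_deriv ?_
  simp only [weightedDeriv_smul]
  rw [integral_const_mul, integral_weightedDeriv (hreg s hs'), mul_zero]

theorem gaussInt_smul_contour (hξ : toComplex ξ ∈ A.regular) (q : MvPolynomial (Fin n) ℂ)
    {s : ℝ} (hs : 0 < s) : A.gaussInt (s • ξ) q = A.gaussInt ξ q := by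
  have h := (convex_Ioi (0 : ℝ)).is_const_of_fderivWithin_eq_zero (𝕜 := ℝ)
    (f := fun s : ℝ => A.gaussInt (s • ξ) q)
    (fun s hs => (hasDerivAt_gaussInt_smul hξ q hs).differentiableAt.differentiableWithinAt)
    (fun s hs => by
      rw [fderivWithin_of_isOpen isOpen_Ioi hs]
      ext
      simp [(hasDerivAt_gaussInt_smul hξ q hs).deriv])
    (Set.mem_Ioi.mpr hs) (Set.mem_Ioi.mpr one_pos)
  simpa using h

/-- `L f + E f` with `E` the Euler operator. -/
def shiftedL (A : Arrangement n ι) (f : MvPolynomial (Fin n) ℂ) (u : Fin n → ℂ) : ℂ :=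
  A.L (fun y => eval y f) u + ∑ j, u j * eval u (dirDeriv (Pi.single j 1) f)

/-- Green's identity: the gradient of the weight w is w(u - 2∑ m_α α/(α,u)), so div(w∇f) = w(Lf +
Ef). -/
lemma sum_weightedDeriv (f g : MvPolynomial (Fin n) ℂ) (u : Fin n → ℂ) :
    ∑ j, A.weightedDeriv (Pi.single j 1)
      (f * dirDeriv (Pi.single j 1) g - g * dirDeriv (Pi.single j 1) f) u =
    (eval u f * A.shiftedL g u - eval u g * A.shiftedL f u) * A.weight u := by
  have hv : ∀ (v : Fin n → ℂ) (p : MvPolynomial (Fin n) ℂ),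
      eval u (dirDeriv v p) = ∑ j, v j * eval u (dirDeriv (Pi.single j 1) p) := by
    intro v p
    have h1 : ∀ v : Fin n → ℂ, dirDeriv v p = ∑ j, C (v j) * pderiv j p := fun v =>
      dirDeriv_eq_sum v p
    have h2 : ∀ j, dirDeriv (Pi.single j 1) p = pderiv j p := fun j => by
      rw [h1, Finset.sum_eq_single j (fun k _ hk => by simp [hk]) (by simp)]
      simp
    rw [h1, map_sum]
    exact Finset.sum_congr rfl fun j _ => by rw [map_mul, eval_C, h2]
  simp only [weightedDeriv, logGrad, ← Finset.sum_mul]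
  congr 1
  have hκ : ∀ p : MvPolynomial (Fin n) ℂ,
      ∑ i, 2 * (A.mult i : ℂ) / A.form i u * eval u (dirDeriv (A.root i) p) =
        ∑ j, 2 * (∑ i, A.mult i * A.root i j * (A.form i u)⁻¹) *
          eval u (dirDeriv (Pi.single j 1) p) := by
    intro p
    simp only [hv (A.root _), Finset.mul_sum, Finset.sum_mul]
    rw [Finset.sum_comm]
    exact Finset.sum_congr rfl fun j _ => Finset.sum_congr rfl fun i _ => by
      rw [div_eq_mul_inv]; ring
  simp only [shiftedL, L_eval, hκ, map_sub, map_mul, Derivation.leibniz, smul_eq_mul,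
    map_add, pairing_single, pairing_comm (Pi.single _ 1) u]
  simp only [mul_sub, mul_add, Finset.mul_sum, ← Finset.sum_sub_distrib, ← Finset.sum_add_distrib]
  refine Finset.sum_congr rfl fun j _ => ?_
  simp only [← Finset.mul_sum]
  ring

theorem gaussInt_shiftedL_comm (hξ : toComplex ξ ∈ A.regular) {f g f' g' : MvPolynomial (Fin n) ℂ}
    (hf : ∀ u ∈ A.regular, A.shiftedL f u = eval u f')
    (hg : ∀ u ∈ A.regular, A.shiftedL g u = eval u g') :
    A.gaussInt ξ (f * g') = A.gaussInt ξ (g * f') := by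
  have h : ∫ y, ∑ j, A.weightedDeriv (Pi.single j 1)
      (f * dirDeriv (Pi.single j 1) g - g * dirDeriv (Pi.single j 1) f) (contour ξ y) = 0 := by
    rw [integral_finsetSum _ fun j _ => integrable_weightedDeriv hξ _ _]
    refine Finset.sum_eq_zero fun j _ => ?_
    have : (Pi.single j 1 : Fin n → ℂ) = toComplex (Pi.single j 1) := by
      ext k
      by_cases hk : k = j
      · subst hk; simp [toComplex]
      · simp [toComplex, hk]
    rw [this]
    exact integral_weightedDeriv hξ _ _
  simp only [sum_weightedDeriv, sub_mul] at h
  rw [← sub_eq_zero, ← h, gaussInt, gaussInt, ← integral_sub (integrable_mul_weight hξ _)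
    (integrable_mul_weight hξ _)]
  refine integral_congr_ae (.of_forall fun y => ?_)
  have hr := contour_mem_regular hξ y
  simp only [map_mul, hf _ hr, hg _ hr]

end Arrangement

/-! ### Orthogonality relations for the Taylor components -/

lemma dirDeriv_single (j : Fin n) (p : MvPolynomial (Fin n) ℂ) :
    dirDeriv (Pi.single j 1) p = pderiv j p := by
  rw [dirDeriv_eq_sum, Finset.sum_eq_single j (fun k _ hk => by simp [hk]) (by simp)]
  simp

/-- The recurrence reads (N-k)b_k = c b_{k-2}. Below N everything vanishes, and so do the terms N+1,
N+3, …. Above N one gets b_{N+2l} = (-c/2)^l b_N/l!, an exponential series. -/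
lemma eq_zero_and_hasSum_of_recurrence {b : ℕ → ℂ} {N : ℕ} {c : ℂ}
    (h : ∀ k, (N : ℂ) * b k = k * b k + if 2 ≤ k then c * b (k - 2) else 0) :
    (∀ k < N, b k = 0) ∧ HasSum b (Complex.exp (-c / 2) * b N) := by
  have hz : ∀ k, k ≠ N → (2 ≤ k → b (k - 2) = 0) → b k = 0 := by
    intro k hk h2
    have h1 := h k
    have h3 : (if 2 ≤ k then c * b (k - 2) else 0) = 0 := by
      split_ifs with h4
      · rw [h2 h4, mul_zero]
      · rfl
    rw [h3, add_zero, ← sub_eq_zero, ← sub_mul] at h1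
    exact (mul_eq_zero.mp h1).resolve_left (sub_ne_zero.mpr (by exact_mod_cast hk.symm))
  have hlt : ∀ k < N, b k = 0 := by
    intro k
    induction k using Nat.strong_induction_on with
    | _ k ih =>
      intro hk
      exact hz k hk.ne fun h2 => ih (k - 2) (by omega) (by omega)
  refine ⟨hlt, ?_⟩
  have hodd : ∀ l, b (N + 2 * l + 1) = 0 := by
    intro l
    induction l with
    | zero => exact hz _ (by omega) fun h2 => hlt _ (by omega)
    | succ l ih =>
      refine hz _ (by omega) fun h2 => ?_
      rwa [show N + 2 * (l + 1) + 1 - 2 = N + 2 * l + 1 by omega]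
  have heven : ∀ l, b (N + 2 * l) = (-c / 2) ^ l / l.factorial * b N := by
    intro l
    induction l with
    | zero => simp
    | succ l ih =>
      have h1 := h (N + 2 * (l + 1))
      rw [if_pos (by omega), show N + 2 * (l + 1) - 2 = N + 2 * l by omega, ih] at h1
      rw [pow_succ, Nat.factorial_succ]
      push_cast at h1 ⊢
      have h2 : (l : ℂ) + 1 ≠ 0 := by exact_mod_cast l.succ_ne_zero
      have h3 : (l.factorial : ℂ) ≠ 0 := by exact_mod_cast l.factorial_ne_zero
      have h4 : 2 * ((l : ℂ) + 1) * b (N + 2 * (l + 1)) =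
          -c * ((-c / 2) ^ l / l.factorial * b N) := by linear_combination -h1
      field_simp at h4 ⊢
      linear_combination h4
  have hinj : Function.Injective fun l : ℕ => N + 2 * l := fun a b hab => by
    simp only at hab; omega
  rw [← hinj.hasSum_iff]
  · have h1 := (NormedSpace.expSeries_div_hasSum_exp (-c / 2)).mul_right (b N)
    rw [← Complex.exp_eq_exp_ℂ] at h1
    simpa only [Function.comp_def, heven] using h1
  · intro k hk
    rcases lt_or_ge k N with h1 | h1
    · exact hlt k h1
    · obtain ⟨d, rfl⟩ := Nat.exists_eq_add_of_le h1
      rcases Nat.even_or_odd' d with ⟨l, rfl | rfl⟩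
      · exact absurd ⟨l, rfl⟩ hk
      · exact hodd l

/-- The degree `N` Taylor component of the Baker-Akhiezer function multiplied by `exp (μ² / 2)`,
where `μ²` counts with weight `2`. -/
def taylorExp (mu : Fin n → ℂ) (W : MvPolynomial (Fin n ⊕ Fin n) ℂ) (N : ℕ) :
    MvPolynomial (Fin n) ℂ :=
  ∑ k ∈ Finset.range (N / 2 + 1), ((pairing mu mu / 2) ^ k / k.factorial) • taylor mu W (N - 2 * k)

namespace Arrangement

variable [Fintype ι] {A : Arrangement n ι} {ξ : Fin n → ℝ} {W : MvPolynomial (Fin n ⊕ Fin n) ℂ}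

lemma shiftedL_eq (A : Arrangement n ι) (f : MvPolynomial (Fin n) ℂ) (u : Fin n → ℂ) :
    A.shiftedL f u = ∑ j, eval u (pderiv j (pderiv j f)) -
        ∑ i, 2 * (A.mult i : ℂ) / A.form i u * eval u (dirDeriv (A.root i) f) +
      ∑ j, u j * eval u (pderiv j f) := by
  simp only [shiftedL, L_eval, dirDeriv_single]

lemma shiftedL_sum_smul {κ : Type*} (s : Finset κ) (c : κ → ℂ) (f : κ → MvPolynomial (Fin n) ℂ)
    (u : Fin n → ℂ) :
    A.shiftedL (∑ k ∈ s, c k • f k) u = ∑ k ∈ s, c k * A.shiftedL (f k) u := by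
  simp only [shiftedL_eq, map_sum, Derivation.map_smul, smul_eval, mul_add, mul_sub,
    Finset.mul_sum, Finset.sum_add_distrib, Finset.sum_sub_distrib]
  rw [Finset.sum_comm (s := s), Finset.sum_comm (s := s), Finset.sum_comm (s := s)]
  simp only [mul_left_comm]

lemma IsBANum.shiftedL_taylor (hW : A.IsBANum W) (h0 : eval 0 W ≠ 0) (lam : Fin n → ℂ) (N : ℕ)
    {u : Fin n → ℂ} (hu : u ∈ A.regular) :
    A.shiftedL (taylor lam W N) u = N * eval u (taylor lam W N) +
      if 2 ≤ N then pairing lam lam * eval u (taylor lam W (N - 2)) else 0 := by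
  rw [shiftedL, hW.L_taylor h0 lam N hu, add_comm]
  congr 1
  have h := congrArg (eval u) (hW.taylor_isHomogeneous lam N).sum_X_mul_pderiv
  simpa [dirDeriv_single] using h

/-- With c_k = (μ²/2)^k/k!, the operator E gives the k-th term the eigenvalue N-2k. The operator L
shifts it to the next term, and c_kμ² = 2(k+1)c_{k+1} restores the missing 2k. -/
lemma IsBANum.shiftedL_taylorExp (hW : A.IsBANum W) (h0 : eval 0 W ≠ 0) (mu : Fin n → ℂ) (N : ℕ)
    {u : Fin n → ℂ} (hu : u ∈ A.regular) :
    A.shiftedL (taylorExp mu W N) u = eval u ((N : ℂ) • taylorExp mu W N) := by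
  set c : ℕ → ℂ := fun k => (pairing mu mu / 2) ^ k / k.factorial with hc
  set e : ℕ → ℂ := fun k => eval u (taylor mu W (N - 2 * k)) with he
  have hcs : ∀ k : ℕ, c k * pairing mu mu = 2 * (k + 1 : ℕ) * c (k + 1) := fun k => by
    simp only [hc, pow_succ, Nat.factorial_succ]
    have h3 : (k.factorial : ℂ) ≠ 0 := by exact_mod_cast k.factorial_ne_zero
    have h2 : (k : ℂ) + 1 ≠ 0 := by exact_mod_cast k.succ_ne_zero
    push_cast
    field_simp
  have h1 : ∀ k ∈ Finset.range (N / 2 + 1), c k * A.shiftedL (taylor mu W (N - 2 * k)) u =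
      (N - 2 * k : ℂ) * (c k * e k) +
        if k < N / 2 then 2 * (k + 1 : ℕ) * c (k + 1) * e (k + 1) else 0 := by
    intro k hk
    have hk' := Finset.mem_range.mp hk
    rw [hW.shiftedL_taylor h0 mu _ hu, Nat.cast_sub (by omega), mul_add]
    congr 1
    · push_cast
      ring
    · by_cases h2 : k < N / 2
      · rw [if_pos (by omega), if_pos h2, ← hcs, mul_assoc,
          show N - 2 * k - 2 = N - 2 * (k + 1) by omega]
      · rw [if_neg (by omega), if_neg h2, mul_zero]
  have h2 : ∑ k ∈ Finset.range (N / 2 + 1),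
      (if k < N / 2 then 2 * ((k + 1 : ℕ) : ℂ) * c (k + 1) * e (k + 1) else 0) =
      ∑ k ∈ Finset.range (N / 2 + 1), 2 * (k : ℂ) * c k * e k := by
    rw [Finset.sum_range_succ, if_neg (lt_irrefl _), add_zero, Finset.sum_range_succ' _ (N / 2)]
    simp only [Nat.cast_zero, mul_zero, zero_mul, add_zero]
    exact Finset.sum_congr rfl fun k hk => if_pos (Finset.mem_range.mp hk)
  rw [taylorExp, shiftedL_sum_smul, Finset.sum_congr rfl h1, Finset.sum_add_distrib, h2,
    ← Finset.sum_add_distrib, smul_eval, map_sum, Finset.mul_sum]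
  refine Finset.sum_congr rfl fun k _ => ?_
  rw [smul_eval]
  ring

/-- Symmetry of L + E: its eigenvalue N on `h` is compared with its action on the k-th Taylor
component. -/
lemma IsBANum.gaussInt_recurrence (hW : A.IsBANum W) (h0 : eval 0 W ≠ 0)
    (hξ : toComplex ξ ∈ A.regular) (lam : Fin n → ℂ) {h : MvPolynomial (Fin n) ℂ} {N : ℕ}
    (hh : ∀ u ∈ A.regular, A.shiftedL h u = eval u ((N : ℂ) • h)) (k : ℕ) :
    (N : ℂ) * A.gaussInt ξ (h * taylor lam W k) = k * A.gaussInt ξ (h * taylor lam W k) +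
      if 2 ≤ k then pairing lam lam * A.gaussInt ξ (h * taylor lam W (k - 2)) else 0 := by
  have h1 := gaussInt_shiftedL_comm hξ (f := taylor lam W k) (g := h)
    (f' := (k : ℂ) • taylor lam W k +
      if 2 ≤ k then pairing lam lam • taylor lam W (k - 2) else 0) (fun u hu => by
        rw [hW.shiftedL_taylor h0 lam k hu, map_add, smul_eval]
        congr 1
        split_ifs
        · rw [smul_eval]
        · rw [map_zero]) hh
  rw [mul_smul_comm, gaussInt_smul, mul_comm (taylor lam W k), mul_add, gaussInt_add hξ,
    mul_smul_comm, gaussInt_smul] at h1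
  rw [h1]
  congr 1
  split_ifs
  · rw [mul_smul_comm, gaussInt_smul]
  · simp [gaussInt]

lemma l1_contour_le (ξ y : Fin n → ℝ) : ∑ j, ‖contour ξ y j‖ ≤ l1 y + l1 ξ := by
  rw [l1, l1, ← Finset.sum_add_distrib]
  refine Finset.sum_le_sum fun j _ => ?_
  rw [contour_apply]
  refine (norm_sub_le _ _).trans ?_
  simp

/-- The integral of the product with a Baker-Akhiezer function. -/
lemma IsBANum.integral_polyExp (hW : A.IsBANum W) (h0 : eval 0 W ≠ 0)
    (hξ : toComplex ξ ∈ A.regular) (lam : Fin n → ℂ) {h : MvPolynomial (Fin n) ℂ} {N : ℕ}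
    (hh : ∀ u ∈ A.regular, A.shiftedL h u = eval u ((N : ℂ) • h)) :
    ∫ y, eval (contour ξ y) h * (eval (Sum.elim lam (contour ξ y)) W *
      Complex.exp (pairing lam (contour ξ y))) * A.weight (contour ξ y) =
    Complex.exp (-pairing lam lam / 2) * A.gaussInt ξ (h * taylor lam W N) := by
  have hsum := (eq_zero_and_hasSum_of_recurrence (hW.gaussInt_recurrence h0 hξ lam hh)).2
  obtain ⟨K, c, hK, hc, hbd⟩ := exists_sum_norm_taylor_le lam W
  have htame : Tame ({1} : Set ℝ) fun s y => eval (contour (s • ξ) y) h *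
      ((K * Real.exp (c * (l1 y + l1 ξ)) : ℝ) : ℂ) * A.weight (contour (s • ξ) y) *
        ((gauss y)⁻¹ : ℝ) := by
    have h1 : Tame ({1} : Set ℝ) fun _ (y : Fin n → ℝ) =>
        ((K * Real.exp (c * (l1 y + l1 ξ)) : ℝ) : ℂ) :=
      ⟨K * Real.exp (c * l1 ξ), c, by positivity, hc, fun _ _ y => by
        rw [Complex.norm_real, Real.norm_eq_abs, abs_of_nonneg (by positivity), mul_add,
          Real.exp_add]
        exact le_of_eq (by ring)⟩
    have h2 := ((tame_eval ξ (S := {1}) (b := 1) (by simp) h).mul h1).mul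
      (tame_weight (σ := fun s => s) hξ ⟨1, one_pos, by simp⟩ ⟨1, by simp⟩)
    simpa only [mul_assoc] using h2
  obtain ⟨g, hg, hb⟩ := htame.exists_bound_of_inv
  -- Integrates the Taylor series of φ(λ,·) termwise; the limit is then identified by the sum in
  -- `hsum`.
  have hlim := tendsto_integral_of_dominated_convergence
    (F := fun K y => eval (contour ξ y) h * (∑ k ∈ Finset.range K,
      eval (contour ξ y) (taylor lam W k)) * A.weight (contour ξ y))
    (f := fun y => eval (contour ξ y) h * (eval (Sum.elim lam (contour ξ y)) W *
      Complex.exp (pairing lam (contour ξ y))) * A.weight (contour ξ y)) (μ := volume) g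
    (fun K => by
      have := continuous_mul_weight hξ (h * ∑ k ∈ Finset.range K, taylor lam W k)
      simp only [map_mul, map_sum] at this
      exact this.aestronglyMeasurable) hg
    (fun M => .of_forall fun y => by
      refine le_trans ?_ (hb 1 rfl y)
      simp only [one_smul, norm_mul]
      refine mul_le_mul_of_nonneg_right (mul_le_mul_of_nonneg_left ?_ (norm_nonneg _))
        (norm_nonneg _)
      rw [Complex.norm_real, Real.norm_eq_abs,
        abs_of_nonneg (by positivity)]
      refine (norm_sum_le _ _).trans ((hbd (contour ξ y) M).trans ?_)
      have := l1_contour_le ξ y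
      gcongr)
    (.of_forall fun y =>
      ((hasSum_taylor lam (contour ξ y) W).tendsto_sum_nat.const_mul _).mul_const _)
  refine tendsto_nhds_unique hlim (hsum.tendsto_sum_nat.congr fun M => ?_)
  rw [show ∑ k ∈ Finset.range M, A.gaussInt ξ (h * taylor lam W k) =
    A.gaussIntLin hξ (∑ k ∈ Finset.range M, h * taylor lam W k) by rw [map_sum]; rfl]
  change A.gaussInt ξ _ = _
  simp only [gaussInt, map_sum, map_mul, Finset.mul_sum]

end Arrangement

/-! ### Asymptotics on moving contours -/

namespace Arrangement

variable [Fintype ι] {A : Arrangement n ι} {ξ : Fin n → ℝ}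
  {S : Finset (Fin n →₀ ℕ)} {c : (Fin n →₀ ℕ) → MvPolynomial (Fin n) ℂ}

/-- The rescaled integrand on the contour through `-ε⁻¹ ξ`, without the Gaussian factor. -/
def rescaled (A : Arrangement n ι) (S : Finset (Fin n →₀ ℕ))
    (c : (Fin n →₀ ℕ) → MvPolynomial (Fin n) ℂ) (mu lam : Fin n → ℂ) (N : ℕ) (ε : ℂ)
    (z : Fin n → ℂ) : ℂ :=
  (∑ k ∈ Finset.range (N / 2 + 1), (pairing mu mu / 2) ^ k / k.factorial * ε ^ (2 * k) *
      eval z (taylor mu (A.biNum S c) (N - 2 * k))) *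
    (A.discr lam * A.discr z + ∑ a ∈ S, ε ^ (2 * (A.totalMult - a.degree)) *
      eval lam (monomial a 1) * eval z (c a)) * ((A.discr z)⁻¹) ^ 2

lemma eval_taylorExp_smul (hW : A.IsBANum (A.biNum S c)) (mu z : Fin n → ℂ) (N : ℕ) {s : ℂ}
    (hs : s ≠ 0) : eval (s • z) (taylorExp mu (A.biNum S c) N) =
      s ^ N * ∑ k ∈ Finset.range (N / 2 + 1), (pairing mu mu / 2) ^ k / k.factorial *
        s⁻¹ ^ (2 * k) * eval z (taylor mu (A.biNum S c) (N - 2 * k)) := by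
  rw [taylorExp, map_sum, Finset.mul_sum]
  refine Finset.sum_congr rfl fun k hk => ?_
  have hk' : 2 * k ≤ N := by have := Finset.mem_range.mp hk; omega
  rw [smul_eval, eval_smul_of_isHomogeneous (hW.taylor_isHomogeneous mu _), inv_pow]
  have : s ^ N = s ^ (N - 2 * k) * s ^ (2 * k) := by rw [← pow_add, Nat.sub_add_cancel hk']
  rw [this]
  have := pow_ne_zero (2 * k) hs
  field_simp

lemma eval_biNum_smul (hS : ∀ a ∈ S, a.degree < A.totalMult) (hW : A.IsBANum (A.biNum S c))
    (lam z : Fin n → ℂ) {s : ℂ} (hs : s ≠ 0) :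
    eval (Sum.elim (s • lam) (s • z)) (A.biNum S c) =
      s ^ (2 * A.totalMult) * (A.discr lam * A.discr z + ∑ a ∈ S,
        s⁻¹ ^ (2 * (A.totalMult - a.degree)) * eval lam (monomial a 1) * eval z (c a)) := by
  rw [← hW.eval_smul, eval_biNum, discr_smul, discr_smul, mul_add, Finset.mul_sum]
  congr 1
  · rw [two_mul, pow_add]
    ring
  · refine Finset.sum_congr rfl fun a ha => ?_
    rw [smul_smul, ← sq, eval_smul_of_isHomogeneous (isHomogeneous_monomial (1 : ℂ) rfl), inv_pow,
      ← pow_mul]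
    have h1 : s ^ (2 * A.totalMult) =
        s ^ (2 * a.degree) * s ^ (2 * (A.totalMult - a.degree)) := by
      rw [← pow_add]
      congr 1
      have := hS a ha
      omega
    rw [h1]
    have := pow_ne_zero (2 * (A.totalMult - a.degree)) hs
    field_simp

/-- With s = 1/ε, the contour is moved to the one through -sξ, λ is replaced by sλ at the cost of
s^N, and y is translated by -sη, so that u = sz with z near -λ. The powers of s from `taylorExp` and
P cancel those from φ_N(sλ,·) and A_m(sz)². -/
lemma gaussInt_eq_integral_rescaled (hS : ∀ a ∈ S, a.degree < A.totalMult)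
    (hW : A.IsBANum (A.biNum S c)) (h0 : eval 0 (A.biNum S c) ≠ 0) (hξ : toComplex ξ ∈ A.regular)
    (mu : Fin n → ℂ) (η : Fin n → ℝ) (N : ℕ) {ε : ℝ} (hε : 0 < ε) :
    A.gaussInt ξ (taylorExp mu (A.biNum S c) N *
      taylor (toComplex ξ + Complex.I • toComplex η) (A.biNum S c) N) =
    ∫ v : Fin n → ℝ, A.rescaled S c mu (toComplex ξ + Complex.I • toComplex η) N ε
      (contour ξ (ε • v - η)) * gauss v := by
  set lam := toComplex ξ + Complex.I • toComplex η with hlam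
  set s : ℂ := ((ε⁻¹ : ℝ) : ℂ) with hsdef
  have hε' : (ε : ℂ) ≠ 0 := by exact_mod_cast hε.ne'
  have hs : s ≠ 0 := by rw [hsdef]; exact_mod_cast (inv_pos.mpr hε).ne'
  have hsε : s⁻¹ = ε := by rw [hsdef, Complex.ofReal_inv, inv_inv]
  have hξ' : toComplex (ε⁻¹ • ξ) ∈ A.regular := smul_real_mem_regular hξ (inv_pos.mpr hε).ne'
  have hT : taylor lam (A.biNum S c) N = (s ^ N)⁻¹ • taylor (s • lam) (A.biNum S c) N := by
    rw [taylor_smul, smul_smul, inv_mul_cancel₀ (pow_ne_zero N hs), one_smul]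
  have hint := hW.integral_polyExp h0 hξ' (s • lam)
    (fun u hu => hW.shiftedL_taylorExp h0 mu N hu)
  have hcont : ∀ v : Fin n → ℝ,
      contour (ε⁻¹ • ξ) (v - ε⁻¹ • η) = s • contour ξ (ε • v - η) := fun v => by
    ext j
    simp only [contour_apply, Pi.sub_apply, Pi.smul_apply, smul_eq_mul, hsdef]
    push_cast
    field_simp
  rw [← gaussInt_smul_contour hξ _ (inv_pos.mpr hε), hT, mul_smul_comm, gaussInt_smul,
    ← mul_right_inj' (Complex.exp_ne_zero (-pairing (s • lam) (s • lam) / 2)), mul_left_comm,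
    ← hint, ← integral_sub_right_eq_self _ (ε⁻¹ • η), ← integral_const_mul, ← integral_const_mul]
  refine integral_congr_ae (.of_forall fun v => ?_)
  simp only [hcont]
  set z := contour ξ (ε • v - η) with hz
  rw [eval_taylorExp_smul hW mu z N hs, eval_biNum_smul hS hW lam z hs, weight, discr_smul, hsε]
  -- Completing the square: s(λ+z) = iv, hence (sλ,sz) + (sz)²/2 = -(sλ)²/2 - v²/2.
  have hexp : Complex.exp (pairing (s • lam) (s • z)) *
      Complex.exp (pairing (s • z) (s • z) / 2) =
      Complex.exp (-pairing (s • lam) (s • lam) / 2) * gauss v := by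
    have hsum : s • z = Complex.I • toComplex v - s • lam := by
      rw [hz, ← hcont]
      ext j
      simp only [contour_apply, Pi.sub_apply, Pi.smul_apply, smul_eq_mul, hsdef, hlam,
        Pi.add_apply, toComplex]
      push_cast
      ring
    rw [gauss, Complex.ofReal_exp, ← Complex.exp_add, ← Complex.exp_add]
    congr 1
    have hv : pairing (Complex.I • toComplex v) (Complex.I • toComplex v) =
        -((∑ j, v j ^ 2 : ℝ) : ℂ) := by
      rw [pairing_smul_left, pairing_smul_right, pairing_toComplex, ← mul_assoc, Complex.I_mul_I]
      simp only [sq]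
      ring
    rw [hsum]
    generalize s • lam = l
    have h1 : ∀ a b : Fin n → ℂ, pairing (a - b) (a - b) =
        pairing a a - 2 * pairing b a + pairing b b := fun a b => by
      simp only [sub_eq_add_neg, pairing_add_left, pairing_add_right, pairing_neg_left,
        pairing_neg_right, pairing_comm a b]
      ring
    have h2 : pairing l (Complex.I • toComplex v - l) =
        pairing l (Complex.I • toComplex v) - pairing l l := by
      simp only [sub_eq_add_neg, pairing_add_right, pairing_neg_right]
    rw [h1, h2, hv]
    push_cast
    ring
  have hsM : s ^ (2 * A.totalMult) ≠ 0 := pow_ne_zero _ hs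
  have hsN : s ^ N ≠ 0 := pow_ne_zero _ hs
  rw [rescaled]
  set H := ∑ k ∈ Finset.range (N / 2 + 1), (pairing mu mu / 2) ^ k / k.factorial *
    (ε : ℂ) ^ (2 * k) * eval z (taylor mu (A.biNum S c) (N - 2 * k))
  set B := A.discr lam * A.discr z + ∑ a ∈ S, (ε : ℂ) ^ (2 * (A.totalMult - a.degree)) *
    eval lam (monomial a 1) * eval z (c a)
  have hpow : (s ^ A.totalMult * A.discr z) ^ 2 = s ^ (2 * A.totalMult) * A.discr z ^ 2 := by ring
  rw [hpow]
  calc _ = (s ^ N)⁻¹ * s ^ N * (s ^ (2 * A.totalMult) * (s ^ (2 * A.totalMult))⁻¹) *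
        (H * B * ((A.discr z)⁻¹) ^ 2) * (Complex.exp (pairing (s • lam) (s • z)) *
          Complex.exp (pairing (s • z) (s • z) / 2)) := by
        rw [div_eq_mul_inv, mul_inv, inv_pow]; ring
    _ = _ := by
        rw [inv_mul_cancel₀ hsN, mul_inv_cancel₀ hsM, hexp]; ring

/-- Only nonnegative powers of ε occur and every contour passes through -ξ, so one bound covers all
ε in [0,1], including the limit value. -/
lemma tame_rescaled (hξ : toComplex ξ ∈ A.regular) (mu lam : Fin n → ℂ) (η : Fin n → ℝ) (N : ℕ) :
    Tame (Set.Icc (0 : ℝ) 1) fun ε v => A.rescaled S c mu lam N ε (contour ξ (ε • v - η)) := by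
  have hb : ∀ ε ∈ Set.Icc (0 : ℝ) 1, |ε| ≤ 1 := fun ε hε =>
    abs_le.mpr ⟨by linarith [hε.1], hε.2⟩
  have hε : Tame (Set.Icc (0 : ℝ) 1) fun ε (_ : Fin n → ℝ) => (ε : ℂ) :=
    Tame.of_bounded 1 fun ε hε _ => by simpa using hb ε hε
  have hτ : ∀ j, Tame (Set.Icc (0 : ℝ) 1) fun ε (v : Fin n → ℝ) =>
      (((ε • v - η) j : ℝ) : ℂ) := fun j => by
    have := (hε.mul (tame_apply j)).sub (Tame.const (η j : ℂ))
    simpa using this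
  have hz : ∀ p : MvPolynomial (Fin n) ℂ, Tame (Set.Icc (0 : ℝ) 1) fun ε (v : Fin n → ℝ) =>
      eval (contour ξ (ε • v - η)) p := fun p => by
    have := Tame.eval_poly (tame_contour_apply (σ := fun _ => 1) ξ ⟨1, by simp⟩ hτ) p
    simpa only [one_smul] using this
  have hinv : Tame (Set.Icc (0 : ℝ) 1) fun ε (v : Fin n → ℝ) =>
      (A.discr (contour ξ (ε • v - η)))⁻¹ := by
    have := tame_inv_discr (S := Set.Icc (0 : ℝ) 1) (σ := fun _ => 1)
      (τ := fun ε v => ε • v - η) hξ ⟨1, one_pos, by simp⟩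
    simpa only [one_smul] using this
  have hd := hz A.discrPoly
  simp only [eval_discrPoly] at hd
  exact ((Tame.sum _ fun k _ => ((Tame.const _).mul (hε.pow _)).mul (hz _)).mul
    (((Tame.const _).mul hd).add (Tame.sum _ fun a _ =>
      ((hε.pow _).mul (Tame.const _)).mul (hz _)))).mul (hinv.pow 2)

lemma continuous_rescaled (hξ : toComplex ξ ∈ A.regular) (mu lam : Fin n → ℂ) (η : Fin n → ℝ)
    (N : ℕ) : Continuous fun q : ℝ × (Fin n → ℝ) =>
      A.rescaled S c mu lam N q.1 (contour ξ (q.1 • q.2 - η)) := by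
  have hz : Continuous fun q : ℝ × (Fin n → ℝ) => contour ξ (q.1 • q.2 - η) := by fun_prop
  have hp : ∀ p : MvPolynomial (Fin n) ℂ, Continuous fun q : ℝ × (Fin n → ℝ) =>
      eval (contour ξ (q.1 • q.2 - η)) p := fun p => (continuous_eval p).comp hz
  have hd := hp A.discrPoly
  simp only [eval_discrPoly] at hd
  have hinv := hd.inv₀ fun q => A.discr_ne_zero (contour_mem_regular hξ _)
  unfold rescaled
  have hε : Continuous fun q : ℝ × (Fin n → ℝ) => (q.1 : ℂ) := by fun_prop
  exact ((continuous_finsetSum _ fun k _ => (continuous_const.mul (hε.pow _)).mul (hp _)).mul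
    ((continuous_const.mul hd).add (continuous_finsetSum _ fun a _ =>
      ((hε.pow _).mul continuous_const).mul (hp _)))).mul (hinv.pow 2)

/-- At ε = 0 only the leading terms survive: A_m(λ)A_m(-λ)/A_m(-λ)² contributes (-1)^{|m|}, and
homogeneity of φ_N(μ,·) contributes (-1)^N. -/
lemma rescaled_zero (hS : ∀ a ∈ S, a.degree < A.totalMult) (hW : A.IsBANum (A.biNum S c))
    (mu : Fin n → ℂ) {lam : Fin n → ℂ} (hlam : lam ∈ A.regular) (N : ℕ) :
    A.rescaled S c mu lam N 0 (-lam) =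
      (-1) ^ (N + A.totalMult) * eval lam (taylor mu (A.biNum S c) N) := by
  have h1 : -lam = (-1 : ℂ) • lam := by simp
  have hd := A.discr_ne_zero hlam
  have h2 : ∑ a ∈ S, (0 : ℂ) ^ (2 * (A.totalMult - a.degree)) * eval lam (monomial a 1) *
      eval (-lam) (c a) = 0 := Finset.sum_eq_zero fun a ha => by
    rw [zero_pow (by have := hS a ha; omega), zero_mul, zero_mul]
  have h3 : ∑ k ∈ Finset.range (N / 2 + 1), (pairing mu mu / 2) ^ k / k.factorial *
      (0 : ℂ) ^ (2 * k) * eval (-lam) (taylor mu (A.biNum S c) (N - 2 * k)) =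
      eval (-lam) (taylor mu (A.biNum S c) N) := by
    rw [Finset.sum_eq_single 0 (fun k _ hk => by rw [zero_pow (by omega)]; ring)
      (fun h => absurd (Finset.mem_range.mpr (Nat.succ_pos _)) h)]
    simp
  have h4 : ((-1 : ℂ) ^ A.totalMult)⁻¹ = (-1) ^ A.totalMult := by
    rw [← inv_pow, inv_neg, inv_one]
  rw [rescaled, h2, h3, add_zero, h1, discr_smul,
    eval_smul_of_isHomogeneous (hW.taylor_isHomogeneous mu N), pow_add, mul_inv, h4]
  have h5 : ((-1 : ℂ) ^ A.totalMult) ^ 2 = 1 := by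
    rw [← pow_mul, mul_comm, pow_mul]; simp
  have h6 : A.discr lam * (A.discr lam)⁻¹ = 1 := mul_inv_cancel₀ hd
  linear_combination (-1) ^ N * eval lam (taylor mu (A.biNum S c) N) * (-1) ^ A.totalMult *
    ((A.discr lam * (A.discr lam)⁻¹) ^ 2 * h5 + (A.discr lam * (A.discr lam)⁻¹ + 1) * h6)

/-- The value of the pairing for a spectral parameter with real part `ξ`. -/
lemma gaussInt_taylorExp_mul_taylor_aux (hS : ∀ a ∈ S, a.degree < A.totalMult)
    (hW : A.IsBANum (A.biNum S c)) (h0 : eval 0 (A.biNum S c) ≠ 0) (hξ : toComplex ξ ∈ A.regular)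
    (mu : Fin n → ℂ) (η : Fin n → ℝ) (N : ℕ) :
    A.gaussInt ξ (taylorExp mu (A.biNum S c) N *
      taylor (toComplex ξ + Complex.I • toComplex η) (A.biNum S c) N) =
    (-1) ^ (N + A.totalMult) * ((2 * Real.pi) ^ ((n : ℝ) / 2) : ℝ) *
      eval (toComplex ξ + Complex.I • toComplex η) (taylor mu (A.biNum S c) N) := by
  set lam := toComplex ξ + Complex.I • toComplex η with hlam
  obtain ⟨g, hg, hb⟩ := (tame_rescaled (S := S) (c := c) hξ mu lam η N).exists_bound
  have hcont := continuous_rescaled (S := S) (c := c) hξ mu lam η N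
  have hlim := tendsto_integral_of_dominated_convergence (μ := volume)
    (F := fun (m : ℕ) (v : Fin n → ℝ) => A.rescaled S c mu lam N ((1 / ((m : ℝ) + 1) : ℝ) : ℂ)
      (contour ξ ((1 / ((m : ℝ) + 1)) • v - η)) * gauss v)
    (f := fun v => A.rescaled S c mu lam N ((0 : ℝ) : ℂ) (contour ξ ((0 : ℝ) • v - η)) * gauss v)
    g (fun m => by
      have h1 := hcont.comp (Continuous.prodMk_right (1 / ((m : ℝ) + 1)) :
        Continuous fun v : Fin n → ℝ => ((1 / ((m : ℝ) + 1) : ℝ), v))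
      exact (h1.mul (by fun_prop)).aestronglyMeasurable) hg
    (fun m => .of_forall fun v => hb _ ⟨by positivity, by
      rw [div_le_one (by positivity)]; linarith [(Nat.cast_nonneg m : (0 : ℝ) ≤ m)]⟩ v)
    (.of_forall fun v => by
      have h1 := hcont.comp (Continuous.prodMk_left v : Continuous fun ε : ℝ => (ε, v))
      exact ((h1.tendsto 0).comp tendsto_one_div_add_atTop_nhds_zero_nat).mul_const _)
  -- The rescaled integral does not depend on ε, so its limit as ε → 0 is its exact value.
  have hconst : ∀ m : ℕ, ∫ v : Fin n → ℝ, A.rescaled S c mu lam N ((1 / ((m : ℝ) + 1) : ℝ) : ℂ)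
      (contour ξ ((1 / ((m : ℝ) + 1)) • v - η)) * gauss v =
      A.gaussInt ξ (taylorExp mu (A.biNum S c) N * taylor lam (A.biNum S c) N) := fun m =>
    (gaussInt_eq_integral_rescaled hS hW h0 hξ mu η N (by positivity)).symm
  simp only [hconst] at hlim
  rw [tendsto_nhds_unique tendsto_const_nhds hlim]
  have hz : contour ξ (-η) = -lam := by
    ext j
    simp [contour_apply, hlam, toComplex]
    ring
  have hreg : lam ∈ A.regular := fun i => by
    have := contour_mem_regular hξ (-η) i
    rwa [hz, form_eq_pairing, pairing_neg_right, neg_ne_zero] at this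
  simp only [zero_smul, zero_sub, hz, Complex.ofReal_zero, rescaled_zero hS hW mu hreg N]
  rw [integral_const_mul, integral_complex_ofReal, integral_gauss]
  ring

/-! ### Symmetry -/

/-- Joint polynomiality in λ and u, needed to extend identities from special λ to all λ. -/
lemma _root_.BakerAkhiezer.exists_specL_eq_taylor (W : MvPolynomial (Fin n ⊕ Fin n) ℂ) :
    ∀ N, ∃ T : MvPolynomial (Fin n ⊕ Fin n) ℂ, ∀ lam, taylor lam W N = specL lam T := by
  induction W using MvPolynomial.induction_on with
  | C a =>
    intro N
    refine ⟨C (a * (N.factorial : ℂ)⁻¹) * (∑ j, X (Sum.inl j) * X (Sum.inr j)) ^ N, fun lam => ?_⟩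
    refine MvPolynomial.funext fun u => ?_
    rw [taylor_C, eval_specL]
    simp [eval_linForm, pairing]
  | add p q hp hq =>
    intro N
    obtain ⟨T, hT⟩ := hp N
    obtain ⟨T', hT'⟩ := hq N
    exact ⟨T + T', fun lam => by rw [taylor_add, hT, hT', map_add]⟩
  | mul_X p j hp =>
    intro N
    rcases j with j | j
    · rcases N with _ | N
      · exact ⟨0, fun lam => by rw [taylor_mul_X_inl_zero, map_zero]⟩
      · obtain ⟨T, hT⟩ := hp N
        refine ⟨inL (X j) * T, fun lam => ?_⟩
        rw [taylor_mul_X_inl_succ, hT, map_mul, specL_inL, eval_X, smul_eq_C_mul]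
    · obtain ⟨T, hT⟩ := hp N
      refine ⟨inR (X j) * T, fun lam => ?_⟩
      rw [taylor_mul_X_inr, hT, map_mul, specL_inR]

lemma _root_.BakerAkhiezer.exists_eval_eq_dual_specL (W : MvPolynomial (Fin n ⊕ Fin n) ℂ)
    (g : MvPolynomial (Fin n) ℂ →ₗ[ℂ] ℂ) :
    ∃ q : MvPolynomial (Fin n) ℂ, ∀ x, g (specL x W) = eval x q := by
  induction W using biPoly_induction with
  | add W W' h h' =>
    obtain ⟨q, hq⟩ := h
    obtain ⟨q', hq'⟩ := h'
    exact ⟨q + q', fun x => by rw [map_add, map_add, map_add, hq, hq']⟩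
  | mul p q =>
    refine ⟨C (g q) * p, fun x => ?_⟩
    rw [map_mul, specL_inL, specL_inR, ← smul_eq_C_mul, map_smul, map_mul, eval_C, smul_eq_mul,
      mul_comm]

theorem gaussInt_taylorExp_mul_taylor (hS : ∀ a ∈ S, a.degree < A.totalMult)
    (hW : A.IsBANum (A.biNum S c)) (h0 : eval 0 (A.biNum S c) ≠ 0) (hξ : toComplex ξ ∈ A.regular)
    (mu lam : Fin n → ℂ) (N : ℕ) :
    A.gaussInt ξ (taylorExp mu (A.biNum S c) N * taylor lam (A.biNum S c) N) =
    (-1) ^ (N + A.totalMult) * ((2 * Real.pi) ^ ((n : ℝ) / 2) : ℝ) *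
      eval lam (taylor mu (A.biNum S c) N) := by
  set W := A.biNum S c
  set κ : ℂ := (-1) ^ (N + A.totalMult) * ((2 * Real.pi) ^ ((n : ℝ) / 2) : ℝ)
  obtain ⟨T, hT⟩ := exists_specL_eq_taylor W N
  obtain ⟨q, hq⟩ := exists_eval_eq_dual_specL T
    ((A.gaussIntLin hξ).comp (LinearMap.mulLeft ℂ (taylorExp mu W N)))
  have hq' : ∀ lam, A.gaussInt ξ (taylorExp mu W N * taylor lam W N) = eval lam q := fun lam => by
    rw [hT, ← hq]; rfl
  -- The value is known for λ in ξ + iℝⁿ, a product of infinite subsets of ℂ. Both sides are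
  -- polynomials in λ, so they agree everywhere, with the contour kept fixed.
  have hpoly : q = C κ * taylor mu W N := by
    refine MvPolynomial.funext_set
      (fun j => Set.range fun t : ℝ => (ξ j : ℂ) + Complex.I * t) (fun j => ?_) fun x hx => ?_
    · refine Set.infinite_range_of_injective fun a b hab => ?_
      simpa [Complex.I_ne_zero] using hab
    · choose η hη using fun j => hx j (Set.mem_univ j)
      have hx' : x = toComplex ξ + Complex.I • toComplex η := by
        ext j
        rw [← hη j]
        rfl
      rw [← hq', map_mul, eval_C, hx']
      exact gaussInt_taylorExp_mul_taylor_aux hS hW h0 hξ mu η N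
  rw [hq', hpoly, map_mul, eval_C]

end Arrangement

/-! ### Orthogonality of the polynomials e^{L/2}φ_N and symmetry of φ -/

namespace Arrangement

variable [Fintype ι] {A : Arrangement n ι} {ξ : Fin n → ℝ}
  {S : Finset (Fin n →₀ ℕ)} {c : (Fin n →₀ ℕ) → MvPolynomial (Fin n) ℂ}
  {W : MvPolynomial (Fin n ⊕ Fin n) ℂ}

lemma gaussInt_taylorExp_mul_eq_zero (hW : A.IsBANum W) (h0 : eval 0 W ≠ 0)
    (hξ : toComplex ξ ∈ A.regular) (mu lam : Fin n → ℂ) {N k : ℕ} (hk : k < N) :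
    A.gaussInt ξ (taylorExp mu W N * taylor lam W k) = 0 :=
  (eq_zero_and_hasSum_of_recurrence (hW.gaussInt_recurrence h0 hξ lam
    (fun _ hu => hW.shiftedL_taylorExp h0 mu N hu))).1 k hk

lemma gaussInt_mul_taylorExp (hξ : toComplex ξ ∈ A.regular) (h : MvPolynomial (Fin n) ℂ)
    (lam : Fin n → ℂ) (k : ℕ) : A.gaussInt ξ (h * taylorExp lam W k) =
      ∑ l ∈ Finset.range (k / 2 + 1), (pairing lam lam / 2) ^ l / l.factorial *
        A.gaussInt ξ (h * taylor lam W (k - 2 * l)) := by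
  rw [taylorExp, Finset.mul_sum, show A.gaussInt ξ = A.gaussIntLin hξ from rfl, map_sum]
  exact Finset.sum_congr rfl fun l _ => by rw [mul_smul_comm, map_smul, smul_eq_mul]

lemma gaussInt_taylorExp_mul_taylorExp_of_lt (hW : A.IsBANum W) (h0 : eval 0 W ≠ 0)
    (hξ : toComplex ξ ∈ A.regular) (mu lam : Fin n → ℂ) {N k : ℕ} (hk : k < N) :
    A.gaussInt ξ (taylorExp mu W N * taylorExp lam W k) = 0 := by
  rw [gaussInt_mul_taylorExp hξ]
  refine Finset.sum_eq_zero fun l _ => ?_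
  rw [gaussInt_taylorExp_mul_eq_zero hW h0 hξ mu lam (by omega), mul_zero]

/-- For N = k, all the terms of the second e^{L/2}φ_N except φ_N itself have lower degree and are
orthogonal to the first factor. For N ≠ k, the factor of larger index kills the other. -/
lemma gaussInt_taylorExp_mul_taylorExp (hS : ∀ a ∈ S, a.degree < A.totalMult)
    (hW : A.IsBANum (A.biNum S c)) (h0 : eval 0 (A.biNum S c) ≠ 0) (hξ : toComplex ξ ∈ A.regular)
    (mu lam : Fin n → ℂ) (N k : ℕ) :
    A.gaussInt ξ (taylorExp mu (A.biNum S c) N * taylorExp lam (A.biNum S c) k) =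
    if N = k then (-1) ^ (N + A.totalMult) * ((2 * Real.pi) ^ ((n : ℝ) / 2) : ℝ) *
      eval lam (taylor mu (A.biNum S c) N) else 0 := by
  split_ifs with h
  · subst h
    rw [gaussInt_mul_taylorExp hξ, Finset.sum_eq_single 0]
    · rw [pow_zero, Nat.factorial_zero, Nat.cast_one, div_one, one_mul, mul_zero, Nat.sub_zero,
        gaussInt_taylorExp_mul_taylor hS hW h0 hξ]
    · intro l hl hl0
      have := Finset.mem_range.mp hl
      rw [gaussInt_taylorExp_mul_eq_zero hW h0 hξ mu lam (by omega), mul_zero]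
    · exact fun h => absurd (Finset.mem_range.mpr (Nat.succ_pos _)) h
  · rcases lt_or_gt_of_ne h with h | h
    · rw [mul_comm, gaussInt_taylorExp_mul_taylorExp_of_lt hW h0 hξ _ _ h]
    · rw [gaussInt_taylorExp_mul_taylorExp_of_lt hW h0 hξ _ _ h]

/-- The Taylor components are symmetric in both arguments. -/
theorem eval_taylor_comm (hS : ∀ a ∈ S, a.degree < A.totalMult)
    (hW : A.IsBANum (A.biNum S c)) (h0 : eval 0 (A.biNum S c) ≠ 0)
    (mu lam : Fin n → ℂ) (N : ℕ) :
    eval lam (taylor mu (A.biNum S c) N) = eval mu (taylor lam (A.biNum S c) N) := by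
  obtain ⟨ξ, hξ⟩ := A.exists_real_regular
  -- The integrand is a commutative product, so exchanging μ and λ leaves the integral unchanged;
  -- the common constant is nonzero.
  have h1 := gaussInt_taylorExp_mul_taylorExp hS hW h0 hξ mu lam N N
  rw [mul_comm, gaussInt_taylorExp_mul_taylorExp hS hW h0 hξ lam mu N N, if_pos rfl,
    if_pos rfl] at h1
  refine (mul_left_cancel₀ (mul_ne_zero (pow_ne_zero _ (by norm_num)) ?_) h1).symm
  exact_mod_cast (Real.rpow_pos_of_pos (by positivity) _).ne'

/-- Summing the symmetric components recovers φ(x,λ) = φ(λ,x); the exponentials agree and cancel. -/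
theorem eval_biNum_comm (hS : ∀ a ∈ S, a.degree < A.totalMult)
    (hW : A.IsBANum (A.biNum S c)) (h0 : eval 0 (A.biNum S c) ≠ 0) (x lam : Fin n → ℂ) :
    eval (Sum.elim x lam) (A.biNum S c) = eval (Sum.elim lam x) (A.biNum S c) := by
  have h1 := hasSum_taylor x lam (A.biNum S c)
  have h2 := hasSum_taylor lam x (A.biNum S c)
  simp only [eval_taylor_comm hS hW h0 lam x] at h2
  have h3 := h1.unique h2
  rw [pairing_comm lam x] at h3
  exact mul_right_cancel₀ (Complex.exp_ne_zero _) h3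

end Arrangement

/-! ### Reality -/

/-- Complex conjugation on `ℂⁿ`. -/
def conjVec (x : Fin n → ℂ) : Fin n → ℂ := fun j => starRingEnd ℂ (x j)

lemma conjVec_conjVec (x : Fin n → ℂ) : conjVec (conjVec x) = x := by
  ext j; simp [conjVec]

lemma conjVec_toComplex (x : Fin n → ℝ) : conjVec (toComplex x) = toComplex x := by
  ext j; simp [conjVec, toComplex]

lemma pairing_conjVec (x y : Fin n → ℂ) :
    pairing (conjVec x) (conjVec y) = starRingEnd ℂ (pairing x y) := by
  simp [pairing, conjVec]

lemma eval_conj (x : Fin n → ℂ) (p : MvPolynomial (Fin n) ℂ) :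
    eval x (conj p) = starRingEnd ℂ (eval (conjVec x) p) := by
  induction p using MvPolynomial.induction_on with
  | C a => simp
  | add p q hp hq => simp [hp, hq]
  | mul_X p j hp => simp [hp, conjVec]

lemma eval_elim_conj (x lam : Fin n → ℂ) (W : MvPolynomial (Fin n ⊕ Fin n) ℂ) :
    eval (Sum.elim x lam) (conj W) =
      starRingEnd ℂ (eval (Sum.elim (conjVec x) (conjVec lam)) W) := by
  induction W using MvPolynomial.induction_on with
  | C a => simp
  | add p q hp hq => simp [hp, hq]
  | mul_X p j hp => rcases j with j | j <;> simp [hp, conjVec]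

lemma specR_conj (lam : Fin n → ℂ) (W : MvPolynomial (Fin n ⊕ Fin n) ℂ) :
    specR lam (conj W) = conj (specR (conjVec lam) W) :=
  MvPolynomial.funext fun x => by
    rw [eval_specR, eval_elim_conj, eval_conj, eval_specR]

lemma dirDeriv_conj (v : Fin n → ℝ) (p : MvPolynomial (Fin n) ℂ) :
    dirDeriv (toComplex v) (conj p) = conj (dirDeriv (toComplex v) p) := by
  induction p using MvPolynomial.induction_on with
  | C a => simp
  | add p q hp hq => simp only [map_add, hp, hq]
  | mul_X p j hp =>
    simp only [map_mul, map_X, Derivation.leibniz, hp, smul_eq_mul, dirDeriv_X, map_add, map_C]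
    simp [toComplex]

lemma twist_pow_conj (v : Fin n → ℝ) (z : ℂ) (k : ℕ) (p : MvPolynomial (Fin n) ℂ) :
    (twist (toComplex v) (starRingEnd ℂ z) ^ k) (conj p) =
      conj ((twist (toComplex v) z ^ k) p) := by
  induction k with
  | zero => simp
  | succ k ih =>
    rw [pow_succ', Module.End.mul_apply, ih, pow_succ', Module.End.mul_apply, twist_apply,
      twist_apply, dirDeriv_conj, map_add, smul_eq_C_mul, smul_eq_C_mul, map_mul, map_C]

lemma restr_conj (v : Fin n → ℝ) (p : MvPolynomial (Fin n) ℂ) :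
    restr (toComplex v) (conj p) = conj (restr (toComplex v) p) :=
  MvPolynomial.funext fun x => by
    have h1 := pairing_conjVec (toComplex v) x
    have h2 := pairing_conjVec (toComplex v) (toComplex v)
    rw [conjVec_toComplex] at h1 h2
    have h3 : conjVec (x - (pairing (toComplex v) x / pairing (toComplex v) (toComplex v)) •
        toComplex v) = conjVec x - (pairing (toComplex v) (conjVec x) /
          pairing (toComplex v) (toComplex v)) • toComplex v := by
      ext j
      simp only [conjVec, Pi.sub_apply, Pi.smul_apply, smul_eq_mul, map_sub, map_mul, map_div₀,
        ← h2, ← h1]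
      simp [toComplex]
    rw [eval_restr, eval_conj, eval_conj, eval_restr, h3]

lemma homogeneousComponent_conj (r : ℕ) (p : MvPolynomial (Fin n) ℂ) :
    homogeneousComponent r (conj p) = conj (homogeneousComponent r p) := by
  ext a
  rw [coeff_homogeneousComponent, coeff_map, coeff_map, coeff_homogeneousComponent]
  split_ifs <;> simp

lemma conj_mem_degLT {d : ℕ} {p : MvPolynomial (Fin n) ℂ} (h : p ∈ degLT n d) :
    conj p ∈ degLT n d := fun r hr => by
  rw [homogeneousComponent_conj, h r hr, map_zero]

lemma taylor_conj (lam : Fin n → ℂ) (W : MvPolynomial (Fin n ⊕ Fin n) ℂ) (N : ℕ) :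
    taylor lam (conj W) N = conj (taylor (conjVec lam) W N) := by
  induction W using MvPolynomial.induction_on generalizing N with
  | C a =>
    rw [map_C, taylor_C, taylor_C, map_mul conj, map_C, map_pow, map_mul (starRingEnd ℂ), map_inv₀,
      map_natCast]
    congr 2
    refine MvPolynomial.funext fun x => ?_
    rw [eval_conj, eval_linForm, eval_linForm, pairing_conjVec, Complex.conj_conj]
  | add p q hp hq => rw [map_add, taylor_add, taylor_add, hp, hq, map_add]
  | mul_X p j hp =>
    rw [map_mul, map_X]
    rcases j with j | j
    · rcases N with _ | N
      · rw [taylor_mul_X_inl_zero, taylor_mul_X_inl_zero, map_zero]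
      · rw [taylor_mul_X_inl_succ, taylor_mul_X_inl_succ, hp, smul_eq_C_mul, smul_eq_C_mul,
          map_mul, map_C, conjVec, Complex.conj_conj]
    · rw [taylor_mul_X_inr, taylor_mul_X_inr, hp, map_mul, map_X]

lemma exists_real_of_conj_eq {p : MvPolynomial (Fin n) ℂ} (h : conj p = p) :
    ∃ r : MvPolynomial (Fin n) ℝ, map (algebraMap ℝ ℂ) r = p := by
  have hr : p ∈ Set.range (map (algebraMap ℝ ℂ) : MvPolynomial (Fin n) ℝ → _) := by
    rw [mem_range_map_iff_coeffs_subset]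
    intro z hz
    obtain ⟨a, ha, rfl⟩ := mem_coeffs_iff.mp hz
    have : starRingEnd ℂ (coeff a p) = coeff a p := by
      conv_rhs => rw [← h, coeff_map]
    obtain ⟨t, ht⟩ := Complex.conj_eq_iff_real.mp this
    exact ⟨t, ht.symm⟩
  exact hr

lemma Arrangement.conj_mem_twistedQI {A : Arrangement n ι} {lam : Fin n → ℂ} {p : MvPolynomial (Fin n) ℂ}
    (h : p ∈ A.twistedQI (conjVec lam)) : conj p ∈ A.twistedQI lam := fun i s hs => by
  have h1 := pairing_conjVec (A.root i) (conjVec lam)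
  rw [conjVec_conjVec, show conjVec (A.root i) = A.root i from conjVec_toComplex _] at h1
  rw [h1, Arrangement.root, twist_pow_conj, restr_conj]
  exact (congrArg conj (h i s hs)).trans (map_zero _)

namespace Arrangement

variable [Fintype ι] {A : Arrangement n ι} {W : MvPolynomial (Fin n ⊕ Fin n) ℂ}

lemma conj_discrPoly (A : Arrangement n ι) : conj A.discrPoly = A.discrPoly := by
  rw [discrPoly, map_prod]
  refine Finset.prod_congr rfl fun i _ => ?_
  rw [map_pow]
  congr 1
  refine MvPolynomial.funext fun x => ?_
  rw [eval_conj, eval_linForm, eval_linForm, ← pairing_conjVec, conjVec_conjVec,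
    show conjVec (A.root i) = A.root i from conjVec_toComplex _]

/-- Conjugating the coefficients of P yields another Baker-Akhiezer numerator, since the vectors are
real; uniqueness applies. -/
lemma IsBANum.conj_eq (hW : A.IsBANum W) : conj W = W := by
  refine IsBANum.unique (A := A) ⟨fun lam => ?_, fun lam => ?_⟩ hW
  · rw [specR_conj]
    exact conj_mem_twistedQI (hW.qi _)
  · have h := conj_mem_degLT (hW.top (conjVec lam))
    have h1 : starRingEnd ℂ (A.discr (conjVec lam)) = A.discr lam := by
      rw [← eval_discrPoly, ← eval_conj, conj_discrPoly, eval_discrPoly]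
    rwa [map_sub, map_mul, map_C, conj_discrPoly, h1, ← specR_conj] at h

lemma IsBANum.conj_taylor (hW : A.IsBANum W) (x : Fin n → ℝ) (N : ℕ) :
    conj (taylor (toComplex x) W N) = taylor (toComplex x) W N := by
  have h := taylor_conj (toComplex x) W N
  rw [hW.conj_eq, conjVec_toComplex] at h
  exact h.symm

end Arrangement

/-! ### Taylor components span the quasi-invariants -/

lemma eval_map_algebraMap (x : Fin n → ℂ) (p : MvPolynomial (Fin n) ℝ) :
    eval x (map (algebraMap ℝ ℂ) p) = aeval x p := by
  rw [eval_map, aeval_def]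

lemma Arrangement.mem_quasiInvariants_iff {A : Arrangement n ι} (p : MvPolynomial (Fin n) ℝ) :
    p ∈ A.quasiInvariants ↔ map (algebraMap ℝ ℂ) p ∈ A.twistedQI 0 := by
  rw [← A.quasiInvariant_polyExp_iff]
  simp only [pairing_zero_right, Complex.exp_zero, mul_one, eval_map_algebraMap]
  rfl

namespace Arrangement

variable [Fintype ι] {A : Arrangement n ι} {φ : (Fin n → ℂ) → (Fin n → ℂ) → ℂ}
  {W : MvPolynomial (Fin n ⊕ Fin n) ℂ}

/-- By symmetry, the differentiated variable may be put in the second slot, where `exists_operator`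
works. The definition speaks only of points with nonzero denominator; multiplying by `den` once more
makes both sides agree everywhere, and this factor is then cancelled. -/
lemma isAssociated_iff (hφ : ∀ x lam, φ x lam =
      eval (Sum.elim lam x) W * Complex.exp (pairing lam x)) (D : RatDiffOp n)
    (p : MvPolynomial (Fin n) ℝ) : D.IsAssociated φ p ↔
      inR D.den * inL (map (algebraMap ℝ ℂ) p) * W =
        D.num.sum fun a q => inR q * twistMulti a W := by
  have key : ∀ lam x, eval x D.den ≠ 0 →
      (D.apply (fun y => φ y lam) x = aeval lam p * φ x lam ↔
        eval (Sum.elim lam x) (inR D.den * inL (map (algebraMap ℝ ℂ) p) * W) =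
          eval (Sum.elim lam x) (D.num.sum fun a q => inR q * twistMulti a W)) := by
    intro lam x hx
    have hfun : (fun y => φ y lam) =
        fun y => eval (Sum.elim lam y) W * Complex.exp (pairing lam y) := funext fun y => hφ y lam
    have hR : ∀ q : MvPolynomial (Fin n) ℂ, eval (Sum.elim lam x) (inR q) = eval x q := fun q => by
      rw [← eval_specL, specL_inR]
    have hL : ∀ q : MvPolynomial (Fin n) ℂ, eval (Sum.elim lam x) (inL q) = eval lam q := fun q => by
      rw [← eval_specL, specL_inL, eval_C]
    rw [RatDiffOp.apply, hfun, div_eq_iff hx, hφ]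
    simp only [multiDeriv_polyExp_right, Finsupp.sum, map_sum, map_mul, hR, hL,
      eval_map_algebraMap, ← mul_assoc, ← Finset.sum_mul]
    rw [mul_right_comm _ (Complex.exp _), mul_left_inj' (Complex.exp_ne_zero _), eq_comm,
      mul_comm _ (eval x D.den), ← mul_assoc]
  constructor
  · intro h
    have hden : inR D.den ≠ 0 := by
      rw [inR, Ne, map_eq_zero_iff _ (rename_injective _ Sum.inr_injective)]
      exact D.den_ne_zero
    refine mul_left_cancel₀ hden (biPoly_ext fun lam x => ?_)
    by_cases hx : eval x D.den = 0
    · have : eval (Sum.elim lam x) (inR D.den) = 0 := by rw [← eval_specL, specL_inR, hx]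
      rw [map_mul (eval _) (inR D.den), map_mul (eval _) (inR D.den), this, zero_mul, zero_mul]
    · rw [map_mul (eval _) (inR D.den), map_mul (eval _) (inR D.den), (key lam x hx).mp (h lam x hx)]
  · intro h lam x hx
    rw [key lam x hx, h]

/-- Apply `g` in the variable λ to D_uφ_N(λ,u) = ∑_i p_i(λ)φ_{N-i}(λ,u). By symmetry `g` kills
φ_N(·,u) for every u, hence also its u-derivatives, so it kills the right side for every u. -/
lemma IsBANum.dual_homogeneousComponent_eq_zero (hW : A.IsBANum W) (h0 : eval 0 W ≠ 0)
    (hsym : ∀ (mu lam : Fin n → ℂ) N, eval lam (taylor mu W N) = eval mu (taylor lam W N))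
    {D : RatDiffOp n} {p : MvPolynomial (Fin n) ℂ}
    (hD : inR D.den * inL p * W = D.num.sum fun a q => inR q * twistMulti a W)
    (g : MvPolynomial (Fin n) ℂ →ₗ[ℂ] ℂ) (N : ℕ) (hg : ∀ u, g (taylor u W N) = 0) :
    g (homogeneousComponent N p) = 0 := by
  choose T hT using exists_specL_eq_taylor W
  have hTsym : ∀ N u, specR u (T N) = taylor u W N := fun N u =>
    MvPolynomial.funext fun lam => by
      rw [eval_specR, ← eval_specL, ← hT, hsym]
  have hder : ∀ a, ∃ T', (∀ lam, taylor lam (twistMulti a W) N = specL lam T') ∧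
      ∀ u, g (specR u T') = 0 := fun a => by
    refine twistMulti_induction (d := 0) (p := 1) (motive := fun _ _ W' => ∃ T',
      (∀ lam, taylor lam W' N = specL lam T') ∧ ∀ u, g (specR u T') = 0) ?_ ?_ a
    · rintro j _ _ W' ⟨T', h1, h2⟩
      refine ⟨dirDerivR (Pi.single j 1) T', fun lam => ?_, fun u => ?_⟩
      · rw [← dirDeriv_taylor, h1, specL_dirDerivR]
      · exact dual_specR_dirDerivR_eq_zero h2 _ u
    · exact ⟨T N, hT N, fun u => by rw [hTsym, hg]⟩
  choose T' hT' hgT' using hder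
  set R : MvPolynomial (Fin n ⊕ Fin n) ℂ :=
    ∑ i ∈ Finset.range (N + 1), inL (homogeneousComponent i p) * T (N - i) with hR
  have hflat : inR D.den * R = D.num.sum fun a q => inR q * T' a := by
    refine biPoly_ext fun lam u => ?_
    rw [← eval_specL, ← eval_specL]
    congr 1
    have h := congrArg (fun W => taylor lam W N) hD
    simp only [mul_assoc, taylor_inR_mul, taylor_inL_mul, Finsupp.sum, taylor_sum, hT', hT] at h
    simpa only [map_mul, Finsupp.sum, map_sum, specL_inR, specL_inL, hR, smul_eq_C_mul] using h
  obtain ⟨q, hq⟩ := exists_eval_eq_dual_specR R g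
  have hq0 : q = 0 := by
    have : D.den * q = 0 := MvPolynomial.funext fun u => by
      have h := congrArg (fun W => g (specR u W)) hflat
      simp only [map_mul, specR_inR, ← smul_eq_C_mul, map_smul, Finsupp.sum, map_sum, hgT',
        smul_eq_mul, mul_zero, Finset.sum_const_zero] at h
      rw [map_mul, ← hq, h, map_zero]
    exact (mul_eq_zero.mp this).resolve_left D.den_ne_zero
  -- At u = 0 only φ_0 = φ(0,0) survives, which leaves the single term i = N.
  have h1 : specR 0 R = homogeneousComponent N p * C (eval 0 W) := by
    have h2 : ∀ m, specR 0 (T m) = if m = 0 then C (eval 0 W) else 0 := fun m => by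
      refine MvPolynomial.funext fun lam => ?_
      rw [hTsym, ← hsym]
      split_ifs with hm
      · rw [hm, hW.taylor_zero, eval_C, eval_C]
      · have h3 := eval_smul_of_isHomogeneous (hW.taylor_isHomogeneous lam m) 0 0
        rw [smul_zero, zero_pow hm, zero_mul] at h3
        rw [h3, map_zero]
    rw [hR, map_sum, Finset.sum_eq_single N]
    · rw [map_mul, specR_inL, h2, Nat.sub_self, if_pos rfl]
    · intro i hi hiN
      have := Finset.mem_range.mp hi
      rw [map_mul, h2, if_neg (by omega), mul_zero]
    · exact fun h => absurd (Finset.mem_range.mpr (Nat.lt_succ_self N)) h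
  have h2 := hq 0
  rw [hq0, map_zero, h1, mul_comm, ← smul_eq_C_mul, map_smul, smul_eq_mul] at h2
  exact (mul_eq_zero.mp h2).resolve_left h0

/-- If a homogeneous part of `p` were outside the span, a functional would separate it. That
functional kills φ_N(λ,·) for real λ, hence for all λ by polynomiality, contradicting the preceding
lemma. Real λ are used so that the spanning polynomials are real. -/
lemma IsBANum.mem_span_taylor (hW : A.IsBANum W) (h0 : eval 0 W ≠ 0)
    (hsym : ∀ (mu lam : Fin n → ℂ) N, eval lam (taylor mu W N) = eval mu (taylor lam W N))
    {p : MvPolynomial (Fin n) ℂ} (hp : p ∈ A.twistedQI 0) :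
    p ∈ Submodule.span ℂ (Set.range fun q : (Fin n → ℝ) × ℕ => taylor (toComplex q.1) W q.2) := by
  obtain ⟨D, hD⟩ := hW.exists_operator hp
  obtain ⟨d, hd⟩ := exists_mem_degLT p
  rw [← sum_homogeneousComponent_of_mem_degLT hd]
  refine Submodule.sum_mem _ fun N _ => ?_
  by_contra hN
  obtain ⟨g, hg0, hg⟩ := Submodule.exists_le_ker_of_notMem hN
  refine hg0 (hW.dual_homogeneousComponent_eq_zero h0 hsym hD g N fun u => ?_)
  obtain ⟨T, hT⟩ := exists_specL_eq_taylor W N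
  obtain ⟨q, hq⟩ := exists_eval_eq_dual_specL T g
  have hq0 : q = 0 := by
    refine MvPolynomial.funext_set (fun _ => Set.range ((↑) : ℝ → ℂ))
      (fun _ => Set.infinite_range_of_injective Complex.ofReal_injective) fun x hx => ?_
    choose y hy using fun j => hx j (Set.mem_univ j)
    have hxy : x = toComplex y := funext fun j => (hy j).symm
    rw [← hq, ← hT, hxy, map_zero]
    exact hg (Submodule.subset_span ⟨(y, N), rfl⟩)
  rw [hT, hq, hq0, map_zero]

lemma _root_.BakerAkhiezer.mem_span_real_of_conj_eq {s : Set (MvPolynomial (Fin n) ℂ)}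
    (hs : ∀ p ∈ s, conj p = p) {p : MvPolynomial (Fin n) ℂ} (hp : conj p = p)
    (h : p ∈ Submodule.span ℂ s) : p ∈ Submodule.span ℝ s := by
  have hreal : ∀ q ∈ Submodule.span ℝ s, conj q = q := fun q hq => by
    induction hq using Submodule.span_induction with
    | mem q hq => exact hs q hq
    | zero => exact map_zero _
    | add q q' _ _ hq hq' => rw [map_add, hq, hq']
    | smul t q _ hq =>
      rw [← Complex.coe_smul, smul_eq_C_mul, map_mul, hq, map_C, Complex.conj_ofReal]
  have hsplit : ∀ q ∈ Submodule.span ℂ s, ∃ a ∈ Submodule.span ℝ s, ∃ b ∈ Submodule.span ℝ s,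
      q = a + Complex.I • b := fun q hq => by
    induction hq using Submodule.span_induction with
    | mem q hq => exact ⟨q, Submodule.subset_span hq, 0, zero_mem _, by simp⟩
    | zero => exact ⟨0, zero_mem _, 0, zero_mem _, by simp⟩
    | add q q' _ _ hq hq' =>
      obtain ⟨a, ha, b, hb, rfl⟩ := hq
      obtain ⟨a', ha', b', hb', rfl⟩ := hq'
      exact ⟨a + a', add_mem ha ha', b + b', add_mem hb hb', by rw [smul_add]; abel⟩
    | smul z q _ hq =>
      obtain ⟨a, ha, b, hb, rfl⟩ := hq
      refine ⟨z.re • a - z.im • b, sub_mem (Submodule.smul_mem _ _ ha) (Submodule.smul_mem _ _ hb),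
        z.im • a + z.re • b, add_mem (Submodule.smul_mem _ _ ha) (Submodule.smul_mem _ _ hb), ?_⟩
      conv_lhs => rw [← Complex.re_add_im z]
      simp only [← Complex.coe_smul, smul_eq_C_mul, map_add, map_mul]
      have hI : (C Complex.I * C Complex.I : MvPolynomial (Fin n) ℂ) = -1 := by
        rw [← map_mul, Complex.I_mul_I, map_neg, map_one]
      linear_combination C (z.im : ℂ) * b * hI
  obtain ⟨a, ha, b, hb, rfl⟩ := hsplit p h
  rw [map_add, smul_eq_C_mul, map_mul, map_C, Complex.conj_I, hreal a ha, hreal b hb, map_neg] at hp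
  have hb0 : C (2 * Complex.I) * b = 0 := by
    rw [map_mul, show (C 2 : MvPolynomial (Fin n) ℂ) = 2 from map_ofNat _ _]
    linear_combination -hp
  have hb0' : b = 0 := (mul_eq_zero.mp hb0).resolve_left (by simp [Complex.I_ne_zero])
  rw [hb0', smul_zero, add_zero]
  exact ha

end Arrangement

/-! ### The exponential of `L / 2` and the contour integral -/

namespace Arrangement

variable [Fintype ι] {A : Arrangement n ι} {W : MvPolynomial (Fin n ⊕ Fin n) ℂ}
  {p p' q q' : MvPolynomial (Fin n) ℂ}

lemma L_congr {f g : (Fin n → ℂ) → ℂ} (h : ∀ x ∈ A.regular, f x = g x) :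
    ∀ x ∈ A.regular, A.L f x = A.L g x := by
  have hline : ∀ {f g : (Fin n → ℂ) → ℂ} (v : Fin n → ℂ), (∀ x ∈ A.regular, f x = g x) →
      ∀ x ∈ A.regular, lineDeriv ℂ f x v = lineDeriv ℂ g x v := fun v h x hx =>
    Filter.EventuallyEq.lineDeriv_eq
      (Filter.eventually_of_mem (A.isOpen_regular.mem_nhds hx) h)
  intro x hx
  rw [L, L]
  congr 1
  · exact Finset.sum_congr rfl fun j _ => hline _ (hline _ h) x hx
  · exact Finset.sum_congr rfl fun i _ => by rw [hline _ h x hx]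

/-- The iterates of `L` on `p` are polynomials, eventually zero, and `exp (L / 2) p = p'`. -/
def ExpChain (A : Arrangement n ι) (p p' : MvPolynomial (Fin n) ℂ) : Prop :=
  ∃ (Q : ℕ → MvPolynomial (Fin n) ℂ) (K : ℕ), Q 0 = p ∧
    (∀ k, ∀ x ∈ A.regular, A.L (fun y => eval y (Q k)) x = eval x (Q (k + 1))) ∧
    (∀ k ≥ K, Q k = 0) ∧
    p' = ∑ k ∈ Finset.range K, ((2 : ℂ) ^ k * k.factorial)⁻¹ • Q k

lemma iterate_L_eval {Q : ℕ → MvPolynomial (Fin n) ℂ}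
    (hQ : ∀ k, ∀ x ∈ A.regular, A.L (fun y => eval y (Q k)) x = eval x (Q (k + 1))) (k : ℕ) :
    ∀ x ∈ A.regular, A.L^[k] (fun y => eval y (Q 0)) x = eval x (Q k) := by
  induction k with
  | zero => exact fun x _ => rfl
  | succ k ih =>
    intro x hx
    rw [Function.iterate_succ_apply', L_congr ih x hx, hQ k x hx]

lemma ExpChain.iterate_eq_zero (h : A.ExpChain p p') :
    ∃ N, ∀ k ≥ N, ∀ x ∈ A.regular, A.L^[k] (fun y => eval y p) x = 0 := by
  obtain ⟨Q, K, rfl, hQ, hK, -⟩ := h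
  exact ⟨K, fun k hk x hx => by rw [iterate_L_eval hQ k x hx, hK k hk, map_zero]⟩

lemma ExpChain.expHalfL_eq (h : A.ExpChain p p') {x : Fin n → ℂ} (hx : x ∈ A.regular) :
    A.expHalfL (fun y => eval y p) x = eval x p' := by
  obtain ⟨Q, K, rfl, hQ, hK, rfl⟩ := h
  rw [expHalfL, tsum_eq_sum (s := Finset.range K), map_sum]
  · refine Finset.sum_congr rfl fun k _ => ?_
    rw [iterate_L_eval hQ k x hx, smul_eval, div_eq_inv_mul]
  · intro k hk
    rw [iterate_L_eval hQ k x hx, hK k (by simpa using hk), map_zero, zero_div]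

lemma L_eval_add (p q : MvPolynomial (Fin n) ℂ) (x : Fin n → ℂ) :
    A.L (fun y => eval y (p + q)) x = A.L (fun y => eval y p) x + A.L (fun y => eval y q) x := by
  rw [L_eval, L_eval, L_eval]
  simp only [map_add, mul_add, Finset.sum_add_distrib]
  ring

lemma L_eval_smul (z : ℂ) (p : MvPolynomial (Fin n) ℂ) (x : Fin n → ℂ) :
    A.L (fun y => eval y (z • p)) x = z * A.L (fun y => eval y p) x := by
  rw [L_eval, L_eval]
  simp only [Derivation.map_smul, smul_eval, mul_sub, Finset.mul_sum]
  congr 1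
  exact Finset.sum_congr rfl fun i _ => by ring

lemma sum_range_eq_of_zero {Q : ℕ → MvPolynomial (Fin n) ℂ} {K K' : ℕ} (h : ∀ k ≥ K, Q k = 0)
    (hK : K ≤ K') (c : ℕ → ℂ) :
    ∑ k ∈ Finset.range K, c k • Q k = ∑ k ∈ Finset.range K', c k • Q k :=
  Finset.sum_subset (Finset.range_mono hK) fun k _ hk => by
    rw [h k (by simpa using hk), smul_zero]

lemma ExpChain.zero : A.ExpChain 0 0 :=
  ⟨fun _ => 0, 0, rfl, fun k x _ => by simpa using A.L_eval_smul 0 0 x, fun _ _ => rfl, by simp⟩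

lemma ExpChain.add (h : A.ExpChain p p') (h' : A.ExpChain q q') :
    A.ExpChain (p + q) (p' + q') := by
  obtain ⟨Q, K, rfl, hQ, hK, rfl⟩ := h
  obtain ⟨Q', K', rfl, hQ', hK', rfl⟩ := h'
  refine ⟨fun k => Q k + Q' k, max K K', rfl, fun k x hx => ?_, fun k hk => ?_, ?_⟩
  · rw [L_eval_add, hQ k x hx, hQ' k x hx, map_add]
  · beta_reduce
    rw [hK k (le_of_max_le_left hk), hK' k (le_of_max_le_right hk), add_zero]
  · rw [sum_range_eq_of_zero hK (le_max_left K K'), sum_range_eq_of_zero hK' (le_max_right K K')]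
    simp only [smul_add, Finset.sum_add_distrib]

lemma ExpChain.smul (h : A.ExpChain p p') (z : ℂ) : A.ExpChain (z • p) (z • p') := by
  obtain ⟨Q, K, rfl, hQ, hK, rfl⟩ := h
  refine ⟨fun k => z • Q k, K, rfl, fun k x hx => ?_, fun k hk => ?_, ?_⟩
  · rw [L_eval_smul, hQ k x hx, smul_eval]
  · beta_reduce
    rw [hK k hk, smul_zero]
  · rw [Finset.smul_sum]
    exact Finset.sum_congr rfl fun k _ => smul_comm _ _ _

lemma IsBANum.expChain_taylor (hW : A.IsBANum W) (h0 : eval 0 W ≠ 0) (mu : Fin n → ℂ) (N : ℕ) :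
    A.ExpChain (taylor mu W N) (taylorExp mu W N) := by
  refine ⟨fun k => if 2 * k ≤ N then pairing mu mu ^ k • taylor mu W (N - 2 * k) else 0,
    N / 2 + 1, by simp, fun k x hx => ?_, fun k hk => if_neg (by omega), ?_⟩
  · by_cases h : 2 * k ≤ N
    · simp only [if_pos h]
      rw [L_eval_smul, hW.L_taylor h0 mu _ hx]
      by_cases h2 : 2 * (k + 1) ≤ N
      · rw [if_pos (by omega), if_pos h2, smul_eval, pow_succ, mul_assoc,
          show N - 2 * k - 2 = N - 2 * (k + 1) by omega]
      · rw [if_neg (by omega), if_neg h2, mul_zero, map_zero]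
    · simp only [if_neg h, if_neg (by omega : ¬ 2 * (k + 1) ≤ N)]
      simpa using A.L_eval_smul 0 0 x
  · rw [taylorExp]
    refine Finset.sum_congr rfl fun k hk => ?_
    have := Finset.mem_range.mp hk
    beta_reduce
    rw [if_pos (by omega), smul_smul, div_pow, mul_inv]
    congr 1
    rw [div_div, div_eq_mul_inv, mul_inv]
    ring

/-- Lp = 0 is known only at regular points, but Q 1 is a polynomial and these points are dense, so Q
1 and all later iterates vanish. -/
lemma ExpChain.eq_of_harmonic (h : A.ExpChain p p')
    (hp : ∀ x ∈ A.regular, A.L (fun y => eval y p) x = 0) : p' = p := by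
  obtain ⟨Q, K, rfl, hQ, hK, rfl⟩ := h
  have hext : ∀ {q : MvPolynomial (Fin n) ℂ}, (∀ x ∈ A.regular, eval x q = 0) → q = 0 :=
    fun {q} hq => MvPolynomial.funext fun x => congrFun (A.eq_of_eq_on_regular
      (continuous_eval q) (continuous_eval 0) fun x hx => by rw [hq x hx, map_zero]) x
  have hzero : ∀ k, Q (k + 1) = 0 := fun k => by
    induction k with
    | zero => exact hext fun x hx => by rw [← hQ 0 x hx, hp x hx]
    | succ k ih =>
      refine hext fun x hx => ?_
      rw [← hQ (k + 1) x hx, ih]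
      simpa using A.L_eval_smul 0 0 x
  rw [sum_range_eq_of_zero hK (Nat.le_succ K), Finset.sum_range_succ',
    Finset.sum_eq_zero fun k _ => by rw [hzero, smul_zero]]
  simp

lemma contourDensity_eq {ξ : Fin n → ℝ} (hξ : toComplex ξ ∈ A.regular)
    {F G : (Fin n → ℂ) → ℂ} (hF : ∀ x ∈ A.regular, F x = eval x p)
    (hG : ∀ x ∈ A.regular, G x = eval x q) :
    A.contourDensity F G ξ = fun y =>
      ((-1) ^ A.totalMult * (((2 * Real.pi) ^ (-(n : ℝ) / 2) : ℝ) : ℂ)) *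
        (eval (contour ξ y) (scale (-1) p * q) * A.weight (contour ξ y)) := by
  funext y
  set u := contour ξ y with hu
  have hreg : u ∈ A.regular := contour_mem_regular hξ y
  have hx : toComplex y + Complex.I • toComplex ξ = (-Complex.I) • u := by
    ext j
    simp only [hu, contour, toComplex, Pi.add_apply, Pi.smul_apply, Pi.sub_apply, smul_eq_mul]
    linear_combination (y j : ℂ) * Complex.I_sq
  have hIx : Complex.I • (-Complex.I) • u = u := by
    rw [smul_smul, mul_neg, Complex.I_mul_I, neg_neg, one_smul]
  have hd : A.discr ((-Complex.I) • u) ^ 2 = (-1) ^ A.totalMult * A.discr u ^ 2 := by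
    rw [discr_smul, mul_pow, ← pow_mul, mul_comm A.totalMult, pow_mul, neg_sq, Complex.I_sq]
  have hpair : -pairing ((-Complex.I) • u) ((-Complex.I) • u) / 2 = pairing u u / 2 := by
    rw [pairing_smul_left, pairing_smul_right]
    linear_combination -(pairing u u / 2) * Complex.I_sq
  have hneg : -u ∈ A.regular := fun i => by
    rw [form_eq_pairing, pairing_neg_right, neg_ne_zero]
    exact hreg i
  have hsq : ((-1 : ℂ) ^ A.totalMult)⁻¹ = (-1) ^ A.totalMult := by
    rw [← inv_pow, inv_neg, inv_one]
  rw [contourDensity]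
  simp only [hx, hIx, hd, hpair, hF _ hneg, hG _ hreg]
  rw [map_mul, eval_scale, neg_one_smul, weight, div_eq_mul_inv, div_eq_mul_inv, mul_inv, hsq]
  ring

variable {S : Finset (Fin n →₀ ℕ)} {c : (Fin n →₀ ℕ) → MvPolynomial (Fin n) ℂ}

/-- All the components of this sum have degrees of the same parity as N. -/
lemma scale_neg_one_taylorExp (hW : A.IsBANum W) (mu : Fin n → ℂ) (N : ℕ) :
    scale (-1) (taylorExp mu W N) = (-1 : ℂ) ^ N • taylorExp mu W N := by
  rw [taylorExp, map_sum, Finset.smul_sum]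
  refine Finset.sum_congr rfl fun k hk => ?_
  have := Finset.mem_range.mp hk
  rw [map_smul, scale_of_isHomogeneous (hW.taylor_isHomogeneous mu _), smul_comm]
  have h1 : (-1 : ℂ) ^ N = (-1) ^ (N - 2 * k) * (-1) ^ (2 * k) := by
    rw [← pow_add, Nat.sub_add_cancel (by omega)]
  rw [h1, pow_mul (-1 : ℂ) 2 k, neg_one_sq, one_pow, mul_one]

/-- Pairing e^{L/2}p, reflected, against e^{L/2}φ_N(λ,·) reproduces p_N(λ). The reflection u ↦ -u,
which comes from the argument -ix, cancels the sign (-1)^N of the orthogonality relation. -/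
lemma exists_expChain_gaussInt (hS : ∀ a ∈ S, a.degree < A.totalMult)
    (hW : A.IsBANum (A.biNum S c)) (h0 : eval 0 (A.biNum S c) ≠ 0)
    (hp : p ∈ Submodule.span ℝ
      (Set.range fun q : (Fin n → ℝ) × ℕ => taylor (toComplex q.1) (A.biNum S c) q.2)) :
    ∃ p', A.ExpChain p p' ∧ ∀ ξ, toComplex ξ ∈ A.regular → ∀ lam N,
      A.gaussInt ξ (scale (-1) p' * taylorExp lam (A.biNum S c) N) =
        (-1) ^ A.totalMult * ((2 * Real.pi) ^ ((n : ℝ) / 2) : ℝ) *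
          eval lam (homogeneousComponent N p) := by
  induction hp using Submodule.span_induction with
  | mem p hp =>
    obtain ⟨⟨mu, k⟩, rfl⟩ := hp
    refine ⟨_, hW.expChain_taylor h0 (toComplex mu) k, fun ξ hξ lam N => ?_⟩
    rw [scale_neg_one_taylorExp hW, smul_mul_assoc, gaussInt_smul,
      gaussInt_taylorExp_mul_taylorExp hS hW h0 hξ,
      homogeneousComponent_of_mem (hW.taylor_isHomogeneous _ k)]
    by_cases hkN : k = N
    · subst hkN
      have : (-1 : ℂ) ^ k * (-1) ^ k = 1 := by rw [← mul_pow]; simp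
      rw [if_pos rfl, if_pos rfl, pow_add]
      linear_combination (-1) ^ A.totalMult * (((2 * Real.pi) ^ ((n : ℝ) / 2) : ℝ) : ℂ) *
        eval lam (taylor (toComplex mu) (A.biNum S c) k) * this
    · rw [if_neg hkN, if_neg (Ne.symm hkN), map_zero, mul_zero, mul_zero]
  | zero =>
    exact ⟨0, ExpChain.zero, fun ξ _ lam N => by simp [gaussInt]⟩
  | add p q _ _ hp hq =>
    obtain ⟨p', hp, hp'⟩ := hp
    obtain ⟨q', hq, hq'⟩ := hq
    refine ⟨p' + q', hp.add hq, fun ξ hξ lam N => ?_⟩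
    rw [map_add, add_mul, gaussInt_add hξ, hp' ξ hξ, hq' ξ hξ, map_add, map_add, mul_add]
  | smul t p _ hp =>
    obtain ⟨p', hp, hp'⟩ := hp
    refine ⟨(t : ℂ) • p', by rw [← Complex.coe_smul]; exact hp.smul _, fun ξ hξ lam N => ?_⟩
    rw [map_smul, smul_mul_assoc, gaussInt_smul, hp' ξ hξ, ← Complex.coe_smul, map_smul, smul_eval]
    ring

lemma multiDeriv_eval (a : Fin n →₀ ℕ) :
    ∃ T : MvPolynomial (Fin n) ℂ →ₗ[ℂ] MvPolynomial (Fin n) ℂ, ∀ p,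
      multiDeriv a (fun y => eval y p) = fun y => eval y (T p) := by
  unfold multiDeriv
  induction List.finRange n with
  | nil => exact ⟨LinearMap.id, fun p => rfl⟩
  | cons j l ih =>
    obtain ⟨T, hT⟩ := ih
    refine ⟨((dirDeriv (Pi.single j 1)).toLinearMap ^ a j).comp T, fun p => ?_⟩
    rw [List.foldr_cons, hT, LinearMap.comp_apply]
    generalize T p = p
    induction a j generalizing p with
    | zero => rfl
    | succ k ih =>
      rw [Function.iterate_succ_apply, partialDeriv_eval, ih, pow_succ, Module.End.mul_apply]
      rfl

lemma apply_eval_add (D : RatDiffOp n) (p q : MvPolynomial (Fin n) ℂ) (x : Fin n → ℂ) :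
    D.apply (fun y => eval y (p + q)) x =
      D.apply (fun y => eval y p) x + D.apply (fun y => eval y q) x := by
  choose T hT using fun a => multiDeriv_eval (n := n) a
  unfold RatDiffOp.apply
  rw [← add_div]
  congr 1
  simp only [Finsupp.sum, hT, ← Finset.sum_add_distrib]
  exact Finset.sum_congr rfl fun a _ => by rw [map_add, map_add, mul_add]

lemma apply_eval_smul (D : RatDiffOp n) (z : ℂ) (p : MvPolynomial (Fin n) ℂ) (x : Fin n → ℂ) :
    D.apply (fun y => eval y (z • p)) x = z * D.apply (fun y => eval y p) x := by
  choose T hT using fun a => multiDeriv_eval (n := n) a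
  unfold RatDiffOp.apply
  rw [← mul_div_assoc]
  congr 1
  simp only [Finsupp.sum, hT, Finset.mul_sum]
  exact Finset.sum_congr rfl fun a _ => by rw [map_smul, smul_eval, mul_left_comm]

/-- On q = φ_N(l,·), the operator gives ∑ p_i(l)φ_{N-i}(l,·), whose value at 0 is φ(0,0)p_N(l),
matching the integral. Taking the real span with real l keeps the polynomial `r` real. -/
lemma exists_apply_eq (hW : A.IsBANum W)
    (h0 : eval 0 W ≠ 0) {D : RatDiffOp n} (hpconj : conj p = p)
    (hD : inR D.den * inL p * W = D.num.sum fun a q => inR q * twistMulti a W)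
    {p' : MvPolynomial (Fin n) ℂ} (hp' : ∀ ξ, toComplex ξ ∈ A.regular → ∀ lam N,
      A.gaussInt ξ (scale (-1) p' * taylorExp lam W N) =
        (-1) ^ A.totalMult * ((2 * Real.pi) ^ ((n : ℝ) / 2) : ℝ) *
          eval lam (homogeneousComponent N p))
    (hq : q ∈ Submodule.span ℝ
      (Set.range fun q : (Fin n → ℝ) × ℕ => taylor (toComplex q.1) W q.2)) :
    ∃ r q', conj r = r ∧ A.ExpChain q q' ∧
      (∀ x, eval x D.den ≠ 0 → D.apply (fun y => eval y q) x = eval x r) ∧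
      ∀ ξ, toComplex ξ ∈ A.regular → eval 0 W * A.gaussInt ξ (scale (-1) p' * q') =
        (-1) ^ A.totalMult * ((2 * Real.pi) ^ ((n : ℝ) / 2) : ℝ) * eval 0 r := by
  induction hq using Submodule.span_induction with
  | mem q hq =>
    obtain ⟨⟨l, N⟩, rfl⟩ := hq
    refine ⟨∑ i ∈ Finset.range (N + 1), eval (toComplex l) (homogeneousComponent i p) •
      taylor (toComplex l) W (N - i), _, ?_, hW.expChain_taylor h0 (toComplex l) N,
      fun x hx => taylor_operator hD _ N hx, fun ξ hξ => ?_⟩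
    · rw [map_sum]
      refine Finset.sum_congr rfl fun i _ => ?_
      have h1 := eval_conj (toComplex l) (homogeneousComponent i p)
      rw [← homogeneousComponent_conj, hpconj, conjVec_toComplex] at h1
      rw [smul_eq_C_mul, map_mul, hW.conj_taylor, map_C, ← h1]
    · rw [hp' ξ hξ, map_sum, Finset.sum_eq_single N]
      · rw [Nat.sub_self, hW.taylor_zero, smul_eval, eval_C]
        ring
      · intro i hi hiN
        have := Finset.mem_range.mp hi
        have h3 := eval_smul_of_isHomogeneous (hW.taylor_isHomogeneous (toComplex l) (N - i)) 0 0
        rw [smul_zero, zero_pow (by omega), zero_mul] at h3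
        rw [smul_eval, h3, mul_zero]
      · exact fun h => absurd (Finset.mem_range.mpr (Nat.lt_succ_self N)) h
  | zero =>
    refine ⟨0, 0, map_zero _, ExpChain.zero, fun x _ => ?_, fun ξ _ => by simp [gaussInt]⟩
    simpa using apply_eval_smul D 0 0 x
  | add q₁ q₂ _ _ h₁ h₂ =>
    obtain ⟨r₁, q₁', hr₁, hc₁, hD₁, hg₁⟩ := h₁
    obtain ⟨r₂, q₂', hr₂, hc₂, hD₂, hg₂⟩ := h₂
    refine ⟨r₁ + r₂, q₁' + q₂', by rw [map_add, hr₁, hr₂], hc₁.add hc₂, fun x hx => ?_,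
      fun ξ hξ => ?_⟩
    · rw [apply_eval_add, hD₁ x hx, hD₂ x hx, map_add]
    · rw [mul_add, gaussInt_add hξ, mul_add, hg₁ ξ hξ, hg₂ ξ hξ, map_add, mul_add]
  | smul t q _ h =>
    obtain ⟨r, q', hr, hc, hD', hg⟩ := h
    refine ⟨(t : ℂ) • r, (t : ℂ) • q', ?_, by rw [← Complex.coe_smul]; exact hc.smul _,
      fun x hx => ?_, fun ξ hξ => ?_⟩
    · rw [smul_eq_C_mul, map_mul, map_C, Complex.conj_ofReal, hr]
    · rw [← Complex.coe_smul, apply_eval_smul, hD' x hx, smul_eval]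
    · rw [mul_smul_comm, gaussInt_smul, smul_eval, mul_left_comm, hg ξ hξ]
      ring

lemma integrable_and_integral_contourDensity {ξ : Fin n → ℝ} (hξ : toComplex ξ ∈ A.regular)
    {F G : (Fin n → ℂ) → ℂ} (hF : ∀ x ∈ A.regular, F x = eval x p)
    (hG : ∀ x ∈ A.regular, G x = eval x q) {b r : ℂ}
    (h : b * A.gaussInt ξ (scale (-1) p * q) =
      (-1) ^ A.totalMult * ((2 * Real.pi) ^ ((n : ℝ) / 2) : ℝ) * r) :
    Integrable (A.contourDensity F G ξ) ∧ r = b * ∫ y, A.contourDensity F G ξ y := by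
  rw [contourDensity_eq hξ hF hG]
  refine ⟨(integrable_mul_weight hξ _).const_mul _, ?_⟩
  rw [integral_const_mul, mul_left_comm]
  change r = _ * (b * A.gaussInt ξ (scale (-1) p * q))
  rw [h]
  have h1 : ((((2 * Real.pi) ^ (-(n : ℝ) / 2) : ℝ) : ℂ)) *
      (((2 * Real.pi) ^ ((n : ℝ) / 2) : ℝ) : ℂ) = 1 := by
    rw [← Complex.ofReal_mul, ← Real.rpow_add (by positivity), neg_div, neg_add_cancel,
      Real.rpow_zero, Complex.ofReal_one]
  have h2 : (-1 : ℂ) ^ A.totalMult * (-1) ^ A.totalMult = 1 := by rw [← mul_pow]; simp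
  linear_combination -(r * (-1) ^ A.totalMult * (-1) ^ A.totalMult) * h1 - r * h2

end Arrangement

/-! ### Assembly: transfer to φ and to real polynomials -/

namespace Arrangement

variable [Fintype ι] {A : Arrangement n ι}

lemma IsBakerAkhiezer.exists_isBANum {φ : (Fin n → ℂ) → (Fin n → ℂ) → ℂ}
    (hφ : A.IsBakerAkhiezer φ) (h0 : φ 0 0 ≠ 0) :
    ∃ (S : Finset (Fin n →₀ ℕ)) (c : (Fin n →₀ ℕ) → MvPolynomial (Fin n) ℂ),
      (∀ a ∈ S, a.degree < A.totalMult) ∧ A.IsBANum (A.biNum S c) ∧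
      eval 0 (A.biNum S c) = φ 0 0 ∧
      ∀ x lam, φ x lam = eval (Sum.elim lam x) (A.biNum S c) * Complex.exp (pairing lam x) := by
  obtain ⟨S, c, hS, hφeq⟩ := hφ.exists_biNum
  have hW := hφ.isBANum hS hφeq
  have he : eval 0 (A.biNum S c) = φ 0 0 := by
    have h := hφeq 0 0
    have hz : (Sum.elim 0 0 : Fin n ⊕ Fin n → ℂ) = 0 := by ext (i | i) <;> rfl
    rw [hz, pairing_zero_right, Complex.exp_zero, mul_one] at h
    exact h.symm
  refine ⟨S, c, hS, hW, he, fun x lam => ?_⟩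
  rw [hφeq, pairing_comm, eval_biNum_comm hS hW (he ▸ h0)]

lemma conj_map_algebraMap (p : MvPolynomial (Fin n) ℝ) :
    conj (map (algebraMap ℝ ℂ) p) = map (algebraMap ℝ ℂ) p := by
  rw [conj, map_map]
  congr 1
  ext x
  · simp
  · simp

lemma mem_span_real_taylor {S : Finset (Fin n →₀ ℕ)} {c : (Fin n →₀ ℕ) → MvPolynomial (Fin n) ℂ}
    (hS : ∀ a ∈ S, a.degree < A.totalMult) (hW : A.IsBANum (A.biNum S c))
    (h0 : eval 0 (A.biNum S c) ≠ 0) {p : MvPolynomial (Fin n) ℝ} (hp : p ∈ A.quasiInvariants) :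
    map (algebraMap ℝ ℂ) p ∈ Submodule.span ℝ
      (Set.range fun q : (Fin n → ℝ) × ℕ => taylor (toComplex q.1) (A.biNum S c) q.2) := by
  refine mem_span_real_of_conj_eq ?_ (conj_map_algebraMap p)
    (hW.mem_span_taylor h0 (eval_taylor_comm hS hW h0) ((A.mem_quasiInvariants_iff p).mp hp))
  rintro _ ⟨q, rfl⟩
  exact hW.conj_taylor q.1 q.2

lemma exists_apply_eq_integral_contourDensity {φ : (Fin n → ℂ) → (Fin n → ℂ) → ℂ}
    {S : Finset (Fin n →₀ ℕ)} {c : (Fin n →₀ ℕ) → MvPolynomial (Fin n) ℂ}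
    (hS : ∀ a ∈ S, a.degree < A.totalMult) (hW : A.IsBANum (A.biNum S c))
    (h0 : eval 0 (A.biNum S c) ≠ 0)
    (hφ : ∀ x lam, φ x lam =
      eval (Sum.elim lam x) (A.biNum S c) * Complex.exp (pairing lam x))
    {p q : MvPolynomial (Fin n) ℝ} (hp : p ∈ A.quasiInvariants) (hq : q ∈ A.quasiInvariants)
    {D : RatDiffOp n} (hD : D.IsAssociated φ p) :
    ∃ r : MvPolynomial (Fin n) ℝ,
      (∀ x, eval x D.den ≠ 0 → D.apply (fun y => aeval y q) x = aeval x r) ∧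
      ∀ ξ : Fin n → ℝ, toComplex ξ ∈ A.regular →
        (Integrable (A.contourDensity (A.expHalfL fun y => aeval y p)
            (A.expHalfL fun y => aeval y q) ξ) ∧
          ((eval 0 r : ℝ) : ℂ) = eval 0 (A.biNum S c) * ∫ y : Fin n → ℝ,
            A.contourDensity (A.expHalfL fun y => aeval y p)
              (A.expHalfL fun y => aeval y q) ξ y) ∧
        (A.IsHarmonic p → A.IsHarmonic q →
          Integrable (A.contourDensity (fun y => aeval y p) (fun y => aeval y q) ξ) ∧
          ((eval 0 r : ℝ) : ℂ) = eval 0 (A.biNum S c) * ∫ y : Fin n → ℝ,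
            A.contourDensity (fun y => aeval y p) (fun y => aeval y q) ξ y) := by
  obtain ⟨p', hpp', hp'⟩ := exists_expChain_gaussInt hS hW h0 (mem_span_real_taylor hS hW h0 hp)
  obtain ⟨r, q', hr, hqq', hDr, hint⟩ := exists_apply_eq hW h0 (conj_map_algebraMap p)
    ((isAssociated_iff hφ D p).mp hD) hp' (mem_span_real_taylor hS hW h0 hq)
  obtain ⟨r, rfl⟩ := exists_real_of_conj_eq hr
  have hr0 : eval 0 (map (algebraMap ℝ ℂ) r) = ((eval 0 r : ℝ) : ℂ) := by
    have h := eval₂_comp_left (algebraMap ℝ ℂ) (RingHom.id ℝ) 0 r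
    rw [eval_map]
    have hz : (algebraMap ℝ ℂ) ∘ (0 : Fin n → ℝ) = 0 := by ext; simp
    rw [hz, RingHom.comp_id] at h
    exact h.symm
  simp only [hr0] at hint
  simp only [eval_map_algebraMap] at hDr
  simp only [← eval_map_algebraMap]
  refine ⟨r, by simpa only [eval_map_algebraMap] using hDr, fun ξ hξ => ⟨?_, fun hpL hqL => ?_⟩⟩
  · exact integrable_and_integral_contourDensity hξ (fun x hx => hpp'.expHalfL_eq hx)
      (fun x hx => hqq'.expHalfL_eq hx) (hint ξ hξ)
  · simp only [IsHarmonic, ← eval_map_algebraMap] at hpL hqL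
    have hint := hint ξ hξ
    rw [hpp'.eq_of_harmonic hpL, hqq'.eq_of_harmonic hqL] at hint
    exact integrable_and_integral_contourDensity hξ (fun x _ => rfl) (fun x _ => rfl) hint

end Arrangement

end BakerAkhiezer

end

theorem mainTheorem6 {n : ℕ} {ι : Type*} [Fintype ι] (A : Arrangement n ι)
    (φ : (Fin n → ℂ) → (Fin n → ℂ) → ℂ) (hφ : A.IsBakerAkhiezer φ) (h0 : φ 0 0 ≠ 0) :
    -- every quasi-invariant `p` has an operator `L_p`, and `exp (L/2) p` is a finite sum
    (∀ p ∈ A.quasiInvariants,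
      (∃ D : RatDiffOp n, D.IsAssociated φ p) ∧
      ∃ N : ℕ, ∀ k ≥ N, ∀ x ∈ A.regular, A.L^[k] (fun y => MvPolynomial.aeval y p) x = 0) ∧
    -- `L_p q` is a real polynomial `r`, so that `(p, q) = (L_p q)(0) = r(0)`
    ∀ p ∈ A.quasiInvariants, ∀ q ∈ A.quasiInvariants,
      ∀ D : RatDiffOp n, D.IsAssociated φ p →
        ∃ r : MvPolynomial (Fin n) ℝ,
          (∀ x : Fin n → ℂ, MvPolynomial.eval x D.den ≠ 0 →
            D.apply (fun y => MvPolynomial.aeval y q) x = MvPolynomial.aeval x r) ∧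
          ∀ ξ : Fin n → ℝ, toComplex ξ ∈ A.regular →
            (Integrable (A.contourDensity (A.expHalfL fun y => MvPolynomial.aeval y p)
                (A.expHalfL fun y => MvPolynomial.aeval y q) ξ) ∧
              ((MvPolynomial.eval 0 r : ℝ) : ℂ) =
                φ 0 0 * ∫ y : Fin n → ℝ,
                  A.contourDensity (A.expHalfL fun y => MvPolynomial.aeval y p)
                    (A.expHalfL fun y => MvPolynomial.aeval y q) ξ y) ∧
            (A.IsHarmonic p → A.IsHarmonic q →
              Integrable (A.contourDensity (fun y => MvPolynomial.aeval y p)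
                (fun y => MvPolynomial.aeval y q) ξ) ∧
              ((MvPolynomial.eval 0 r : ℝ) : ℂ) =
                φ 0 0 * ∫ y : Fin n → ℝ,
                  A.contourDensity (fun y => MvPolynomial.aeval y p)
                    (fun y => MvPolynomial.aeval y q) ξ y) := by
  obtain ⟨S, c, hS, hW, he, hφeq⟩ := hφ.exists_isBANum h0
  rw [← he] at h0 ⊢
  refine ⟨fun p hp => ⟨?_, ?_⟩, fun p hp q hq D hD =>
    Arrangement.exists_apply_eq_integral_contourDensity hS hW h0 hφeq hp hq hD⟩
  · obtain ⟨D, hD⟩ := hW.exists_operator ((A.mem_quasiInvariants_iff p).mp hp)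
    exact ⟨D, (Arrangement.isAssociated_iff hφeq D p).mpr hD⟩
  · obtain ⟨p', hpp', -⟩ := Arrangement.exists_expChain_gaussInt hS hW h0
      (Arrangement.mem_span_real_taylor hS hW h0 hp)
    simpa only [eval_map_algebraMap] using hpp'.iterate_eq_zero
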